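/- Let $\Psi\colon[0,\infty)\to[0,\infty)$ be an Orlicz function, i.e. $\Psi$ is non-decreasing, strictly convex, continuous at $0$, $\Psi(0)=0$ and $\Psi(x)/x\to\infty$ as $x\to\infty$. Let $m$ be the normalized Lebesgue measure on the unit circle $\mathbb T$ and $\mathbb D$ the open unit disk. Let $L^\Psi(\mathbb T)$ be the space of (classes of) measurable $f\colon\mathbb T\to\mathbb C$ with $\int_{\mathbb T}\Psi(|f|/C)\,dm<\infty$ for some $C>0$, with the Luxemburg norm $\|f\|_\Psi=\inf\{C>0:\int_{\mathbb T}\Psi(|f|/C)\,dm\le 1\}$, and $M^\Psi(\mathbb T)$ the subspace of those $f$ for which this integral is finite for every $C>0$. Let $H^\Psi$ be the space of analytic functions $f(z)=\sum_{n\ge0}\widehat{f^*}(n)z^n$ on $\mathbb D$ with boundary function $f^*\in L^\Psi(\mathbb T)$ such that $\widehat{f^*}(n)=0$ for $n<0$, normed by $\|f\|=\|f^*\|_\Psi$. Assume that $\Psi\in\Delta^2$: there is $\alpha>1$ such that $\Psi(x)^2\le\Psi(\alpha x)$ for all $x$ large enough. Then there is an analytic map $\phi\colon\mathbb D\to\mathbb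 D$ such that the composition operator $C_\phi\colon f\mapsto f\circ\phi$ is a bounded operator $H^\Psi\to H^\Psi$ with the following properties: 1. $C_\phi$ is order bounded into $M^\Psi(\mathbb T)$: there is $y\ge0$ in $M^\Psi(\mathbb T)$ such that $|(f\circ\phi)^*|\le y$ a.e. on $\mathbb T$ for every $f\in H^\Psi$ with $\|f\|\le1$; 2. $C_\phi$ is compact; 3. for no real $p\ge1$ is $C_\phi$ $p$-summing, i.e. for no $p\ge 1$ is there a constant $C>0$ such that $$\sum_{k=1}^n\|C_\phi f_k\|^p\le C^p\sup_{\xi\in (H^\Psi)^*,\ \|\xi\|\le1}\ \sum_{k=1}^n|\xi(f_k)|^p$$ for all $n$ and all $f_1,\dots,f_n\in H^\Psi$. Moreover, $\phi$ can be taken to be an outer function with piecewise constant modulus, $$\phi(z)=\exp\Big(\int_{\mathbb T}\frac{u+z}{u-z}\,\log h(u)\,dm(u)\Big),\qquad h=\sum_{n}r_n\mathbf 1_{B_n},\quad \log h\in L^1(\mathbb T),$$ where $(B_n)$ is a countable partition of $\mathbb T$ into measurable sets and $0<r_n<1$. -/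

import Mathlib

noncomputable section

open MeasureTheory Set Filter Topology

namespace HardyOrlicz

/-! ### Orlicz functions -/

/-- An Orlicz function: a non-decreasing, strictly convex `Ψ : [0, ∞) → [0, ∞)`, continuous at `0`,
with `Ψ 0 = 0` and `Ψ x / x → ∞` as `x → ∞`. Only the values on `[0, ∞)` matter; they are
nonnegative because `Ψ` is non-decreasing and `Ψ 0 = 0`. -/
structure OrliczFunction where
  /-- the underlying function -/
  toFun : ℝ → ℝ
  map_zero : toFun 0 = 0
  monotoneOn : MonotoneOn toFun (Ici 0)
  continuousWithinAt_zero : ContinuousWithinAt toFun (Ici 0) 0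
  strictConvexOn : StrictConvexOn ℝ (Ici 0) toFun
  tendsto_div_atTop : Tendsto (fun x => toFun x / x) atTop atTop

instance : CoeFun OrliczFunction (fun _ => ℝ → ℝ) := ⟨OrliczFunction.toFun⟩

namespace OrliczFunction

/-- The fast growth condition `Δ²`: for some `α > 1`, `Ψ(x)² ≤ Ψ(α x)` for all large `x`. -/
def DeltaSupTwo (Ψ : OrliczFunction) : Prop :=
  ∃ α : ℝ, 1 < α ∧ ∀ᶠ x in atTop, (Ψ x) ^ 2 ≤ Ψ (α * x)

theorem nonneg (Ψ : OrliczFunction) {x : ℝ} (hx : 0 ≤ x) : 0 ≤ Ψ x := by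
  have h := Ψ.monotoneOn (mem_Ici.2 le_rfl) (mem_Ici.2 hx) hx
  rwa [Ψ.map_zero] at h

theorem convex_comb (Ψ : OrliczFunction) {x y a b : ℝ} (hx : 0 ≤ x) (hy : 0 ≤ y) (ha : 0 ≤ a)
    (hb : 0 ≤ b) (hab : a + b = 1) : Ψ (a * x + b * y) ≤ a * Ψ x + b * Ψ y := by
  have h := Ψ.strictConvexOn.convexOn.2 (mem_Ici.2 hx) (mem_Ici.2 hy) ha hb hab
  simpa [smul_eq_mul] using h

theorem mul_le (Ψ : OrliczFunction) {x a : ℝ} (hx : 0 ≤ x) (ha : 0 ≤ a) (ha1 : a ≤ 1) :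
    Ψ (a * x) ≤ a * Ψ x := by
  have h := Ψ.convex_comb hx le_rfl ha (sub_nonneg.2 ha1) (by ring)
  simpa [Ψ.map_zero] using h

theorem pos (Ψ : OrliczFunction) {x : ℝ} (hx : 0 < x) : 0 < Ψ x := by
  have h := Ψ.strictConvexOn.2 (mem_Ici.2 le_rfl) (mem_Ici.2 hx.le) hx.ne
    (by norm_num : (0 : ℝ) < 1 / 2) (by norm_num : (0 : ℝ) < 1 / 2) (by norm_num)
  simp only [smul_eq_mul, Ψ.map_zero, mul_zero, zero_add] at h
  have h0 : 0 ≤ Ψ (1 / 2 * x) := Ψ.nonneg (by positivity)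
  linarith

theorem measurable_max (Ψ : OrliczFunction) : Measurable fun x : ℝ => Ψ (max x 0) :=
  Monotone.measurable fun _ _ hxy =>
    Ψ.monotoneOn (mem_Ici.2 (le_max_right _ _)) (mem_Ici.2 (le_max_right _ _))
      (max_le_max hxy le_rfl)

end OrliczFunction

/-! ### Orlicz spaces and Morse–Transue spaces -/

section Orlicz

variable {Ω : Type*} [MeasurableSpace Ω]

/-- `∫ Ψ(|f| / C) dμ`, as an element of `[0, ∞]`. -/
def modular (Ψ : OrliczFunction) (μ : Measure Ω) (f : Ω → ℂ) (C : ℝ) : ENNReal :=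
  ∫⁻ t, ENNReal.ofReal (Ψ (‖f t‖ / C)) ∂μ

/-- The Luxemburg norm: the infimum of all `C > 0` with `∫ Ψ(|f| / C) dμ ≤ 1`. -/
def luxemburgNorm (Ψ : OrliczFunction) (μ : Measure Ω) (f : Ω → ℂ) : ℝ :=
  sInf {C : ℝ | 0 < C ∧ modular Ψ μ f C ≤ 1}

variable {Ψ : OrliczFunction} {μ : Measure Ω}

theorem modular_congr {f g : Ω → ℂ} (h : f =ᵐ[μ] g) (C : ℝ) :
    modular Ψ μ f C = modular Ψ μ g C :=
  lintegral_congr_ae (by filter_upwards [h] with t ht; rw [ht])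

theorem luxemburgNorm_congr {f g : Ω → ℂ} (h : f =ᵐ[μ] g) :
    luxemburgNorm Ψ μ f = luxemburgNorm Ψ μ g := by
  simp only [luxemburgNorm, modular_congr h]

theorem aemeasurable_modular {f : Ω → ℂ} (hf : AEStronglyMeasurable f μ) {C : ℝ} (hC : 0 < C) :
    AEMeasurable (fun t => ENNReal.ofReal (Ψ (‖f t‖ / C))) μ := by
  have h : AEMeasurable (fun t => ENNReal.ofReal (Ψ (max (‖f t‖ / C) 0))) μ :=
    (Ψ.measurable_max.comp_aemeasurable (hf.norm.aemeasurable.div_const C)).ennreal_ofReal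
  refine h.congr (Eventually.of_forall fun t => ?_)
  have : (0 : ℝ) ≤ ‖f t‖ / C := by positivity
  simp only [max_eq_left this]

theorem modular_zero (C : ℝ) : modular Ψ μ (0 : Ω → ℂ) C = 0 := by
  simp [modular, Ψ.map_zero]

theorem modular_add_le {f g : Ω → ℂ} (hf : AEStronglyMeasurable f μ) {a b : ℝ}
    (ha : 0 < a) (hb : 0 < b) :
    modular Ψ μ (f + g) (a + b) ≤
      ENNReal.ofReal (a / (a + b)) * modular Ψ μ f a +
        ENNReal.ofReal (b / (a + b)) * modular Ψ μ g b := by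
  have hab : 0 < a + b := by positivity
  unfold modular
  rw [← lintegral_const_mul' _ _ ENNReal.ofReal_ne_top,
    ← lintegral_const_mul' _ _ ENNReal.ofReal_ne_top,
    ← lintegral_add_left' ((aemeasurable_modular hf ha).const_mul _)]
  refine lintegral_mono fun t => ?_
  have hfa : 0 ≤ ‖f t‖ / a := by positivity
  have hgb : 0 ≤ ‖g t‖ / b := by positivity
  have h1 : ‖(f + g) t‖ / (a + b) ≤ a / (a + b) * (‖f t‖ / a) + b / (a + b) * (‖g t‖ / b) := by
    have : a / (a + b) * (‖f t‖ / a) + b / (a + b) * (‖g t‖ / b) = (‖f t‖ + ‖g t‖) / (a + b) := by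
      field_simp
    rw [this]
    gcongr
    exact norm_add_le _ _
  have h2 := Ψ.monotoneOn (mem_Ici.2 (by positivity)) (mem_Ici.2 (by positivity)) h1
  have h3 := Ψ.convex_comb hfa hgb (by positivity : 0 ≤ a / (a + b))
    (by positivity : 0 ≤ b / (a + b)) (by field_simp)
  rw [← ENNReal.ofReal_mul (by positivity), ← ENNReal.ofReal_mul (by positivity),
    ← ENNReal.ofReal_add (mul_nonneg (by positivity) (Ψ.nonneg hfa))
      (mul_nonneg (by positivity) (Ψ.nonneg hgb))]
  exact ENNReal.ofReal_le_ofReal (h2.trans h3)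

theorem modular_mul_le (f : Ω → ℂ) {C K : ℝ} (hC : 0 < C) (hK : 1 ≤ K) :
    modular Ψ μ f (K * C) ≤ ENNReal.ofReal K⁻¹ * modular Ψ μ f C := by
  have hK0 : 0 < K := by linarith
  unfold modular
  rw [← lintegral_const_mul' _ _ ENNReal.ofReal_ne_top]
  refine lintegral_mono fun t => ?_
  rw [← ENNReal.ofReal_mul (by positivity)]
  refine ENNReal.ofReal_le_ofReal ?_
  have h := Ψ.mul_le (x := ‖f t‖ / C) (a := K⁻¹) (by positivity) (by positivity)
    (inv_le_one_of_one_le₀ hK)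
  have he : ‖f t‖ / (K * C) = K⁻¹ * (‖f t‖ / C) := by field_simp
  rwa [he]

theorem modular_smul (f : Ω → ℂ) {c : ℂ} (hc : c ≠ 0) (C : ℝ) :
    modular Ψ μ (c • f) (‖c‖ * C) = modular Ψ μ f C := by
  have hc' : ‖c‖ ≠ 0 := norm_ne_zero_iff.2 hc
  unfold modular
  congr 1 with t
  rw [Pi.smul_apply, norm_smul, mul_div_mul_left _ _ hc']

variable (Ψ μ)

/-- The Orlicz space `L^Ψ(μ)`: classes of measurable functions `f` such that
`∫ Ψ(|f| / C) dμ < ∞` for some `C > 0`. -/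
def orliczSpace : Submodule ℂ (Ω →ₘ[μ] ℂ) where
  carrier := {f | ∃ C : ℝ, 0 < C ∧ modular Ψ μ f C < ⊤}
  zero_mem' := ⟨1, one_pos, by
    rw [modular_congr (g := 0) AEEqFun.coeFn_zero, modular_zero]; exact ENNReal.zero_lt_top⟩
  add_mem' := by
    rintro f g ⟨a, ha, hfa⟩ ⟨b, hb, hgb⟩
    refine ⟨a + b, by positivity, ?_⟩
    rw [modular_congr (AEEqFun.coeFn_add f g)]
    exact (modular_add_le f.aestronglyMeasurable ha hb).trans_lt (ENNReal.add_lt_top.2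
      ⟨ENNReal.mul_lt_top ENNReal.ofReal_lt_top hfa, ENNReal.mul_lt_top ENNReal.ofReal_lt_top hgb⟩)
  smul_mem' := by
    rintro c f ⟨a, ha, hfa⟩
    by_cases hc : c = 0
    · refine ⟨1, one_pos, ?_⟩
      rw [hc, zero_smul, modular_congr (g := 0) AEEqFun.coeFn_zero, modular_zero]
      exact ENNReal.zero_lt_top
    · refine ⟨‖c‖ * a, mul_pos (norm_pos_iff.2 hc) ha, ?_⟩
      rw [modular_congr (AEEqFun.coeFn_smul c f), modular_smul _ hc]
      exact hfa

/-- The Morse–Transue space `M^Ψ(μ)`: those `f ∈ L^Ψ(μ)` with `∫ Ψ(|f| / C) dμ < ∞` for every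
`C > 0`. -/
def morseTransue : Submodule ℂ (orliczSpace Ψ μ) where
  carrier := {f | ∀ C : ℝ, 0 < C → modular Ψ μ f.1 C < ⊤}
  zero_mem' := fun C _ => by
    have h : ((0 : orliczSpace Ψ μ).1 : Ω → ℂ) =ᵐ[μ] 0 := AEEqFun.coeFn_zero
    rw [modular_congr h, modular_zero]; exact ENNReal.zero_lt_top
  add_mem' := by
    intro f g hf hg C hC
    have h : ((f + g).1 : Ω → ℂ) =ᵐ[μ] f.1 + g.1 := AEEqFun.coeFn_add f.1 g.1
    rw [modular_congr h, ← add_halves C]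
    exact (modular_add_le f.1.aestronglyMeasurable (half_pos hC) (half_pos hC)).trans_lt
      (ENNReal.add_lt_top.2
        ⟨ENNReal.mul_lt_top ENNReal.ofReal_lt_top (hf _ (half_pos hC)),
          ENNReal.mul_lt_top ENNReal.ofReal_lt_top (hg _ (half_pos hC))⟩)
  smul_mem' := by
    intro c f hf C hC
    have h : ((c • f).1 : Ω → ℂ) =ᵐ[μ] c • f.1 := AEEqFun.coeFn_smul c f.1
    rw [modular_congr h]
    by_cases hc : c = 0
    · rw [hc, zero_smul, modular_zero]; exact ENNReal.zero_lt_top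
    · have hc' : 0 < ‖c‖ := norm_pos_iff.2 hc
      have := modular_smul (Ψ := Ψ) (μ := μ) f.1 hc (C / ‖c‖)
      rw [mul_div_cancel₀ _ hc'.ne'] at this
      rw [this]
      exact hf _ (div_pos hC hc')

variable {Ψ μ}

theorem exists_modular_le_one (f : orliczSpace Ψ μ) : ∃ C : ℝ, 0 < C ∧ modular Ψ μ f.1 C ≤ 1 := by
  obtain ⟨C, hC, hfin⟩ := f.2
  set M : ℝ := (modular Ψ μ f.1 C).toReal with hM
  have hM0 : 0 ≤ M := ENNReal.toReal_nonneg
  refine ⟨(1 + M) * C, by positivity, (modular_mul_le _ hC (by linarith)).trans ?_⟩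
  rw [← ENNReal.ofReal_toReal hfin.ne, ← hM, ← ENNReal.ofReal_mul (by positivity),
    ENNReal.ofReal_le_one, inv_mul_le_iff₀ (by positivity)]
  linarith

theorem luxemburgNorm_set_bddBelow (f : Ω → ℂ) :
    BddBelow {C : ℝ | 0 < C ∧ modular Ψ μ f C ≤ 1} := ⟨0, fun _ hC => hC.1.le⟩

theorem luxemburgNorm_nonneg (f : Ω → ℂ) : 0 ≤ luxemburgNorm Ψ μ f :=
  Real.sInf_nonneg fun _ hC => hC.1.le

theorem luxemburgNorm_zero : luxemburgNorm Ψ μ (0 : Ω → ℂ) = 0 := by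
  refine le_antisymm (le_of_forall_pos_le_add fun ε hε => ?_) (luxemburgNorm_nonneg _)
  rw [zero_add]
  exact csInf_le (luxemburgNorm_set_bddBelow _) ⟨hε, by rw [modular_zero]; exact zero_le_one⟩

theorem luxemburgNorm_add_le (f g : orliczSpace Ψ μ) :
    luxemburgNorm Ψ μ (f + g).1 ≤ luxemburgNorm Ψ μ f.1 + luxemburgNorm Ψ μ g.1 := by
  refine le_of_forall_pos_le_add fun ε hε => ?_
  obtain ⟨a, ⟨ha, hfa⟩, hae⟩ := Real.lt_sInf_add_pos (exists_modular_le_one f) (half_pos hε)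
  obtain ⟨b, ⟨hb, hgb⟩, hbe⟩ := Real.lt_sInf_add_pos (exists_modular_le_one g) (half_pos hε)
  have h : ((f + g).1 : Ω → ℂ) =ᵐ[μ] f.1 + g.1 := AEEqFun.coeFn_add f.1 g.1
  have hab : modular Ψ μ (f + g).1 (a + b) ≤ 1 := by
    rw [modular_congr h]
    calc _ ≤ _ := modular_add_le f.1.aestronglyMeasurable ha hb
      _ ≤ ENNReal.ofReal (a / (a + b)) * 1 + ENNReal.ofReal (b / (a + b)) * 1 := by gcongr
      _ = 1 := by
        rw [mul_one, mul_one, ← ENNReal.ofReal_add (by positivity) (by positivity), ← add_div,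
          div_self (by positivity), ENNReal.ofReal_one]
  have h1 : luxemburgNorm Ψ μ (f + g).1 ≤ a + b :=
    csInf_le (luxemburgNorm_set_bddBelow _) ⟨by positivity, hab⟩
  have h2 : a < luxemburgNorm Ψ μ f.1 + ε / 2 := hae
  have h3 : b < luxemburgNorm Ψ μ g.1 + ε / 2 := hbe
  linarith

theorem luxemburgNorm_smul_le (c : ℂ) (f : orliczSpace Ψ μ) :
    luxemburgNorm Ψ μ (c • f).1 ≤ ‖c‖ * luxemburgNorm Ψ μ f.1 := by
  have h : ((c • f).1 : Ω → ℂ) =ᵐ[μ] c • f.1 := AEEqFun.coeFn_smul c f.1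
  rw [luxemburgNorm_congr h]
  by_cases hc : c = 0
  · rw [hc, zero_smul, luxemburgNorm_zero, norm_zero, zero_mul]
  · have hc' : 0 < ‖c‖ := norm_pos_iff.2 hc
    rw [← div_le_iff₀' hc']
    refine le_csInf (exists_modular_le_one f) fun a ha => ?_
    rw [div_le_iff₀' hc']
    exact csInf_le (luxemburgNorm_set_bddBelow _)
      ⟨mul_pos hc' ha.1, by rw [modular_smul _ hc]; exact ha.2⟩

theorem luxemburgNorm_neg (f : orliczSpace Ψ μ) :
    luxemburgNorm Ψ μ (-f).1 = luxemburgNorm Ψ μ f.1 := by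
  have h : ((-f).1 : Ω → ℂ) =ᵐ[μ] -f.1 := AEEqFun.coeFn_neg f.1
  rw [luxemburgNorm_congr h]
  simp only [luxemburgNorm, modular, Pi.neg_apply, norm_neg]

theorem eq_zero_of_luxemburgNorm_eq_zero (f : orliczSpace Ψ μ)
    (hf : luxemburgNorm Ψ μ f.1 = 0) : f = 0 := by
  have key : ∀ ε : ℝ, 0 < ε → ε ≤ 1 → modular Ψ μ f.1 1 ≤ ENNReal.ofReal ε := by
    intro ε hε hε1
    obtain ⟨a, ⟨ha, hfa⟩, hae⟩ := Real.lt_sInf_add_pos (exists_modular_le_one f) hε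
    have h0 : sInf {C : ℝ | 0 < C ∧ modular Ψ μ f.1 C ≤ 1} = 0 := hf
    replace hae : a < ε := by
      have : a < sInf {C : ℝ | 0 < C ∧ modular Ψ μ f.1 C ≤ 1} + ε := hae
      rwa [h0, zero_add] at this
    have h1 := modular_mul_le (Ψ := Ψ) (μ := μ) f.1 ha (K := a⁻¹)
      ((one_le_inv₀ ha).2 (hae.le.trans hε1))
    rw [inv_mul_cancel₀ ha.ne', inv_inv] at h1
    calc _ ≤ _ := h1
      _ ≤ ENNReal.ofReal ε * 1 := by gcongr
      _ = _ := mul_one _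
  have hz : modular Ψ μ f.1 1 = 0 := by
    refine le_antisymm (le_of_forall_pos_le_add fun ε hε => ?_) zero_le
    rw [zero_add]
    by_cases ht : min ε 1 = ⊤
    · simp at ht
    have hm : 0 < min ε 1 := lt_min hε one_pos
    have h1 : (min ε 1).toReal ≤ 1 := by
      have := ENNReal.toReal_mono ENNReal.one_ne_top (min_le_right ε 1)
      simpa using this
    have := key _ (ENNReal.toReal_pos hm.ne' ht) h1
    rw [ENNReal.ofReal_toReal ht] at this
    exact this.trans (min_le_left _ _)
  have hae := (lintegral_eq_zero_iff'
    (aemeasurable_modular (Ψ := Ψ) f.1.aestronglyMeasurable one_pos)).1 hz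
  have h0 : (f.1 : Ω → ℂ) =ᵐ[μ] (0 : Ω →ₘ[μ] ℂ) := by
    filter_upwards [hae, AEEqFun.coeFn_zero (α := Ω) (μ := μ) (β := ℂ)] with t ht ht0
    rw [ht0]
    by_contra hne
    have hpos : 0 < ‖f.1 t‖ / 1 := by
      rw [div_one]; exact norm_pos_iff.2 hne
    have := Ψ.pos hpos
    simp only [Pi.zero_apply, ENNReal.ofReal_eq_zero] at ht
    linarith
  exact Subtype.ext (AEEqFun.ext h0)

/-- `L^Ψ(μ)` is normed by the Luxemburg norm. -/
instance : NormedAddCommGroup (orliczSpace Ψ μ) :=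
  AddGroupNorm.toNormedAddCommGroup
    { toFun := fun f => luxemburgNorm Ψ μ f.1
      map_zero' := by
        have h : ((0 : orliczSpace Ψ μ).1 : Ω → ℂ) =ᵐ[μ] 0 := AEEqFun.coeFn_zero
        rw [luxemburgNorm_congr h, luxemburgNorm_zero]
      add_le' := luxemburgNorm_add_le
      neg' := luxemburgNorm_neg
      eq_zero_of_map_eq_zero' := eq_zero_of_luxemburgNorm_eq_zero }

theorem norm_def (f : orliczSpace Ψ μ) : ‖f‖ = luxemburgNorm Ψ μ f.1 := rfl

instance : NormedSpace ℂ (orliczSpace Ψ μ) where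
  norm_smul_le := luxemburgNorm_smul_le

theorem integrable_of_mem_orliczSpace [IsFiniteMeasure μ] (f : orliczSpace Ψ μ) :
    Integrable f.1 μ := by
  obtain ⟨C, hC, hfin⟩ := f.2
  obtain ⟨x₀, hx₀⟩ := eventually_atTop.1 (Ψ.tendsto_div_atTop.eventually_ge_atTop 1)
  refine ⟨f.1.aestronglyMeasurable, ?_⟩
  set K : ℝ := max x₀ 1 with hK
  have hK0 : 0 < K := lt_max_of_lt_right one_pos
  have hpt : ∀ t, ‖f.1 t‖ₑ ≤
      ENNReal.ofReal (C * K) + ENNReal.ofReal C * ENNReal.ofReal (Ψ (‖f.1 t‖ / C)) := by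
    intro t
    have hx : 0 ≤ ‖f.1 t‖ / C := by positivity
    rw [← ENNReal.ofReal_mul hC.le, ← ENNReal.ofReal_add (by positivity)
      (mul_nonneg hC.le (Ψ.nonneg hx)), ← ofReal_norm]
    refine ENNReal.ofReal_le_ofReal ?_
    have hle : ‖f.1 t‖ / C ≤ K + Ψ (‖f.1 t‖ / C) := by
      rcases le_total (‖f.1 t‖ / C) K with h | h
      · linarith [Ψ.nonneg hx]
      · have hp : 0 < ‖f.1 t‖ / C := hK0.trans_le h
        have := hx₀ _ ((le_max_left _ _).trans h)
        rw [le_div_iff₀ hp, one_mul] at this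
        exact this.trans (le_add_of_nonneg_left hK0.le)
    rw [div_le_iff₀ hC] at hle
    linarith
  refine (lintegral_mono hpt).trans_lt ?_
  rw [lintegral_add_left measurable_const, lintegral_const,
    lintegral_const_mul' _ _ ENNReal.ofReal_ne_top]
  exact ENNReal.add_lt_top.2 ⟨ENNReal.mul_lt_top ENNReal.ofReal_lt_top (measure_lt_top _ _),
    ENNReal.mul_lt_top ENNReal.ofReal_lt_top hfin⟩

end Orlicz

/-! ### Hardy–Orlicz spaces on the unit disk -/

instance two_pi_pos_fact : Fact (0 < 2 * Real.pi) := ⟨Real.two_pi_pos⟩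

/-- The unit circle `𝕋`, parametrised by the angle `t ∈ ℝ / 2πℤ`; the point of `ℂ` with angle `t`
is `AddCircle.toCircle t = exp (i t)`. -/
abbrev Torus : Type := AddCircle (2 * Real.pi)

/-- The normalised Haar measure `m = dt / 2π` on `𝕋`. -/
abbrev haarT : Measure Torus := AddCircle.haarAddCircle

/-- The open unit disk. -/
abbrev disk : Set ℂ := Metric.ball 0 1

/-- The Hardy–Orlicz space `H^Ψ`, given by its boundary functions: the subspace of `L^Ψ(𝕋)` of the
functions whose Fourier coefficients of negative index vanish, with the norm of `L^Ψ(𝕋)`. The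
analytic function on the disk that belongs to `f` is `diskExt f`. -/
def hardyOrlicz (Ψ : OrliczFunction) : Submodule ℂ (orliczSpace Ψ haarT) where
  carrier := {f | ∀ n : ℤ, n < 0 → fourierCoeff (f.1 : Torus → ℂ) n = 0}
  zero_mem' := fun n _ => by
    have h : ((0 : orliczSpace Ψ haarT).1 : Torus → ℂ) =ᵐ[haarT] 0 := AEEqFun.coeFn_zero
    rw [fourierCoeff_congr_ae h]
    simp [fourierCoeff]
  add_mem' := by
    intro f g hf hg n hn
    have h : ((f + g).1 : Torus → ℂ) =ᵐ[haarT] f.1 + g.1 := AEEqFun.coeFn_add f.1 g.1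
    rw [fourierCoeff_congr_ae h, fourierCoeff.add (integrable_of_mem_orliczSpace f)
      (integrable_of_mem_orliczSpace g), Pi.add_apply, hf n hn, hg n hn, add_zero]
  smul_mem' := by
    intro c f hf n hn
    have h : ((c • f).1 : Torus → ℂ) =ᵐ[haarT] c • f.1 := AEEqFun.coeFn_smul c f.1
    rw [fourierCoeff_congr_ae h, fourierCoeff.const_smul, hf n hn, smul_zero]

/-- The boundary function of an element of `H^Ψ`. -/
def boundary {Ψ : OrliczFunction} (f : hardyOrlicz Ψ) : Torus → ℂ := f.1.1

/-- The analytic function `z ↦ ∑_{n ≥ 0} f̂(n) zⁿ` on the unit disk that belongs to `f ∈ H^Ψ`. -/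
def diskExt {Ψ : OrliczFunction} (f : hardyOrlicz Ψ) (z : ℂ) : ℂ :=
  ∑' n : ℕ, fourierCoeff (boundary f) (n : ℤ) * z ^ n

/-- `T` is the composition operator `C_φ : f ↦ f ∘ φ` on `H^Ψ`. -/
def IsCompositionOperator {Ψ : OrliczFunction} (φ : ℂ → ℂ)
    (T : hardyOrlicz Ψ →L[ℂ] hardyOrlicz Ψ) : Prop :=
  ∀ f : hardyOrlicz Ψ, ∀ z ∈ disk, diskExt (T f) z = diskExt f (φ z)

/-- `T : H^Ψ → H^Ψ` is order bounded into `M^Ψ(𝕋)`: there is `y ≥ 0` in `M^Ψ(𝕋)` such that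
`|T f| ≤ y` almost everywhere on `𝕋`, for every `f` in the unit ball of `H^Ψ`. -/
def IsOrderBoundedIntoMorseTransue {Ψ : OrliczFunction}
    (T : hardyOrlicz Ψ →L[ℂ] hardyOrlicz Ψ) : Prop :=
  ∃ y ∈ morseTransue Ψ haarT,
    (∀ᵐ t ∂haarT, 0 ≤ (y.1 t).re ∧ (y.1 t).im = 0) ∧
      ∀ f : hardyOrlicz Ψ, ‖f‖ ≤ 1 → ∀ᵐ t ∂haarT, ‖boundary (T f) t‖ ≤ (y.1 t).re

/-- `T : X → Y` is `p`-summing: there is `C > 0` such that, for all `x₁, …, xₙ` in `X`,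
`∑ ‖T x_k‖^p ≤ C^p sup_{‖x*‖ ≤ 1} ∑ |x*(x_k)|^p`. (The supremum is over a nonempty set, bounded
above by `∑ ‖x_k‖^p`.) -/
def IsPSumming {X Y : Type*} [NormedAddCommGroup X] [NormedSpace ℂ X]
    [NormedAddCommGroup Y] [NormedSpace ℂ Y] (p : ℝ) (T : X →L[ℂ] Y) : Prop :=
  ∃ C : ℝ, 0 < C ∧ ∀ (n : ℕ) (x : Fin n → X),
    ∑ k, ‖T (x k)‖ ^ p ≤
      C ^ p * ⨆ ξ : {ξ : StrongDual ℂ X // ‖ξ‖ ≤ 1}, ∑ k, ‖ξ.1 (x k)‖ ^ p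

/-- `h : 𝕋 → ℝ` is piecewise constant, `h = ∑_n r_n 𝟙_{B_n}` for a partition of `𝕋` into
measurable sets `B_n`, with values `r_n ∈ (0, 1)`. -/
def IsPiecewiseConstant (h : Torus → ℝ) : Prop :=
  ∃ (r : ℕ → ℝ) (B : ℕ → Set Torus), (∀ n, 0 < r n ∧ r n < 1) ∧
    (∀ n, MeasurableSet (B n)) ∧ Pairwise (Function.onFun Disjoint B) ∧ (⋃ n, B n) = univ ∧
      ∀ n, ∀ t ∈ B n, h t = r n

/-- On the unit disk, `φ` is the outer function with boundary modulus `h`, where `log h ∈ L¹(𝕋)`: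
`φ(z) = exp ∫ (u + z) / (u - z) log h(u) dm(u)`. -/
def IsOuterWithModulus (φ : ℂ → ℂ) (h : Torus → ℝ) : Prop :=
  Integrable (fun t => Real.log (h t)) haarT ∧
    ∀ z ∈ disk, φ z = Complex.exp (∫ t : Torus,
      ((AddCircle.toCircle t : ℂ) + z) / ((AddCircle.toCircle t : ℂ) - z) * (Real.log (h t) : ℂ)
        ∂haarT)

end HardyOrlicz

end

noncomputable section

open MeasureTheory Set Filter Topology

namespace HardyOrlicz

/-! The growth hypothesis on `Ψ` yields a geometric sequence `s n = α ^ n * s 0` along which `Ψ` at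
least squares at each step, so `Ψ (s n)` is at least `2 ^ 2 ^ n`. The symbol is the outer function
whose modulus is `1 - 2 / Ψ (s n)` on the arc of angles `(2⁻ⁿ, 2⁻ⁿ + c n)`, with `c n = 1 / Ψ (s (2
* n))` and `n ≥ 1`, and `1 - 2 / Ψ (s 0)` off these arcs.

Upper bounds. The Poisson kernel and convexity give `|f w| ≤ 2 s ‖f‖` whenever `|w| ≤ 1 - 2 / Ψ s`
(`norm_diskExt_le`). Hence all compositions with `f` in the unit ball are dominated, up to one
constant, by the function `y` equal to `s n` where the modulus has index `n`. This `y` lies in the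
Morse–Transue space: replacing `y` by `y / C` shifts the index by a bounded amount, which the
passage from `n` to `2 * n` in the arc lengths absorbs (`modular_lt_top`). Compactness follows from
the same domination. The Taylor coefficients of the unit ball lie in a set that is compact for
coefficientwise convergence, and on it composition is continuous into the norm, by dominated
convergence (`continuous_compElement`).

Lower bounds. Beside the `n`-th arc the modulus drops to its background value, and this contrast
makes the argument of the boundary values increase by a fixed `δ > 0` over the middle third of the
arc for all large `n` (`exists_winding`); the later arcs, which act in the opposite direction, are
too short to matter. About `δ N / (2π)` translated Fejér peaks of order `N`, with `N` about `Ψ (s n)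
/ 4`, are therefore met by the boundary values. By Parseval the moduli of these peaks sum to at most
`1` on the circle, so they form a weakly summable family (`sum_norm_fejerPeak_le`,
`sum_norm_apply_le`). The argument is Lipschitz on the arc with constant of order `c n ^ (-2)`, so
each peak is seen on a set of measure more than `1 / Ψ (s (2 * n + 2))`, and its image has norm at
least `1 / (16 * s (2 * n + 2))` (`exists_large_peaks`, `le_norm_of_le_on`).

A `p`-summing operator would bound the number of peaks times the `p`-th power of that norm. The
number is of order `Ψ (s n)`, doubly exponential in `n`, while the norms decay only geometrically
(`not_isPSumming`). -/

/-! ### Boundary functions and their analytic extensions -/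

/-- The point `exp (i t)` of the unit circle with angle `t`. -/
def circlePoint (t : Torus) : ℂ := (AddCircle.toCircle t : ℂ)

@[simp]
theorem norm_circlePoint (t : Torus) : ‖circlePoint t‖ = 1 := Circle.norm_coe _

theorem continuous_circlePoint : Continuous circlePoint :=
  continuous_subtype_val.comp AddCircle.continuous_toCircle

theorem fourier_natCast_apply (n : ℕ) (t : Torus) : fourier (n : ℤ) t = circlePoint t ^ n := by
  rw [fourier_apply, natCast_zsmul, AddCircle.toCircle_nsmul, Circle.coe_pow, circlePoint]

theorem norm_fourier_apply (n : ℤ) (t : Torus) : ‖fourier n t‖ = 1 := by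
  rw [fourier_apply]; exact Circle.norm_coe _

theorem norm_fourierCoeff_le {g : Torus → ℂ} (n : ℤ) :
    ‖fourierCoeff g n‖ ≤ ∫ t, ‖g t‖ ∂haarT := by
  refine (norm_integral_le_integral_norm _).trans (le_of_eq ?_)
  congr 1 with t
  rw [norm_smul, norm_fourier_apply, one_mul]

/-- `g ∈ L¹(𝕋)` has vanishing Fourier coefficients of negative index and `G` is the sum of the
power series `∑ ĝ(n) zⁿ` on the disk. -/
def HasDiskExt (g : Torus → ℂ) (G : ℂ → ℂ) : Prop :=
  Integrable g haarT ∧ (∀ n : ℤ, n < 0 → fourierCoeff g n = 0) ∧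
    ∀ z ∈ disk, HasSum (fun n : ℕ => fourierCoeff g (n : ℤ) * z ^ n) (G z)

theorem HasDiskExt.congr_left {g g' : Torus → ℂ} {G : ℂ → ℂ} (h : HasDiskExt g G)
    (hg : g =ᵐ[haarT] g') : HasDiskExt g' G := by
  refine ⟨h.1.congr hg, fun n hn => ?_, fun z hz => ?_⟩
  · rw [← fourierCoeff_congr_ae hg, h.2.1 n hn]
  · simpa only [fourierCoeff_congr_ae hg] using h.2.2 z hz

theorem HasDiskExt.congr_right {g : Torus → ℂ} {G G' : ℂ → ℂ} (h : HasDiskExt g G)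
    (hG : EqOn G G' disk) : HasDiskExt g G' :=
  ⟨h.1, h.2.1, fun z hz => hG hz ▸ h.2.2 z hz⟩

theorem summable_fourierCoeff_mul_pow (g : Torus → ℂ) {z : ℂ} (hz : z ∈ disk) :
    Summable fun n : ℕ => fourierCoeff g (n : ℤ) * z ^ n := by
  have hz' : ‖z‖ < 1 := by simpa using hz
  refine Summable.of_norm_bounded
    ((summable_geometric_of_lt_one (norm_nonneg z) hz').mul_left (∫ t, ‖g t‖ ∂haarT)) fun n => ?_
  rw [norm_mul, norm_pow]
  gcongr
  exact norm_fourierCoeff_le _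

theorem fourierCoeff_tsum {b : ℕ → ℂ} (hb : Summable fun n => ‖b n‖) (m : ℤ) :
    fourierCoeff (fun t : Torus => ∑' n : ℕ, b n * circlePoint t ^ n) m =
      ∑' n : ℕ, b n * (Pi.single (n : ℤ) (1 : ℂ) : ℤ → ℂ) m := by
  have hF : ∀ n : ℕ, fourierCoeff (fun t : Torus => b n * circlePoint t ^ n) m =
      b n * (Pi.single (n : ℤ) (1 : ℂ) : ℤ → ℂ) m := fun n => by
    rw [fourierCoeff.const_mul, ← fourierCoeff_fourier (T := 2 * Real.pi) (n : ℤ)]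
    congr 2
    ext t
    rw [fourier_natCast_apply]
  have hnorm : ∀ (n : ℕ) (t : Torus),
      ‖(fourier (-m) t : ℂ) • (b n * circlePoint t ^ n)‖ = ‖b n‖ := fun n t => by
    rw [norm_smul, norm_fourier_apply, one_mul, norm_mul, norm_pow, norm_circlePoint, one_pow,
      mul_one]
  have hint := hasSum_integral_of_summable_integral_norm (μ := haarT)
    (F := fun (n : ℕ) (t : Torus) => (fourier (-m) t : ℂ) • (b n * circlePoint t ^ n))
    (fun n => ((map_continuous (fourier (-m))).smul
      (continuous_const.mul (continuous_circlePoint.pow n))).integrable_of_hasCompactSupport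
        (HasCompactSupport.of_compactSpace _))
    (by simpa only [hnorm, integral_const, probReal_univ, one_smul] using hb)
  rw [← tsum_congr hF]
  refine Eq.trans ?_ hint.tsum_eq.symm
  unfold fourierCoeff
  congr 1 with t
  simp only [smul_eq_mul]
  rw [tsum_mul_left]

/-- Absolute convergence on the closed disk permits termwise integration. This is the base case from
which all other extensions are reached by limits. -/
theorem hasDiskExt_of_summable {b : ℕ → ℂ} (hb : Summable fun n => ‖b n‖) :
    HasDiskExt (fun t => ∑' n : ℕ, b n * circlePoint t ^ n)
      (fun z => ∑' n : ℕ, b n * z ^ n) := by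
  have hcoeff : ∀ n : ℕ, fourierCoeff
      (fun t : Torus => ∑' n : ℕ, b n * circlePoint t ^ n) (n : ℤ) = b n := fun n => by
    rw [fourierCoeff_tsum hb, tsum_eq_single n fun k hk => ?_]
    · simp
    · rw [Pi.single_eq_of_ne (by exact_mod_cast hk.symm), mul_zero]
  refine ⟨?_, fun n hn => ?_, fun z hz => ?_⟩
  · refine Continuous.integrable_of_hasCompactSupport ?_ (HasCompactSupport.of_compactSpace _)
    exact continuous_tsum (fun n => continuous_const.mul (continuous_circlePoint.pow n)) hb
      fun n t => by simp
  · rw [fourierCoeff_tsum hb]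
    refine (tsum_congr fun k => ?_).trans tsum_zero
    rw [Pi.single_eq_of_ne (by omega), mul_zero]
  · simp only [hcoeff]
    refine Summable.hasSum (Summable.of_norm_bounded hb fun n => ?_)
    rw [norm_mul, norm_pow]
    have hz' : ‖z‖ < 1 := by simpa using hz
    exact mul_le_of_le_one_right (norm_nonneg _) (pow_le_one₀ (norm_nonneg _) hz'.le)

/-- Dominated almost everywhere limits of boundary functions are boundary functions. -/
theorem hasDiskExt_of_tendsto {g : ℕ → Torus → ℂ} {G : ℕ → ℂ → ℂ} {g' : Torus → ℂ} {G' : ℂ → ℂ}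
    {y : Torus → ℝ} (h : ∀ j, HasDiskExt (g j) (G j)) (hy : Integrable y haarT)
    (hle : ∀ j, ∀ᵐ t ∂haarT, ‖g j t‖ ≤ y t)
    (hg : ∀ᵐ t ∂haarT, Tendsto (fun j => g j t) atTop (𝓝 (g' t)))
    (hG : ∀ z ∈ disk, Tendsto (fun j => G j z) atTop (𝓝 (G' z))) : HasDiskExt g' G' := by
  have hmeas : AEStronglyMeasurable g' haarT :=
    aestronglyMeasurable_of_tendsto_ae atTop (fun j => (h j).1.aestronglyMeasurable) hg
  have hint : Integrable g' haarT := by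
    refine hy.mono' hmeas ?_
    filter_upwards [hg, ae_all_iff.2 hle] with t ht hle
    exact le_of_tendsto ht.norm (Eventually.of_forall hle)
  -- Domination on the circle gives convergence of each coefficient together with the uniform bound
  -- `∫ y`, which lets the power series converge inside the disk.
  have hcoeff : ∀ n : ℤ, Tendsto (fun j => fourierCoeff (g j) n) atTop (𝓝 (fourierCoeff g' n)) := by
    intro n
    refine tendsto_integral_of_dominated_convergence y
      (fun j => ((h j).1.fourier_smul _).aestronglyMeasurable) hy (fun j => ?_) ?_
    · filter_upwards [hle j] with t ht
      rwa [norm_smul, norm_fourier_apply, one_mul]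
    · filter_upwards [hg] with t ht
      exact ht.const_smul _
  refine ⟨hint, fun n hn => ?_, fun z hz => ?_⟩
  · refine tendsto_nhds_unique (hcoeff n) ?_
    simp only [(h _).2.1 n hn, tendsto_const_nhds]
  · have hz' : ‖z‖ < 1 := by simpa using hz
    have hsum := (summable_fourierCoeff_mul_pow g' hz).hasSum
    have hlim : Tendsto (fun j => ∑' n : ℕ, fourierCoeff (g j) (n : ℤ) * z ^ n) atTop
        (𝓝 (∑' n : ℕ, fourierCoeff g' (n : ℤ) * z ^ n)) := by
      refine tendsto_tsum_of_dominated_convergence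
        ((summable_geometric_of_lt_one (norm_nonneg z) hz').mul_left (∫ t, y t ∂haarT))
        (fun n => (hcoeff n).mul_const _) (Eventually.of_forall fun j n => ?_)
      rw [norm_mul, norm_pow]
      gcongr
      exact (norm_fourierCoeff_le _).trans (integral_mono_ae (h j).1.norm hy (hle j))
    have : ∑' n : ℕ, fourierCoeff g' (n : ℤ) * z ^ n = G' z := by
      refine tendsto_nhds_unique hlim ?_
      simp only [((h _).2.2 z hz).tsum_eq]
      exact hG z hz
    rwa [this] at hsum

/-! ### Dilations and radial limits -/

/-- A sequence of radii increasing to `1`. -/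
def radius (j : ℕ) : ℝ := 1 - 1 / ((j : ℝ) + 1)

theorem radius_nonneg (j : ℕ) : 0 ≤ radius j := by
  unfold radius
  rw [sub_nonneg, div_le_one (by positivity)]
  linarith [(Nat.cast_nonneg j : (0 : ℝ) ≤ j)]

theorem radius_lt_one (j : ℕ) : radius j < 1 := by
  unfold radius
  have : (0 : ℝ) < 1 / ((j : ℝ) + 1) := by positivity
  linarith

theorem tendsto_radius : Tendsto radius atTop (𝓝 1) := by
  have := (tendsto_one_div_add_atTop_nhds_zero_nat (𝕜 := ℝ)).const_sub (1 : ℝ)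
  rwa [sub_zero] at this

theorem norm_radius_mul (j : ℕ) (z : ℂ) : ‖(radius j : ℂ) * z‖ = radius j * ‖z‖ := by
  rw [norm_mul, Complex.norm_real, Real.norm_of_nonneg (radius_nonneg j)]

theorem radius_mul_mem_disk (j : ℕ) {z : ℂ} (hz : ‖z‖ ≤ 1) : (radius j : ℂ) * z ∈ disk := by
  rw [mem_ball_zero_iff, norm_radius_mul]
  exact (mul_le_of_le_one_right (radius_nonneg j) hz).trans_lt (radius_lt_one j)

theorem tendsto_radius_mul (z : ℂ) : Tendsto (fun j => (radius j : ℂ) * z) atTop (𝓝 z) := by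
  have := (Complex.continuous_ofReal.tendsto 1).comp tendsto_radius
  simpa using this.mul_const z

theorem hasDiskExt_dilate {G : ℂ → ℂ} (hG : DifferentiableOn ℂ G disk) {ρ : ℝ} (h0 : 0 ≤ ρ)
    (h1 : ρ < 1) :
    HasDiskExt (fun t => G (ρ * circlePoint t)) (fun z => G (ρ * z)) := by
  set a : ℕ → ℂ := fun n => (n.factorial : ℂ)⁻¹ * iteratedDeriv n G 0 with ha
  have hsum : ∀ z ∈ disk, HasSum (fun n => a n * z ^ n) (G z) := fun z hz => by
    have := Complex.hasSum_taylorSeries_on_ball hG hz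
    simp only [sub_zero, smul_eq_mul] at this
    refine this.congr_fun fun n => ?_
    ring
  have hmul : ∀ z : ℂ, ‖z‖ ≤ 1 → (ρ : ℂ) * z ∈ disk := fun z hz => by
    rw [mem_ball_zero_iff, norm_mul, Complex.norm_real, Real.norm_of_nonneg h0]
    exact (mul_le_of_le_one_right h0 hz).trans_lt h1
  -- The Taylor series converges at the interior point `ρ`, and summability in `ℂ` is absolute.
  have hb : Summable fun n => ‖a n * (ρ : ℂ) ^ n‖ := by
    have := (hsum _ (hmul 1 (by simp))).summable
    simpa using this.norm
  have hval : ∀ z : ℂ, ‖z‖ ≤ 1 → ∑' n, a n * (ρ : ℂ) ^ n * z ^ n = G (ρ * z) := fun z hz => by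
    rw [← (hsum _ (hmul z hz)).tsum_eq]
    exact tsum_congr fun n => by rw [mul_pow, mul_assoc]
  have key := hasDiskExt_of_summable hb
  refine (key.congr_left (Eventually.of_forall fun t => ?_)).congr_right fun z hz => ?_
  · exact hval _ (by simp)
  · exact hval z (by simpa using (mem_ball_zero_iff.1 hz).le)

/-- A bounded analytic function on the disk is the extension of its radial limits. -/
theorem hasDiskExt_of_bounded {G : ℂ → ℂ} (hG : DifferentiableOn ℂ G disk) {M : ℝ}
    (hM : ∀ z ∈ disk, ‖G z‖ ≤ M) {g : Torus → ℂ}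
    (hg : ∀ᵐ t ∂haarT,
      Tendsto (fun j => G (radius j * circlePoint t)) atTop (𝓝 (g t))) :
    HasDiskExt g G := by
  refine hasDiskExt_of_tendsto (fun j => hasDiskExt_dilate hG (radius_nonneg j) (radius_lt_one j))
    (integrable_const M) (fun j => Eventually.of_forall fun t => ?_) hg fun z hz => ?_
  · exact hM _ (radius_mul_mem_disk j (by simp))
  · exact ((hG.differentiableAt (Metric.isOpen_ball.mem_nhds hz)).continuousAt.tendsto).comp
      (tendsto_radius_mul z)

/-! ### The Poisson kernel -/

/-- The Poisson kernel of the disk. -/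
def poisson (w : ℂ) (t : Torus) : ℝ :=
  ((circlePoint t + w) / (circlePoint t - w)).re

theorem circlePoint_sub_ne_zero {w : ℂ} (hw : w ∈ disk) (t : Torus) :
    circlePoint t - w ≠ 0 := by
  intro h
  rw [sub_eq_zero] at h
  rw [← h, mem_ball_zero_iff, norm_circlePoint] at hw
  exact lt_irrefl _ hw

theorem continuous_herglotz {w : ℂ} (hw : w ∈ disk) : Continuous fun t : Torus =>
    (circlePoint t + w) / (circlePoint t - w) :=
  (continuous_circlePoint.add continuous_const).div (continuous_circlePoint.sub continuous_const)
    (circlePoint_sub_ne_zero hw)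

theorem continuous_poisson {w : ℂ} (hw : w ∈ disk) : Continuous (poisson w) :=
  Complex.continuous_re.comp (continuous_herglotz hw)

theorem poisson_le {w : ℂ} (hw : w ∈ disk) (t : Torus) :
    poisson w t ≤ (1 + ‖w‖) / (1 - ‖w‖) := by
  have := re_herglotzRieszKernel_le (c := 0) (R := 1) (z := circlePoint t) (w := w)
    (by simp) hw
  simpa [poisson] using this

theorem poisson_pos {w : ℂ} (hw : w ∈ disk) (t : Torus) : 0 < poisson w t := by
  have := le_re_herglotzRieszKernel (c := 0) (R := 1) (z := circlePoint t) (w := w)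
    (by simp) hw
  have hw' : ‖w‖ < 1 := by simpa using hw
  have hpos : 0 < (1 - ‖w‖) / (1 + ‖w‖) := div_pos (sub_pos.2 hw') (by positivity)
  exact hpos.trans_le (by simpa [poisson] using this)

/-- Both series are geometric, because the conjugate of a point of the circle is its inverse. The
split separates the part that pairs with coefficients of index at least `0` from the part that pairs
with negative indices. -/
theorem poisson_eq_tsum {w : ℂ} (hw : w ∈ disk) (t : Torus) :
    (poisson w t : ℂ) = ∑' n : ℕ, w ^ n * fourier (-(n : ℤ)) t +
      ∑' n : ℕ, (starRingEnd ℂ w) ^ (n + 1) * fourier ((n + 1 : ℕ) : ℤ) t := by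
  have hw' : ‖w‖ < 1 := by simpa using hw
  set u : ℂ := circlePoint t with hu
  have hu1 : u * starRingEnd ℂ u = 1 := by
    rw [Complex.mul_conj, Complex.normSq_eq_norm_sq, hu, norm_circlePoint]; norm_num
  have hun : ‖u‖ = 1 := norm_circlePoint t
  have h1 : ∑' n : ℕ, w ^ n * fourier (-(n : ℤ)) t = (1 - w * starRingEnd ℂ u)⁻¹ := by
    rw [← tsum_geometric_of_norm_lt_one (by simpa [hun] using hw')]
    refine tsum_congr fun n => ?_
    rw [fourier_neg, fourier_natCast_apply, ← hu, map_pow, mul_pow]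
  have h2 : ∑' n : ℕ, (starRingEnd ℂ w) ^ (n + 1) * fourier ((n + 1 : ℕ) : ℤ) t =
      starRingEnd ℂ w * u * (1 - starRingEnd ℂ w * u)⁻¹ := by
    rw [← tsum_geometric_of_norm_lt_one (by simpa [hun] using hw'), ← tsum_mul_left]
    refine tsum_congr fun n => ?_
    rw [fourier_natCast_apply, ← hu, ← mul_pow]; ring
  have hne : u - w ≠ 0 := circlePoint_sub_ne_zero hw t
  have hne' : starRingEnd ℂ u - starRingEnd ℂ w ≠ 0 := by
    rw [← map_sub]; exact (map_ne_zero _).2 hne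
  have h3 : 1 - w * starRingEnd ℂ u = (u - w) * starRingEnd ℂ u := by rw [sub_mul, hu1]
  have h4 : 1 - starRingEnd ℂ w * u = (starRingEnd ℂ u - starRingEnd ℂ w) * u := by
    rw [sub_mul, mul_comm (starRingEnd ℂ u) u, hu1]
  have hu0 : u ≠ 0 := by intro h; simp [h] at hun
  have hu0' : starRingEnd ℂ u ≠ 0 := (map_ne_zero _).2 hu0
  rw [h1, h2, h3, h4, poisson, Complex.re_eq_add_conj, ← hu, map_div₀, map_add, map_sub]
  have h5 : ((u - w) * starRingEnd ℂ u)⁻¹ = u / (u - w) := by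
    rw [inv_eq_one_div, div_eq_div_iff (mul_ne_zero hne hu0') hne, one_mul]
    linear_combination -(u - w) * hu1
  rw [h5]
  field_simp
  ring

/-- Termwise integration, with frequencies and exponents left free so that one statement serves both
halves of the Poisson kernel and the Herglotz kernel. The condition `n ≤ k n` secures domination by
the geometric series of `‖w‖`. -/
theorem hasSum_integral_mul_pow {g : Torus → ℂ} (hg : Integrable g haarT) {w : ℂ} (hw : w ∈ disk)
    {m : ℕ → ℤ} {k : ℕ → ℕ} (hk : ∀ n, n ≤ k n) :
    Integrable (fun t => (∑' n : ℕ, w ^ k n * fourier (m n) t) * g t) haarT ∧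
    HasSum (fun n : ℕ => w ^ k n * fourierCoeff g (-m n))
      (∫ t, (∑' n : ℕ, w ^ k n * fourier (m n) t) * g t ∂haarT) := by
  have hw' : ‖w‖ < 1 := by simpa using hw
  have hgeo := summable_geometric_of_lt_one (norm_nonneg w) hw'
  have hle : ∀ n (t : Torus), ‖w ^ k n * fourier (m n) t‖ ≤ ‖w‖ ^ n := fun n t => by
    rw [norm_mul, norm_pow, norm_fourier_apply, mul_one]
    exact pow_le_pow_of_le_one (norm_nonneg w) hw'.le (hk n)
  have hcont : Continuous fun t : Torus => ∑' n : ℕ, w ^ k n * fourier (m n) t :=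
    continuous_tsum (fun n => continuous_const.mul (map_continuous _)) hgeo hle
  have hint : ∀ n, Integrable (fun t => w ^ k n * fourier (m n) t * g t) haarT := fun n => by
    simpa [smul_eq_mul, mul_assoc] using (hg.fourier_smul (m n)).const_mul (w ^ k n)
  have hnorm : ∀ n (t : Torus), ‖w ^ k n * fourier (m n) t * g t‖ ≤ ‖w‖ ^ n * ‖g t‖ := fun n t => by
    rw [norm_mul]; gcongr; exact hle n t
  refine ⟨?_, ?_⟩
  · refine hg.bdd_mul hcont.aestronglyMeasurable (c := (1 - ‖w‖)⁻¹)
      (Eventually.of_forall fun t => ?_)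
    rw [← tsum_geometric_of_lt_one (norm_nonneg w) hw']
    exact tsum_of_norm_bounded hgeo.hasSum (fun n => hle n t)
  · have := hasSum_integral_of_summable_integral_norm hint
      (Summable.of_nonneg_of_le (fun n => by positivity)
        (fun n => (integral_mono (hint n).norm (hg.norm.const_mul _) (hnorm n)).trans
          (le_of_eq (integral_const_mul _ _))) (hgeo.mul_right _))
    simp only [tsum_mul_right] at this
    refine this.congr_fun fun n => ?_
    rw [show fourierCoeff g (-m n) = ∫ t, fourier (-(-m n)) t • g t ∂haarT from rfl, neg_neg,
      ← integral_const_mul]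
    simp only [smul_eq_mul, mul_assoc]

/-- The extension is the Poisson integral of the boundary function. -/
theorem HasDiskExt.eq_integral_poisson {g : Torus → ℂ} {G : ℂ → ℂ} (h : HasDiskExt g G) {w : ℂ}
    (hw : w ∈ disk) : G w = ∫ t, (poisson w t : ℂ) * g t ∂haarT := by
  have hw' : starRingEnd ℂ w ∈ disk := by simpa using hw
  obtain ⟨i1, s1⟩ := hasSum_integral_mul_pow h.1 hw (m := fun n => -(n : ℤ)) (k := id)
    fun n => le_rfl
  obtain ⟨i2, s2⟩ := hasSum_integral_mul_pow h.1 hw' (m := fun n => ((n + 1 : ℕ) : ℤ))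
    (k := (· + 1)) fun n => Nat.le_succ n
  simp only [poisson_eq_tsum hw, add_mul]
  have e1 := s1.unique (by simpa [mul_comm] using h.2.2 w hw)
  -- The half with powers of the conjugate of `w` meets only coefficients of index `-(n + 1)`, which
  -- vanish.
  have e2 : (0 : ℂ) = _ := HasSum.unique (f := fun _ : ℕ => (0 : ℂ)) hasSum_zero (by
    convert s2 using 2 with n
    rw [h.2.1 _ (by push_cast; omega), mul_zero])
  exact (e1.symm.trans (add_zero _).symm).trans
    ((congrArg _ e2).trans (integral_add i1 i2).symm)

theorem integral_poisson {w : ℂ} (hw : w ∈ disk) : ∫ t, poisson w t ∂haarT = 1 := by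
  have h := (hasDiskExt_of_bounded (G := fun _ => 1) (g := fun _ => 1)
    (differentiableOn_const _) (M := 1) (by simp) (by simp)).eq_integral_poisson hw
  simp only [mul_one, integral_complex_ofReal] at h
  exact_mod_cast h.symm

/-! ### Luxemburg norm estimates -/

namespace OrliczFunction

variable (Ψ : OrliczFunction)

theorem mono {x y : ℝ} (hx : 0 ≤ x) (hxy : x ≤ y) : Ψ x ≤ Ψ y :=
  Ψ.monotoneOn (mem_Ici.2 hx) (mem_Ici.2 (hx.trans hxy)) hxy

/-- By convexity and `Ψ 0 = 0` the quotient `Ψ x / x` is non-decreasing, so the second summand alone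
suffices once `x ≥ s`. This inequality turns a bound on the modular into a bound on point
evaluations. -/
theorem le_add_mul {s x : ℝ} (hs : 0 < s) (hx : 0 ≤ x) : x ≤ s + s / Ψ s * Ψ x := by
  have hΨs := Ψ.pos hs
  have h0 : 0 ≤ s / Ψ s * Ψ x := mul_nonneg (by positivity) (Ψ.nonneg hx)
  rcases le_total x s with h | h
  · linarith
  · have hx0 : 0 < x := hs.trans_le h
    have h1 := Ψ.mul_le hx (a := s / x) (by positivity) ((div_le_one hx0).2 h)
    rw [div_mul_cancel₀ _ hx0.ne', div_mul_eq_mul_div, le_div_iff₀ hx0] at h1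
    have h2 : x ≤ s / Ψ s * Ψ x := by
      rw [div_mul_eq_mul_div, le_div_iff₀ hΨs]; linarith
    linarith

theorem tendsto_atTop : Tendsto Ψ atTop atTop := by
  refine tendsto_atTop_mono' atTop ?_ tendsto_id
  filter_upwards [Ψ.tendsto_div_atTop.eventually_ge_atTop 1, eventually_gt_atTop 0] with x hx hx0
  rw [le_div_iff₀ hx0, one_mul] at hx
  exact hx

end OrliczFunction

section

variable {Ω : Type*} [MeasurableSpace Ω] {Ψ : OrliczFunction} {μ : Measure Ω}

theorem modular_mono {f g : Ω → ℂ} {C D : ℝ} (hC : 0 < C)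
    (h : ∀ᵐ t ∂μ, ‖f t‖ / C ≤ ‖g t‖ / D) : modular Ψ μ f C ≤ modular Ψ μ g D := by
  refine lintegral_mono_ae ?_
  filter_upwards [h] with t ht
  exact ENNReal.ofReal_le_ofReal (Ψ.mono (by positivity) ht)

theorem modular_le_one_of_norm_lt {f : orliczSpace Ψ μ} {C : ℝ} (h : ‖f‖ < C) :
    modular Ψ μ f.1 C ≤ 1 := by
  obtain ⟨a, ⟨ha, hfa⟩, hae⟩ := Real.lt_sInf_add_pos (exists_modular_le_one f) (sub_pos.2 h)
  have haC : a < C := by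
    have : a < ‖f‖ + (C - ‖f‖) := hae
    linarith
  refine (modular_mono (ha.trans haC) (Eventually.of_forall fun t => ?_)).trans hfa
  gcongr

theorem norm_le_of_modular_le_one {f : orliczSpace Ψ μ} {C : ℝ} (hC : 0 < C)
    (h : modular Ψ μ f.1 C ≤ 1) : ‖f‖ ≤ C :=
  csInf_le (luxemburgNorm_set_bddBelow _) ⟨hC, h⟩

/-- A lower bound for the Luxemburg norm of a function which is large on a set. -/
theorem le_norm_of_le_on {f : orliczSpace Ψ μ} {S : Set Ω} {b x : ℝ} (hb : 0 < b) (hx : 0 < x)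
    (hS : ENNReal.ofReal (1 / Ψ x) < μ S) (hf : ∀ᵐ t ∂μ, t ∈ S → b ≤ ‖f.1 t‖) :
    b / x ≤ ‖f‖ := by
  by_contra hlt
  rw [not_le] at hlt
  have h1 := modular_le_one_of_norm_lt hlt
  -- Chebyshev's inequality. By the choice of `S` the left side exceeds `1`, which contradicts a
  -- norm below `b / x`.
  have h2 : ENNReal.ofReal (Ψ x) * μ S ≤ modular Ψ μ f.1 (b / x) := by
    have hae : ∀ᵐ t ∂μ, t ∈ S → ENNReal.ofReal (Ψ x) ≤
        ENNReal.ofReal (Ψ (‖f.1 t‖ / (b / x))) := by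
      filter_upwards [hf] with t ht htS
      refine ENNReal.ofReal_le_ofReal (Ψ.mono hx.le ?_)
      rw [le_div_iff₀ (by positivity), mul_div_cancel₀ _ hx.ne']
      exact ht htS
    have h3 : μ S ≤ μ {t | ENNReal.ofReal (Ψ x) ≤ ENNReal.ofReal (Ψ (‖f.1 t‖ / (b / x)))} :=
      measure_mono_ae hae
    calc _ ≤ _ := by gcongr
      _ ≤ _ := mul_meas_ge_le_lintegral₀
        (aemeasurable_modular f.1.aestronglyMeasurable (by positivity)) _
  have hΨ := Ψ.pos hx
  have h4 : (1 : ENNReal) < ENNReal.ofReal (Ψ x) * μ S := by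
    calc (1 : ENNReal) = ENNReal.ofReal (Ψ x) * ENNReal.ofReal (1 / Ψ x) := by
          rw [← ENNReal.ofReal_mul hΨ.le, mul_one_div_cancel hΨ.ne', ENNReal.ofReal_one]
      _ < _ := ENNReal.mul_lt_mul_right (by simpa using hΨ) ENNReal.ofReal_ne_top hS
  exact absurd (h4.trans_le (h2.trans h1)) (lt_irrefl _)

end

section

/-! ### Point evaluations on the Hardy–Orlicz space -/

variable {Ψ : OrliczFunction}

theorem integrable_boundary (f : hardyOrlicz Ψ) : Integrable (boundary f) haarT :=
  integrable_of_mem_orliczSpace f.1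

theorem hasDiskExt_boundary (f : hardyOrlicz Ψ) : HasDiskExt (boundary f) (diskExt f) :=
  ⟨integrable_boundary f, f.2, fun _ hz => (summable_fourierCoeff_mul_pow _ hz).hasSum⟩

/-- The condition on `w` says exactly that `2 / (1 - ‖w‖)`, hence the Poisson kernel, is at most `Ψ
s`. Then `le_add_mul` applied to `|f| / C` leaves two terms: `s` times the kernel, of mass one, and
`s` times the modular, which is at most one. These account for the factor `2 * s`. -/
theorem integral_poisson_mul_norm_le (f : hardyOrlicz Ψ) {s : ℝ} (hs : 0 < s) {w : ℂ}
    (hw : ‖w‖ ≤ 1 - 2 / Ψ s) :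
    ∫ t, poisson w t * ‖boundary f t‖ ∂haarT ≤ 2 * s * ‖f‖ := by
  have hΨs := Ψ.pos hs
  have hwd : w ∈ disk := by
    rw [mem_ball_zero_iff]
    have : 0 < 2 / Ψ s := by positivity
    linarith
  have hP : ∀ t, poisson w t ≤ Ψ s := fun t => by
    refine (poisson_le hwd t).trans ?_
    have h1 : ‖w‖ < 1 := by simpa using hwd
    rw [div_le_iff₀ (by linarith)]
    have h2 : 2 / Ψ s ≤ 1 - ‖w‖ := by linarith
    rw [div_le_iff₀ hΨs] at h2
    nlinarith
  have hPc := continuous_poisson hwd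
  have hPint : Integrable (poisson w) haarT :=
    hPc.integrable_of_hasCompactSupport (HasCompactSupport.of_compactSpace _)
  -- Working with `C` strictly above the norm covers `f = 0` and avoids asking whether the infimum
  -- is attained; `C` decreases to `‖f‖` at the end.
  have hC : ∀ C : ℝ, ‖f‖ < C → ∫ t, poisson w t * ‖boundary f t‖ ∂haarT ≤ 2 * s * C := by
    intro C hfC
    have hC0 : 0 < C := (norm_nonneg f).trans_lt hfC
    have hmod : modular Ψ haarT (boundary f) C ≤ 1 := modular_le_one_of_norm_lt (f := f.1) hfC
    have hmeas : AEMeasurable (fun t => Ψ (‖boundary f t‖ / C)) haarT := by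
      have h : AEMeasurable (fun t => Ψ (max (‖boundary f t‖ / C) 0)) haarT :=
        Ψ.measurable_max.comp_aemeasurable
          ((integrable_boundary f).aestronglyMeasurable.norm.aemeasurable.div_const C)
      refine h.congr (Eventually.of_forall fun t => ?_)
      have : (0 : ℝ) ≤ ‖boundary f t‖ / C := by positivity
      simp only [max_eq_left this]
    have hnn : ∀ t, 0 ≤ Ψ (‖boundary f t‖ / C) := fun t => Ψ.nonneg (by positivity)
    have hΨint : Integrable (fun t => Ψ (‖boundary f t‖ / C)) haarT := by
      refine ⟨hmeas.aestronglyMeasurable, ?_⟩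
      rw [hasFiniteIntegral_iff_ofReal (Eventually.of_forall hnn)]
      exact hmod.trans_lt ENNReal.one_lt_top
    have hle1 : ∫ t, Ψ (‖boundary f t‖ / C) ∂haarT ≤ 1 := by
      rw [integral_eq_lintegral_of_nonneg_ae (Eventually.of_forall hnn) hmeas.aestronglyMeasurable]
      exact ENNReal.toReal_le_of_le_ofReal zero_le_one (by simpa [modular] using hmod)
    have hpt : ∀ t, poisson w t * ‖boundary f t‖ ≤
        C * s * poisson w t + C * s * Ψ (‖boundary f t‖ / C) := by
      intro t
      have h1 := Ψ.le_add_mul hs (x := ‖boundary f t‖ / C) (by positivity)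
      rw [div_le_iff₀ hC0] at h1
      have hp := poisson_pos hwd t
      have h2 : poisson w t * (s / Ψ s * Ψ (‖boundary f t‖ / C)) ≤
          s * Ψ (‖boundary f t‖ / C) := by
        have : poisson w t * (s / Ψ s) ≤ s := by
          rw [mul_div_assoc', div_le_iff₀ hΨs]
          nlinarith [hP t]
        calc _ = poisson w t * (s / Ψ s) * Ψ (‖boundary f t‖ / C) := by ring
          _ ≤ _ := mul_le_mul_of_nonneg_right this (hnn t)
      calc _ ≤ poisson w t * ((s + s / Ψ s * Ψ (‖boundary f t‖ / C)) * C) := by gcongr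
        _ = C * s * poisson w t + C * (poisson w t * (s / Ψ s * Ψ (‖boundary f t‖ / C))) := by ring
        _ ≤ C * s * poisson w t + C * (s * Ψ (‖boundary f t‖ / C)) := by gcongr
        _ = _ := by ring
    have hi1 := hPint.const_mul (C * s)
    have hi2 := hΨint.const_mul (C * s)
    calc _ ≤ ∫ t, (C * s * poisson w t + C * s * Ψ (‖boundary f t‖ / C)) ∂haarT := by
          refine integral_mono ?_ (hi1.add hi2) hpt
          refine (integrable_boundary f).norm.bdd_mul hPc.aestronglyMeasurable (c := Ψ s)
            (Eventually.of_forall fun t => ?_)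
          rw [Real.norm_of_nonneg (poisson_pos hwd t).le]
          exact hP t
      _ = C * s + C * s * ∫ t, Ψ (‖boundary f t‖ / C) ∂haarT := by
          rw [integral_add hi1 hi2, integral_const_mul, integral_const_mul, integral_poisson hwd,
            mul_one]
      _ ≤ C * s + C * s * 1 := by gcongr
      _ = _ := by ring
  refine le_of_forall_gt_imp_ge_of_dense fun b hb => ?_
  have := hC (b / (2 * s)) (by rw [lt_div_iff₀ (by positivity)]; linarith)
  rwa [mul_div_cancel₀ _ (by positivity)] at this

theorem norm_diskExt_le (f : hardyOrlicz Ψ) {s : ℝ} (hs : 0 < s) {w : ℂ}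
    (hw : ‖w‖ ≤ 1 - 2 / Ψ s) : ‖diskExt f w‖ ≤ 2 * s * ‖f‖ := by
  have hwd : w ∈ disk := by
    rw [mem_ball_zero_iff]
    have : 0 < 2 / Ψ s := div_pos two_pos (Ψ.pos hs)
    linarith
  rw [(hasDiskExt_boundary f).eq_integral_poisson hwd]
  refine (norm_integral_le_integral_norm _).trans (le_trans (le_of_eq ?_)
    (integral_poisson_mul_norm_le f hs hw))
  congr 1 with t
  rw [norm_mul, Complex.norm_real, Real.norm_of_nonneg (poisson_pos hwd t).le]

/-- The condition `2 ≤ Ψ s` makes `w = 0` admissible in the previous estimate; there the Poisson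
kernel is `1` and the integral is the `L¹` norm. -/
theorem norm_fourierCoeff_boundary_le (f : hardyOrlicz Ψ) {s : ℝ} (hs : 0 < s) (hs2 : 2 ≤ Ψ s)
    (n : ℤ) : ‖fourierCoeff (boundary f) n‖ ≤ 2 * s * ‖f‖ := by
  refine (norm_fourierCoeff_le n).trans ?_
  have hw : ‖(0 : ℂ)‖ ≤ 1 - 2 / Ψ s := by
    rw [norm_zero, sub_nonneg, div_le_one (Ψ.pos hs)]
    exact hs2
  have h := integral_poisson_mul_norm_le f hs hw
  have h0 : ∀ t, poisson 0 t = 1 := fun t => by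
    have : circlePoint t ≠ 0 := by rw [← norm_ne_zero_iff]; simp
    simp [poisson, this]
  simpa only [h0, one_mul] using h

end

/-! ### Herglotz integrals and outer functions -/

/-- The Herglotz integral `∫ (u + z) / (u - z) g(u) dm(u)` of `g`. -/
def herglotz (g : Torus → ℝ) (z : ℂ) : ℂ :=
  ∫ t : Torus, (circlePoint t + z) / (circlePoint t - z) * (g t : ℂ) ∂haarT

/-- The boundary values of `herglotz g` at points where `g` is locally constant. -/
def herglotzBoundary (g : Torus → ℝ) (t₀ : Torus) : ℂ :=
  (g t₀ : ℂ) + ∫ t : Torus, (circlePoint t + circlePoint t₀) / (circlePoint t - circlePoint t₀) *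
    ((g t - g t₀ : ℝ) : ℂ) ∂haarT

theorem injective_circlePoint : Function.Injective circlePoint := fun _ _ h =>
  AddCircle.injective_toCircle Real.two_pi_pos.ne' (Subtype.ext h)

theorem one_sub_norm_le_norm_circlePoint_sub (t : Torus) (z : ℂ) :
    1 - ‖z‖ ≤ ‖circlePoint t - z‖ := by
  have := norm_sub_norm_le (circlePoint t) z
  rwa [norm_circlePoint] at this

theorem integrable_of_bounded {g : Torus → ℝ} (hg : Measurable g) {M : ℝ} (hM : ∀ t, |g t| ≤ M) :
    Integrable g haarT :=
  Integrable.of_bound hg.aestronglyMeasurable M (Eventually.of_forall hM)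

theorem integrable_herglotz {g : Torus → ℝ} (hg : Integrable g haarT) {z : ℂ} (hz : z ∈ disk) :
    Integrable (fun t : Torus => (circlePoint t + z) / (circlePoint t - z) * (g t : ℂ)) haarT := by
  obtain ⟨C, hC⟩ := isCompact_univ.exists_bound_of_continuousOn
    (continuous_herglotz hz).continuousOn
  exact hg.ofReal.bdd_mul (continuous_herglotz hz).aestronglyMeasurable
    (Eventually.of_forall fun t => hC t (mem_univ t))

theorem differentiableOn_herglotz {g : Torus → ℝ} (hg : Integrable g haarT) :
    DifferentiableOn ℂ (herglotz g) disk := by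
  intro z₀ hz₀
  have hz₀' : ‖z₀‖ < 1 := by simpa using hz₀
  set δ : ℝ := (1 - ‖z₀‖) / 2 with hδ
  have hδ0 : 0 < δ := by rw [hδ]; linarith
  have hball : ∀ z ∈ Metric.ball z₀ δ, ∀ t : Torus, δ ≤ ‖circlePoint t - z‖ := fun z hz t => by
    refine le_trans ?_ (one_sub_norm_le_norm_circlePoint_sub t z)
    have h1 : ‖z - z₀‖ < δ := by simpa [dist_eq_norm] using hz
    have h2 := norm_le_insert' z z₀
    linarith
  have hsub : ∀ z ∈ Metric.ball z₀ δ, z ∈ disk := fun z hz => by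
    rw [mem_ball_zero_iff]
    have h1 : ‖z - z₀‖ < δ := by simpa [dist_eq_norm] using hz
    have h2 := norm_le_insert' z z₀
    linarith
  refine (DifferentiableAt.differentiableWithinAt ?_)
  refine (hasDerivAt_integral_of_dominated_loc_of_deriv_le (μ := haarT) (𝕜 := ℂ)
    (F := fun z (t : Torus) => (circlePoint t + z) / (circlePoint t - z) * (g t : ℂ))
    (F' := fun z (t : Torus) => 2 * circlePoint t / (circlePoint t - z) ^ 2 * (g t : ℂ))
    (bound := fun t => 2 / δ ^ 2 * |g t|) (Metric.ball_mem_nhds z₀ hδ0) ?_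
    (integrable_herglotz hg hz₀) ?_ ?_ (hg.abs.const_mul _) ?_).2.differentiableAt
  · filter_upwards [Metric.ball_mem_nhds z₀ hδ0] with z hz
    exact (integrable_herglotz hg (hsub z hz)).aestronglyMeasurable
  · refine AEStronglyMeasurable.mul (Continuous.aestronglyMeasurable ?_)
      hg.ofReal.aestronglyMeasurable
    exact (continuous_const.mul continuous_circlePoint).div
      ((continuous_circlePoint.sub continuous_const).pow 2)
      fun t => pow_ne_zero 2 (circlePoint_sub_ne_zero hz₀ t)
  · refine Eventually.of_forall fun t z hz => ?_
    rw [norm_mul, norm_div, norm_mul, norm_pow, norm_circlePoint, Complex.norm_real,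
      Real.norm_eq_abs, mul_one, RCLike.norm_ofNat]
    gcongr
    exact hball z hz t
  · refine Eventually.of_forall fun t z hz => ?_
    have hne := circlePoint_sub_ne_zero (hsub z hz) t
    have h1 : HasDerivAt (fun z : ℂ => circlePoint t + z) 1 z := (hasDerivAt_id z).const_add _
    have h2 : HasDerivAt (fun z : ℂ => circlePoint t - z) (-1) z := (hasDerivAt_id z).const_sub _
    refine ((h1.div h2 hne).mul_const (g t : ℂ)).congr_deriv ?_
    ring

theorem re_herglotz {g : Torus → ℝ} (hg : Integrable g haarT) {z : ℂ} (hz : z ∈ disk) :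
    (herglotz g z).re = ∫ t, poisson z t * g t ∂haarT := by
  have h := integral_re (𝕜 := ℂ) (integrable_herglotz hg hz)
  simp only [RCLike.re_to_complex, Complex.re_mul_ofReal] at h
  exact h.symm

theorem re_herglotz_neg {g : Torus → ℝ} (hg : Integrable g haarT) (hneg : ∀ t, g t < 0) {z : ℂ}
    (hz : z ∈ disk) : (herglotz g z).re < 0 := by
  rw [re_herglotz hg hz]
  have hint : Integrable (fun t => poisson z t * g t) haarT := by
    have h := (integrable_herglotz hg hz).re
    simp only [RCLike.re_to_complex, Complex.re_mul_ofReal] at h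
    exact h
  have h : 0 < ∫ t, -(poisson z t * g t) ∂haarT := by
    have hpos : ∀ t, 0 < -(poisson z t * g t) := fun t => by
      have := mul_neg_of_pos_of_neg (poisson_pos hz t) (hneg t)
      linarith
    rw [integral_pos_iff_support_of_nonneg (fun t => (hpos t).le) hint.neg]
    have : Function.support (fun t => -(poisson z t * g t)) = univ :=
      eq_univ_of_forall fun t => (hpos t).ne'
    rw [this]
    simp
  rw [integral_neg] at h
  linarith

/-- The kernel is `2 / (1 - z / u) - 1`; in the geometric series only the constant term has a
nonzero mean, which leaves `2 - 1`. -/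
theorem integral_herglotz_kernel {z : ℂ} (hz : z ∈ disk) :
    ∫ t : Torus, (circlePoint t + z) / (circlePoint t - z) ∂haarT = 1 := by
  obtain ⟨i1, s1⟩ := hasSum_integral_mul_pow (g := fun _ => 1) (integrable_const _) hz
    (m := fun n => -(n : ℤ)) (k := id) fun n => le_rfl
  have hcoeff : ∀ n : ℕ, fourierCoeff (fun _ : Torus => (1 : ℂ)) (n : ℤ) =
      (Pi.single 0 1 : ℕ → ℂ) n := fun n => by
    have h := congrFun (fourierCoeff_fourier (T := 2 * Real.pi) 0) (n : ℤ)
    have h0 : ((fourier 0 : C(Torus, ℂ)) : Torus → ℂ) = fun _ => 1 := by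
      ext t; exact fourier_zero
    rw [h0] at h
    rw [h]
    rcases Nat.eq_zero_or_pos n with rfl | hn
    · simp
    · rw [Pi.single_eq_of_ne (by omega), Pi.single_eq_of_ne (by omega)]
  have hz' : ‖z‖ < 1 := by simpa using hz
  have hker : ∀ t : Torus, (circlePoint t + z) / (circlePoint t - z) =
      2 * ((∑' n : ℕ, z ^ id n * fourier (-(n : ℤ)) t) * 1) - 1 := fun t => by
    have hne := circlePoint_sub_ne_zero hz t
    have hu0 : circlePoint t ≠ 0 := by rw [← norm_ne_zero_iff]; simp
    have h1 : ∑' n : ℕ, z ^ id n * fourier (-(n : ℤ)) t = (1 - z / circlePoint t)⁻¹ := by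
      rw [← tsum_geometric_of_norm_lt_one (by simpa using hz')]
      refine tsum_congr fun n => ?_
      rw [fourier_neg, fourier_natCast_apply, map_pow, div_pow, id, div_eq_mul_inv, ← inv_pow,
        Complex.inv_def, Complex.normSq_eq_norm_sq, norm_circlePoint]
      simp
    rw [h1]
    have h2 : 1 - z / circlePoint t ≠ 0 := by
      rw [one_sub_div hu0]; exact div_ne_zero hne hu0
    field_simp
    ring
  simp only [hker]
  rw [integral_sub (i1.const_mul 2) (integrable_const _), integral_const_mul,
    ← s1.tsum_eq]
  simp only [neg_neg, hcoeff]
  rw [tsum_eq_single 0 fun n hn => by rw [Pi.single_eq_of_ne hn, mul_zero]]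
  simp
  norm_num

/-- The Herglotz integral has radial limits at the points where `g` is locally constant. -/
theorem tendsto_herglotz_radial {g : Torus → ℝ} (hg : Measurable g) {M : ℝ} (hM : ∀ t, |g t| ≤ M)
    {t₀ : Torus} (ht₀ : ∀ᶠ t in 𝓝 t₀, g t = g t₀) :
    Tendsto (fun j => herglotz g (radius j * circlePoint t₀)) atTop
      (𝓝 (herglotzBoundary g t₀)) := by
  obtain ⟨U, hU, hUo, htU⟩ := eventually_nhds_iff.1 ht₀
  have hgi := integrable_of_bounded hg hM
  have hgd : Integrable (fun t => g t - g t₀) haarT := hgi.sub (integrable_const _)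
  obtain ⟨δ, hδ0, hδ⟩ : ∃ δ > 0, ∀ t ∈ Uᶜ, δ ≤ ‖circlePoint t - circlePoint t₀‖ := by
    rcases Uᶜ.eq_empty_or_nonempty with he | hne
    · exact ⟨1, one_pos, by simp [he]⟩
    · obtain ⟨t, ht, hmin⟩ := hUo.isClosed_compl.isCompact.exists_isMinOn hne
        (continuous_circlePoint.sub continuous_const).norm.continuousOn
      refine ⟨_, norm_pos_iff.2 (sub_ne_zero.2 fun h => ?_), hmin⟩
      exact ht (injective_circlePoint h ▸ htU)
  -- Since the kernel has mean one, the constant `g t₀` can be split off. The remaining density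
  -- vanishes near `t₀`, so the singularity of the limiting kernel is never met.
  have heq : ∀ j, herglotz g (radius j * circlePoint t₀) = (g t₀ : ℂ) +
      ∫ t : Torus, (circlePoint t + radius j * circlePoint t₀) /
        (circlePoint t - radius j * circlePoint t₀) * ((g t - g t₀ : ℝ) : ℂ) ∂haarT := fun j => by
    have hz := radius_mul_mem_disk j (norm_circlePoint t₀).le
    have h1 : ∀ t : Torus, (circlePoint t + radius j * circlePoint t₀) /
        (circlePoint t - radius j * circlePoint t₀) * (g t : ℂ) =
        (circlePoint t + radius j * circlePoint t₀) /
        (circlePoint t - radius j * circlePoint t₀) * (g t₀ : ℂ) +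
        (circlePoint t + radius j * circlePoint t₀) /
        (circlePoint t - radius j * circlePoint t₀) * ((g t - g t₀ : ℝ) : ℂ) := fun t => by
      push_cast; ring
    unfold herglotz
    simp only [h1]
    rw [integral_add (integrable_herglotz (g := fun _ => g t₀) (integrable_const _) hz)
      (integrable_herglotz hgd hz), integral_mul_const, integral_herglotz_kernel hz, one_mul]
  simp only [heq]
  refine tendsto_const_nhds.add ?_
  have hM0 : 0 ≤ M := (abs_nonneg _).trans (hM t₀)
  refine tendsto_integral_filter_of_dominated_convergence (fun _ => 2 / (δ / 2) * (2 * M))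
    (Eventually.of_forall fun j =>
      (integrable_herglotz hgd
        (radius_mul_mem_disk j (norm_circlePoint t₀).le)).aestronglyMeasurable)
    ?_ (integrable_const _) (Eventually.of_forall fun t => ?_)
  · filter_upwards [tendsto_radius.eventually (lt_mem_nhds (show 1 - δ / 2 < 1 by linarith))]
      with j hj
    refine Eventually.of_forall fun t => ?_
    by_cases htU' : t ∈ U
    · rw [hU t htU']
      simp only [sub_self, Complex.ofReal_zero, mul_zero, norm_zero]
      positivity
    · have h1 : δ / 2 ≤ ‖circlePoint t - radius j * circlePoint t₀‖ := by
        have h2 := hδ t htU'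
        have h3 : circlePoint t - circlePoint t₀ = (circlePoint t - radius j * circlePoint t₀) -
          ((1 - radius j : ℝ) : ℂ) * circlePoint t₀ := by push_cast; ring
        have h4 := norm_sub_le (circlePoint t - radius j * circlePoint t₀)
          (((1 - radius j : ℝ) : ℂ) * circlePoint t₀)
        rw [← h3, norm_mul, Complex.norm_real, norm_circlePoint, mul_one,
          Real.norm_of_nonneg (by linarith [radius_lt_one j])] at h4
        linarith
      have h5 : ‖circlePoint t + radius j * circlePoint t₀‖ ≤ 2 := by
        refine (norm_add_le _ _).trans ?_
        rw [norm_radius_mul, norm_circlePoint, norm_circlePoint]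
        linarith [radius_lt_one j]
      have h6 : ‖((g t - g t₀ : ℝ) : ℂ)‖ ≤ 2 * M := by
        rw [Complex.norm_real]
        refine (norm_sub_le _ _).trans ?_
        have := hM t
        have := hM t₀
        simp only [Real.norm_eq_abs]
        linarith
      rw [norm_mul, norm_div]
      gcongr
  · by_cases htU' : t ∈ U
    · rw [hU t htU']
      simp
    · refine Tendsto.mul_const _ (Tendsto.div ?_ ?_ ?_)
      · exact (tendsto_radius_mul _).const_add _
      · exact (tendsto_radius_mul _).const_sub _
      · exact norm_pos_iff.1 (hδ0.trans_le (hδ t htU'))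

/-! ### Real part of the boundary values -/

theorem re_div_sub_circlePoint (t t₀ : Torus) :
    ((circlePoint t + circlePoint t₀) / (circlePoint t - circlePoint t₀)).re = 0 := by
  have := congrFun (poissonKernel_eq_re_herglotzRieszKernel (c := 0) (w := circlePoint t₀))
    (circlePoint t)
  simp only [poissonKernel, herglotzRieszKernel, Function.comp_apply, sub_zero,
    norm_circlePoint, sub_self, zero_div] at this
  exact this.symm

theorem re_herglotzBoundary (g : Torus → ℝ) (t₀ : Torus) :
    (herglotzBoundary g t₀).re = g t₀ := by
  unfold herglotzBoundary
  rw [Complex.add_re, Complex.ofReal_re, add_eq_left]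
  by_cases hi : Integrable (fun t : Torus => (circlePoint t + circlePoint t₀) /
    (circlePoint t - circlePoint t₀) * ((g t - g t₀ : ℝ) : ℂ)) haarT
  · have h := integral_re (𝕜 := ℂ) hi
    simp only [RCLike.re_to_complex, Complex.re_mul_ofReal, re_div_sub_circlePoint, zero_mul,
      integral_zero] at h
    exact h.symm
  -- An integral that does not converge is `0` by convention, so the identity holds at every point,
  -- not only where `g` is locally constant.
  · rw [integral_undef hi, Complex.zero_re]

section

variable {Ψ : OrliczFunction}

/-! ### Power series with the growth of functions in the Hardy–Orlicz space -/

/-- The sum of the power series with coefficients `a`. -/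
def powerSum (a : ℕ → ℂ) (w : ℂ) : ℂ := ∑' n : ℕ, a n * w ^ n

/-- The growth of the coefficients and of the sum of a power series that is shared by all functions
of norm at most `M` in the Hardy–Orlicz space, up to a constant. -/
def HasGrowth (Ψ : OrliczFunction) (M : ℝ) (a : ℕ → ℂ) : Prop :=
  (∀ n, ‖a n‖ ≤ M) ∧ ∀ s : ℝ, 0 < s → ∀ w : ℂ, ‖w‖ ≤ 1 - 2 / Ψ s → ‖powerSum a w‖ ≤ M * s

theorem mem_disk_of_norm_le {s : ℝ} (hs : 0 < s) {w : ℂ} (hw : ‖w‖ ≤ 1 - 2 / Ψ s) : w ∈ disk := by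
  rw [mem_ball_zero_iff]
  have : 0 < 2 / Ψ s := div_pos two_pos (Ψ.pos hs)
  linarith

theorem tendsto_powerSum {a : ℕ → ℕ → ℂ} {a' : ℕ → ℂ} {M : ℝ} (hM : ∀ j n, ‖a j n‖ ≤ M)
    (ha : ∀ n, Tendsto (fun j => a j n) atTop (𝓝 (a' n))) {w : ℂ} (hw : w ∈ disk) :
    Tendsto (fun j => powerSum (a j) w) atTop (𝓝 (powerSum a' w)) := by
  have hw' : ‖w‖ < 1 := by simpa using hw
  refine tendsto_tsum_of_dominated_convergence
    ((summable_geometric_of_lt_one (norm_nonneg w) hw').mul_left M)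
    (fun n => (ha n).mul_const _) (Eventually.of_forall fun j n => ?_)
  rw [norm_mul, norm_pow]
  gcongr
  exact hM j n

theorem differentiableOn_powerSum {a : ℕ → ℂ} {M : ℝ} (hM : ∀ n, ‖a n‖ ≤ M) :
    DifferentiableOn ℂ (powerSum a) disk := by
  intro z hz
  have hz' : ‖z‖ < 1 := by simpa using hz
  have hρ : ‖z‖ < (1 + ‖z‖) / 2 := by linarith
  have h := Complex.differentiableOn_tsum_of_summable_norm (F := fun n (w : ℂ) => a n * w ^ n)
    (u := fun n => M * ((1 + ‖z‖) / 2) ^ n)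
    ((summable_geometric_of_lt_one (by positivity) (by linarith)).mul_left M)
    (fun n => by fun_prop) (Metric.isOpen_ball (x := (0 : ℂ)) (ε := (1 + ‖z‖) / 2))
    (fun n w hw => by
      rw [norm_mul, norm_pow]
      have hw' : ‖w‖ < (1 + ‖z‖) / 2 := by simpa using hw
      gcongr
      · exact (norm_nonneg _).trans (hM n)
      · exact hM n)
  exact (h.differentiableAt
    (Metric.isOpen_ball.mem_nhds (by simpa using hρ))).differentiableWithinAt

theorem continuousAt_powerSum {a : ℕ → ℂ} {M : ℝ} (hM : ∀ n, ‖a n‖ ≤ M) {w : ℂ} (hw : w ∈ disk) :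
    ContinuousAt (powerSum a) w :=
  ((differentiableOn_powerSum hM).differentiableAt (Metric.isOpen_ball.mem_nhds hw)).continuousAt

theorem norm_powerSum_le {a : ℕ → ℂ} {M : ℝ} (hM : ∀ n, ‖a n‖ ≤ M) {w : ℂ} {ρ : ℝ}
    (hw : ‖w‖ ≤ ρ) (hρ : ρ < 1) : ‖powerSum a w‖ ≤ M * (1 - ρ)⁻¹ := by
  have hρ0 : 0 ≤ ρ := (norm_nonneg w).trans hw
  refine tsum_of_norm_bounded ((hasSum_geometric_of_lt_one hρ0 hρ).mul_left M) fun n => ?_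
  rw [norm_mul, norm_pow]
  gcongr
  · exact (norm_nonneg _).trans (hM n)
  · exact hM n

/-- This takes the place of Montel's theorem. The coefficient bounds put the set in a product of
closed disks, compact by Tychonoff, and the growth bound survives coefficientwise limits. The
product is countable, so sequences detect closedness. -/
theorem isCompact_setOf_hasGrowth (M : ℝ) : IsCompact {a : ℕ → ℂ | HasGrowth Ψ M a} := by
  refine (isCompact_univ_pi fun _ : ℕ => isCompact_closedBall (0 : ℂ) M).of_isClosed_subset ?_
    fun a ha n _ => by simpa using ha.1 n
  refine IsSeqClosed.isClosed fun a a' ha hlim => ?_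
  rw [tendsto_pi_nhds] at hlim
  refine ⟨fun n => le_of_tendsto (hlim n).norm (Eventually.of_forall fun j => (ha j).1 n),
    fun s hs w hw => ?_⟩
  exact le_of_tendsto
    (tendsto_powerSum (fun j => (ha j).1) hlim (mem_disk_of_norm_le hs hw)).norm
    (Eventually.of_forall fun j => (ha j).2 s hs w hw)

theorem exists_hasGrowth (Ψ : OrliczFunction) : ∃ K : ℝ, 0 < K ∧ ∀ f : hardyOrlicz Ψ, ∀ M : ℝ,
    K * ‖f‖ ≤ M → HasGrowth Ψ M fun n : ℕ => fourierCoeff (boundary f) (n : ℤ) := by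
  -- With `Ψ s ≥ 2` the coefficients are bounded by `2 * s * ‖f‖`, and with `s ≥ 1` the same
  -- constant covers the point evaluations.
  obtain ⟨s, hs2, hs1⟩ :=
    ((Ψ.tendsto_atTop.eventually_ge_atTop 2).and (eventually_ge_atTop 1)).exists
  have hs0 : 0 < s := one_pos.trans_le hs1
  refine ⟨2 * s, by positivity, fun f M hM => ⟨fun n => ?_, fun x hx w hw => ?_⟩⟩
  · exact (norm_fourierCoeff_boundary_le f hs0 hs2 n).trans hM
  · calc ‖diskExt f w‖ ≤ 2 * x * ‖f‖ := norm_diskExt_le f hx hw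
      _ = 2 * 1 * ‖f‖ * x := by ring
      _ ≤ 2 * s * ‖f‖ * x := by gcongr
      _ ≤ M * x := by gcongr

/-! ### Composition operators with a well controlled symbol -/

/-- `φ` is an analytic self map of the disk with radial limits `b`, and `y` is a function in the
Morse–Transue space that controls the distance of `b` to the unit circle. -/
structure ControlledSymbol (Ψ : OrliczFunction) (φ : ℂ → ℂ) (b : Torus → ℂ) (y : Torus → ℝ) :
    Prop where
  differentiableOn : DifferentiableOn ℂ φ disk
  mapsTo : MapsTo φ disk disk
  tendsto : ∀ᵐ t ∂haarT, Tendsto (fun j => φ (radius j * circlePoint t)) atTop (𝓝 (b t))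
  measurable : Measurable y
  pos : ∀ t, 0 < y t
  norm_le : ∀ᵐ t ∂haarT, ‖b t‖ ≤ 1 - 2 / Ψ (y t)
  modular_lt_top : ∀ C : ℝ, 0 < C → modular Ψ haarT (fun t => (y t : ℂ)) C < ⊤

theorem norm_ofReal_div_div {M C x : ℝ} (hx : 0 < x) :
    ‖(x : ℂ)‖ / (C / M) = M * x / C := by
  rw [Complex.norm_real, Real.norm_of_nonneg hx.le, div_div_eq_mul_div, mul_comm]

namespace ControlledSymbol

variable {φ : ℂ → ℂ} {b : Torus → ℂ} {y : Torus → ℝ}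

theorem mem_disk (H : ControlledSymbol Ψ φ b y) : ∀ᵐ t ∂haarT, b t ∈ disk := by
  filter_upwards [H.norm_le] with t ht
  exact mem_disk_of_norm_le (H.pos t) ht

theorem mk_mem (H : ControlledSymbol Ψ φ b y) : AEEqFun.mk (fun t => (y t : ℂ))
    (Complex.measurable_ofReal.comp H.measurable).aestronglyMeasurable ∈ orliczSpace Ψ haarT := by
  refine ⟨1, one_pos, ?_⟩
  rw [modular_congr (AEEqFun.coeFn_mk _ _)]
  exact H.modular_lt_top 1 one_pos

theorem integrable (H : ControlledSymbol Ψ φ b y) : Integrable y haarT := by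
  have h := integrable_of_mem_orliczSpace ⟨_, H.mk_mem⟩
  have h2 := (h.congr (AEEqFun.coeFn_mk _ _)).re
  simpa using h2

theorem norm_powerSum_comp_le (H : ControlledSymbol Ψ φ b y) {M : ℝ} {a : ℕ → ℂ} (ha
    : HasGrowth Ψ M a) :
    ∀ᵐ t ∂haarT, ‖powerSum a (b t)‖ ≤ M * y t := by
  filter_upwards [H.norm_le] with t ht
  exact ha.2 _ (H.pos t) _ ht

/-- Composition with the boundary values of `φ` gives the boundary values of the composition. -/
theorem hasDiskExt_comp (H : ControlledSymbol Ψ φ b y) {M : ℝ} {a : ℕ → ℂ} (ha : HasGrowth Ψ M a) :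
    HasDiskExt (fun t => powerSum a (b t)) (fun z => powerSum a (φ z)) := by
  have hnorm : ∀ j z, z ∈ disk → ‖(radius j : ℂ) * z‖ ≤ radius j := fun j z hz => by
    rw [norm_radius_mul]
    exact mul_le_of_le_one_right (radius_nonneg j) (mem_ball_zero_iff.1 hz).le
  have hmem : ∀ j z, z ∈ disk → (radius j : ℂ) * z ∈ disk := fun j z hz =>
    radius_mul_mem_disk j (mem_ball_zero_iff.1 hz).le
  -- The series itself may be unbounded on the disk. Shrinking its argument by `radius j` makes the
  -- composition bounded, so the bounded case applies; since `|radius j * b| ≤ |b|`, the bound `M *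
  -- y` holds uniformly in `j` and allows the passage to the limit.
  have hdil : ∀ j, HasDiskExt (fun t => powerSum a (radius j * b t))
      (fun z => powerSum a (radius j * φ z)) := fun j => by
    refine hasDiskExt_of_bounded (M := M * (1 - radius j)⁻¹) ?_ (fun z hz => ?_) ?_
    · exact (differentiableOn_powerSum ha.1).comp (H.differentiableOn.const_mul _)
        fun z hz => hmem j _ (H.mapsTo hz)
    · exact norm_powerSum_le ha.1 (hnorm j _ (H.mapsTo hz)) (radius_lt_one j)
    · filter_upwards [H.tendsto, H.mem_disk] with t ht htd
      exact (continuousAt_powerSum ha.1 (hmem j _ htd)).tendsto.comp (ht.const_mul _)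
  refine hasDiskExt_of_tendsto hdil (H.integrable.const_mul M) (fun j => ?_) ?_ fun z hz => ?_
  · filter_upwards [H.norm_le] with t ht
    refine ha.2 _ (H.pos t) _ (le_trans ?_ ht)
    rw [norm_radius_mul]
    exact mul_le_of_le_one_left (norm_nonneg _) (radius_lt_one j).le
  · filter_upwards [H.mem_disk] with t ht
    exact (continuousAt_powerSum ha.1 ht).tendsto.comp (tendsto_radius_mul _)
  · exact (continuousAt_powerSum ha.1 (H.mapsTo hz)).tendsto.comp (tendsto_radius_mul _)

theorem modular_le_of_norm_le (H : ControlledSymbol Ψ φ b y) {M C : ℝ} (hC : 0 < C) {g : Torus → ℂ}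
    (hg : ∀ᵐ t ∂haarT, ‖g t‖ ≤ M * y t) :
    modular Ψ haarT g C ≤ modular Ψ haarT (fun t => (y t : ℂ)) (C / M) := by
  refine modular_mono hC ?_
  filter_upwards [hg] with t ht
  rw [norm_ofReal_div_div (H.pos t)]
  gcongr

theorem mk_comp_mem (H : ControlledSymbol Ψ φ b y) {M : ℝ} (hM : 0 < M) {a : ℕ → ℂ} (ha
    : HasGrowth Ψ M a) :
    AEEqFun.mk (fun t => powerSum a (b t)) (H.hasDiskExt_comp ha).1.aestronglyMeasurable ∈
      orliczSpace Ψ haarT := by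
  refine ⟨1, one_pos, ?_⟩
  rw [modular_congr (AEEqFun.coeFn_mk _ _)]
  exact (H.modular_le_of_norm_le one_pos (H.norm_powerSum_comp_le ha)).trans_lt
    (H.modular_lt_top _ (by positivity))

/-- The element of the Hardy–Orlicz space with boundary values `powerSum a ∘ b`. -/
def compElement (H : ControlledSymbol Ψ φ b y) {M : ℝ} (hM : 0 < M) {a : ℕ → ℂ} (ha
    : HasGrowth Ψ M a) : hardyOrlicz Ψ :=
  ⟨⟨_, H.mk_comp_mem hM ha⟩,
    ((H.hasDiskExt_comp ha).congr_left (AEEqFun.coeFn_mk _ _).symm).2.1⟩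

theorem boundary_compElement (H : ControlledSymbol Ψ φ b y) {M : ℝ} (hM : 0 < M) {a : ℕ → ℂ} (ha
    : HasGrowth Ψ M a) :
    boundary (H.compElement hM ha) =ᵐ[haarT] fun t => powerSum a (b t) :=
  AEEqFun.coeFn_mk _ _

/-- Coefficientwise convergence gives pointwise convergence on the circle, with differences
dominated by `2 * M * y`. Because `y` has finite modular at every scale, dominated convergence
drives the modular to `0` at each scale `ε / 2`, which is norm convergence. Membership of `y` in the
Orlicz space alone would not suffice for this argument. -/
theorem continuous_compElement (H : ControlledSymbol Ψ φ b y) {M : ℝ} (hM : 0 < M) :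
    Continuous fun a : {a : ℕ → ℂ // HasGrowth Ψ M a} => H.compElement hM a.2 := by
  rw [continuous_iff_seqContinuous]
  intro a a' hlim
  rw [tendsto_iff_norm_sub_tendsto_zero]
  have hlim' : ∀ n, Tendsto (fun j => (a j).1 n) atTop (𝓝 (a'.1 n)) :=
    tendsto_pi_nhds.1 ((continuous_subtype_val.tendsto a').comp hlim)
  have hbd : ∀ j, boundary (H.compElement hM (a j).2 - H.compElement hM a'.2) =ᵐ[haarT]
      fun t => powerSum (a j).1 (b t) - powerSum a'.1 (b t) := fun j => by
    filter_upwards [AEEqFun.coeFn_sub (H.compElement hM (a j).2).1.1 (H.compElement hM a'.2).1.1,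
      H.boundary_compElement hM (a j).2, H.boundary_compElement hM a'.2] with t h1 h2 h3
    rw [← h2, ← h3]
    exact h1
  rw [Metric.tendsto_atTop']
  intro ε hε
  have hmod : Tendsto (fun j => modular Ψ haarT
      (boundary (H.compElement hM (a j).2 - H.compElement hM a'.2)) (ε / 2)) atTop (𝓝 0) := by
    have hz : (0 : ENNReal) = ∫⁻ _ : Torus, 0 ∂haarT := by simp
    rw [hz]
    refine tendsto_lintegral_of_dominated_convergence'
      (fun t => ENNReal.ofReal (Ψ (‖(y t : ℂ)‖ / (ε / 2 / (2 * M))))) (fun j =>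
        aemeasurable_modular (integrable_boundary _).aestronglyMeasurable (by positivity))
      (fun j => ?_) (H.modular_lt_top _ (by positivity)).ne ?_
    · filter_upwards [hbd j, H.norm_powerSum_comp_le (a j).2, H.norm_powerSum_comp_le a'.2]
        with t h1 h2 h3
      refine ENNReal.ofReal_le_ofReal (Ψ.mono (by positivity) ?_)
      rw [norm_ofReal_div_div (H.pos t), h1]
      have := norm_sub_le (powerSum (a j).1 (b t)) (powerSum a'.1 (b t))
      gcongr
      linarith
    · filter_upwards [ae_all_iff.2 hbd, H.mem_disk] with t ht htd
      have h1 : Tendsto (fun j => powerSum (a j).1 (b t) - powerSum a'.1 (b t)) atTop (𝓝 0) := by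
        have := (tendsto_powerSum (fun j => (a j).2.1) hlim' htd).sub_const (powerSum a'.1 (b t))
        rwa [sub_self] at this
      have h2 : Tendsto (fun j => ‖powerSum (a j).1 (b t) - powerSum a'.1 (b t)‖ / (ε / 2)) atTop
          (𝓝[≥] 0) := by
        refine tendsto_nhdsWithin_iff.2 ⟨?_, Eventually.of_forall fun j =>
          mem_Ici.2 (by positivity)⟩
        have := h1.norm.div_const (ε / 2)
        rwa [norm_zero, zero_div] at this
      have h3 := Ψ.continuousWithinAt_zero.tendsto.comp h2
      rw [Ψ.map_zero] at h3
      have h4 := ENNReal.tendsto_ofReal h3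
      rw [ENNReal.ofReal_zero] at h4
      refine h4.congr fun j => ?_
      rw [Function.comp_apply, ht j]
  have hev := hmod.eventually (ge_mem_nhds (show (0 : ENNReal) < 1 from one_pos))
  obtain ⟨N, hN⟩ := eventually_atTop.1 hev
  refine ⟨N, fun j hj => ?_⟩
  have : ‖H.compElement hM (a j).2 - H.compElement hM a'.2‖ ≤ ε / 2 :=
    norm_le_of_modular_le_one (f := (H.compElement hM (a j).2 - H.compElement hM a'.2).1)
      (half_pos hε) (hN j hj.le)
  rw [Real.dist_eq, sub_zero, abs_of_nonneg (norm_nonneg _)]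
  exact this.trans_lt (half_lt_self hε)

/-- A scale `C` at which the modular of `y` is at most one works for every `M` and every coefficient
sequence, by domination. -/
theorem norm_compElement_le (H : ControlledSymbol Ψ φ b y) : ∃ C : ℝ, 0 < C ∧ ∀ {M : ℝ} (hM
    : 0 < M) {a : ℕ → ℂ}
    (ha : HasGrowth Ψ M a), ‖H.compElement hM ha‖ ≤ C * M := by
  obtain ⟨C, hC, hC1⟩ := exists_modular_le_one (⟨_, H.mk_mem⟩ : orliczSpace Ψ haarT)
  rw [modular_congr (AEEqFun.coeFn_mk _ _)] at hC1
  refine ⟨C, hC, fun {M} hM {a} ha => norm_le_of_modular_le_one (f := (H.compElement hM ha).1)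
    (by positivity) ?_⟩
  refine (H.modular_le_of_norm_le (by positivity) (?_ : ∀ᵐ t ∂haarT,
    ‖boundary (H.compElement hM ha) t‖ ≤ M * y t)).trans ?_
  · filter_upwards [H.boundary_compElement hM ha, H.norm_powerSum_comp_le ha] with t h1 h2
    rwa [h1]
  · rwa [mul_div_cancel_right₀ _ hM.ne']

/-- The composition operator exists, is order bounded into the Morse–Transue space and compact; its
boundary values are given by composition with `b`. -/
theorem exists_compositionOperator (H : ControlledSymbol Ψ φ b y) : ∃ T
    : hardyOrlicz Ψ →L[ℂ] hardyOrlicz Ψ,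
    IsCompositionOperator φ T ∧ IsOrderBoundedIntoMorseTransue T ∧ IsCompactOperator T ∧
      ∀ f, boundary (T f) =ᵐ[haarT] fun t => diskExt f (b t) := by
  obtain ⟨K, hK, hgr⟩ := exists_hasGrowth Ψ
  obtain ⟨C, hC, hnorm⟩ := H.norm_compElement_le
  -- The added `1` keeps the growth constant positive at `f = 0`. The choice is immaterial, since
  -- the boundary values determine the element.
  have hpos : ∀ f : hardyOrlicz Ψ, 0 < K * (‖f‖ + 1) := fun f => by positivity
  have hg : ∀ f : hardyOrlicz Ψ, HasGrowth Ψ (K * (‖f‖ + 1))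
      fun n : ℕ => fourierCoeff (boundary f) (n : ℤ) := fun f =>
    hgr f _ (mul_le_mul_of_nonneg_left (by linarith) hK.le)
  have hbd : ∀ f : hardyOrlicz Ψ, ∀ {M : ℝ} (hM : 0 < M)
      (ha : HasGrowth Ψ M fun n : ℕ => fourierCoeff (boundary f) (n : ℤ)),
      boundary (H.compElement hM ha) =ᵐ[haarT] fun t => diskExt f (b t) := fun f M hM ha =>
    H.boundary_compElement hM ha
  have hext : ∀ {f g : hardyOrlicz Ψ}, boundary f =ᵐ[haarT] boundary g → f = g :=
    fun h => Subtype.ext (Subtype.ext (AEEqFun.ext h))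
  have hadd : ∀ (f g : hardyOrlicz Ψ), ∀ w ∈ disk, diskExt (f + g) w = diskExt f w + diskExt g w :=
    fun f g w hw => by
      have h : boundary (f + g) =ᵐ[haarT] boundary f + boundary g := AEEqFun.coeFn_add f.1.1 g.1.1
      simp only [diskExt]
      rw [fourierCoeff_congr_ae h, fourierCoeff.add (integrable_boundary f) (integrable_boundary g),
        ← (summable_fourierCoeff_mul_pow _ hw).tsum_add (summable_fourierCoeff_mul_pow _ hw)]
      exact tsum_congr fun n => by rw [Pi.add_apply, add_mul]
  have hsmul : ∀ (c : ℂ) (f : hardyOrlicz Ψ) (w : ℂ), diskExt (c • f) w = c * diskExt f w :=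
    fun c f w => by
      have h : boundary (c • f) =ᵐ[haarT] c • boundary f := AEEqFun.coeFn_smul c f.1.1
      simp only [diskExt]
      rw [fourierCoeff_congr_ae h, ← tsum_mul_left]
      exact tsum_congr fun n => by rw [fourierCoeff.const_smul, smul_eq_mul, mul_assoc]
  let L : hardyOrlicz Ψ →ₗ[ℂ] hardyOrlicz Ψ :=
    { toFun := fun f => H.compElement (hpos f) (hg f)
      map_add' := fun f g => by
        refine hext ?_
        filter_upwards [hbd (f + g) (hpos _) (hg _), hbd f (hpos _) (hg _), hbd g (hpos _) (hg _),
          AEEqFun.coeFn_add (H.compElement (hpos f) (hg f)).1.1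
            (H.compElement (hpos g) (hg g)).1.1, H.mem_disk] with t h1 h2 h3 h4 htd
        rw [h1, hadd f g _ htd, ← h2, ← h3]
        exact h4.symm
      map_smul' := fun c f => by
        refine hext ?_
        filter_upwards [hbd (c • f) (hpos _) (hg _), hbd f (hpos _) (hg _),
          AEEqFun.coeFn_smul c (H.compElement (hpos f) (hg f)).1.1] with t h1 h2 h4
        rw [h1, hsmul c f, ← h2]
        exact h4.symm }
  have hL : ∀ f, boundary (L f) =ᵐ[haarT] fun t => diskExt f (b t) := fun f =>
    hbd f (hpos f) (hg f)
  have hLeq : ∀ f, ∀ {M : ℝ} (hM : 0 < M)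
      (ha : HasGrowth Ψ M fun n : ℕ => fourierCoeff (boundary f) (n : ℤ)),
      L f = H.compElement hM ha := fun f M hM ha => hext ((hL f).trans (hbd f hM ha).symm)
  -- The same element is described with the growth constant `x / C` for every `x` above `C * K *
  -- ‖f‖`, which removes the added `1`.
  have hbound : ∀ f, ‖L f‖ ≤ C * K * ‖f‖ := fun f => by
    refine le_of_forall_gt_imp_ge_of_dense fun x hx => ?_
    have hx0 : 0 < x := lt_of_le_of_lt (by positivity) hx
    have hM : 0 < x / C := by positivity
    have hM' : K * ‖f‖ ≤ x / C := by
      rw [le_div_iff₀ hC]; linarith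
    rw [hLeq f hM (hgr f _ hM')]
    refine (hnorm hM _).trans (le_of_eq ?_)
    field_simp
  refine ⟨L.mkContinuous (C * K) hbound, fun f z hz => ?_, ?_, ?_, hL⟩
  · have h1 := ((H.hasDiskExt_comp (hg f)).congr_left (hL f).symm).2.2 z hz
    exact h1.tsum_eq
  · refine ⟨(K : ℂ) • ⟨_, H.mk_mem⟩, Submodule.smul_mem _ _ fun c hc => ?_, ?_, fun f hf => ?_⟩
    · rw [modular_congr (AEEqFun.coeFn_mk _ _)]
      exact H.modular_lt_top c hc
    · filter_upwards [AEEqFun.coeFn_smul (K : ℂ) (AEEqFun.mk (fun t => (y t : ℂ))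
        (Complex.measurable_ofReal.comp H.measurable).aestronglyMeasurable),
        AEEqFun.coeFn_mk (fun t => (y t : ℂ))
          (Complex.measurable_ofReal.comp H.measurable).aestronglyMeasurable] with t h1 h2
      rw [Submodule.coe_smul, h1, Pi.smul_apply, h2, smul_eq_mul, ← Complex.ofReal_mul]
      exact ⟨by simpa using mul_nonneg hK.le (H.pos t).le, Complex.ofReal_im _⟩
    · filter_upwards [AEEqFun.coeFn_smul (K : ℂ) (AEEqFun.mk (fun t => (y t : ℂ))
        (Complex.measurable_ofReal.comp H.measurable).aestronglyMeasurable),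
        AEEqFun.coeFn_mk (fun t => (y t : ℂ))
          (Complex.measurable_ofReal.comp H.measurable).aestronglyMeasurable, hL f,
        H.norm_powerSum_comp_le (hgr f K (mul_le_of_le_one_right hK.le hf))] with t h1 h2 h3 h4
      rw [Submodule.coe_smul, h1, Pi.smul_apply, h2, smul_eq_mul, ← Complex.ofReal_mul,
        Complex.ofReal_re]
      exact (congrArg norm h3).trans_le h4
  · have : CompactSpace {a : ℕ → ℂ // HasGrowth Ψ K a} :=
      isCompact_iff_compactSpace.1 (isCompact_setOf_hasGrowth K)
    -- The unit ball is mapped into the continuous image of the compact set of coefficient sequences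
    -- with growth constant `K`.
    refine ⟨_, isCompact_range (H.continuous_compElement hK), ?_⟩
    filter_upwards [Metric.closedBall_mem_nhds (0 : hardyOrlicz Ψ) one_pos] with f hf
    have hf' : ‖f‖ ≤ 1 := by simpa using hf
    exact ⟨⟨_, hgr f K (mul_le_of_le_one_right hK.le hf')⟩, (hLeq f hK _).symm⟩

end ControlledSymbol

end

section

variable {Ψ : OrliczFunction}

/-! ### Entire functions in the Hardy–Orlicz space -/

theorem hasDiskExt_of_entire {G : ℂ → ℂ} (hG : Differentiable ℂ G) :
    HasDiskExt (fun t => G (circlePoint t)) G := by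
  obtain ⟨B, hB⟩ := (isCompact_closedBall (0 : ℂ) 1).exists_bound_of_continuousOn
    hG.continuous.continuousOn
  refine hasDiskExt_of_bounded hG.differentiableOn
    (fun z hz => hB z (Metric.ball_subset_closedBall hz)) (Eventually.of_forall fun t => ?_)
  exact (hG.continuous.tendsto _).comp (tendsto_radius_mul _)

theorem mk_entire_mem {G : ℂ → ℂ} (hG : Differentiable ℂ G) :
    AEEqFun.mk (fun t => G (circlePoint t)) (hasDiskExt_of_entire hG).1.aestronglyMeasurable ∈
      orliczSpace Ψ haarT := by
  obtain ⟨B, hB⟩ := isCompact_univ.exists_bound_of_continuousOn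
    (hG.continuous.comp continuous_circlePoint).continuousOn
  refine ⟨1, one_pos, ?_⟩
  rw [modular_congr (AEEqFun.coeFn_mk _ _)]
  refine lt_of_le_of_lt (lintegral_mono (g := fun _ => ENNReal.ofReal (Ψ B)) fun t => ?_) ?_
  · rw [div_one]
    exact ENNReal.ofReal_le_ofReal (Ψ.mono (norm_nonneg _) (hB t (mem_univ t)))
  · simp

variable (Ψ) in
/-- The restriction of an entire function to the disk, as an element of the Hardy–Orlicz space. -/
def entireElement {G : ℂ → ℂ} (hG : Differentiable ℂ G) : hardyOrlicz Ψ :=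
  ⟨⟨_, mk_entire_mem hG⟩,
    ((hasDiskExt_of_entire hG).congr_left (AEEqFun.coeFn_mk _ _).symm).2.1⟩

theorem boundary_entireElement {G : ℂ → ℂ} (hG : Differentiable ℂ G) :
    boundary (entireElement Ψ hG) =ᵐ[haarT] fun t => G (circlePoint t) :=
  AEEqFun.coeFn_mk _ _

theorem diskExt_entireElement {G : ℂ → ℂ} (hG : Differentiable ℂ G) {z : ℂ} (hz : z ∈ disk) :
    diskExt (entireElement Ψ hG) z = G z :=
  (((hasDiskExt_of_entire hG).congr_left
    (boundary_entireElement (Ψ := Ψ) hG).symm).2.2 z hz).tsum_eq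

/-! ### Weakly summable families -/

theorem boundary_sum {ι : Type*} (s : Finset ι) (u : ι → ℂ) (x : ι → hardyOrlicz Ψ) :
    boundary (∑ k ∈ s, u k • x k) =ᵐ[haarT] fun t => ∑ k ∈ s, u k * boundary (x k) t := by
  classical
  induction s using Finset.induction_on with
  | empty =>
    simp only [Finset.sum_empty]
    exact AEEqFun.coeFn_zero
  | insert k s hk ih =>
    simp only [Finset.sum_insert hk]
    filter_upwards [ih, AEEqFun.coeFn_add (u k • x k).1.1 (∑ k ∈ s, u k • x k).1.1,
      AEEqFun.coeFn_smul (u k) (x k).1.1] with t h1 h2 h3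
    rw [← h1]
    refine h2.trans ?_
    rw [Pi.add_apply]
    congr 1

/-- For `K = max 1 (Ψ 1)` convexity gives `Ψ (1 / K) ≤ Ψ 1 / K ≤ 1`, and the measure has mass one.
-/
theorem norm_le_of_boundary_le_one (f : hardyOrlicz Ψ) (hf : ∀ᵐ t ∂haarT, ‖boundary f t‖ ≤ 1) :
    ‖f‖ ≤ max 1 (Ψ 1) := by
  have hC : 0 < max 1 (Ψ 1) := one_pos.trans_le (le_max_left _ _)
  refine norm_le_of_modular_le_one (f := f.1) hC ?_
  have h1 : Ψ (1 / max 1 (Ψ 1)) ≤ 1 := by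
    have := Ψ.mul_le (x := 1) (a := (max 1 (Ψ 1))⁻¹) zero_le_one (by positivity)
      (inv_le_one_of_one_le₀ (le_max_left _ _))
    rw [mul_one] at this
    rw [one_div]
    refine this.trans ?_
    rw [inv_mul_le_iff₀ hC, mul_one]
    exact le_max_right _ _
  calc modular Ψ haarT (boundary f) (max 1 (Ψ 1)) ≤ ∫⁻ _ : Torus, 1 ∂haarT := by
        refine lintegral_mono_ae ?_
        filter_upwards [hf] with t ht
        rw [← ENNReal.ofReal_one]
        refine ENNReal.ofReal_le_ofReal (le_trans (Ψ.mono (by positivity) ?_) h1)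
        gcongr
    _ = 1 := by simp

/-- Multipliers of modulus at most one align the values of `ξ`, so that the sum becomes the value of
`ξ` at a single combination whose boundary function is still bounded by one. -/
theorem sum_norm_apply_le {n : ℕ} (x : Fin n → hardyOrlicz Ψ)
    (hx : ∀ᵐ t ∂haarT, ∑ k, ‖boundary (x k) t‖ ≤ 1) (ξ : StrongDual ℂ (hardyOrlicz Ψ))
    (hξ : ‖ξ‖ ≤ 1) : ∑ k, ‖ξ (x k)‖ ≤ max 1 (Ψ 1) := by
  have hu : ∀ k, ∃ u : ℂ, ‖u‖ ≤ 1 ∧ u * ξ (x k) = ‖ξ (x k)‖ := fun k => by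
    by_cases h : ξ (x k) = 0
    · exact ⟨0, by simp, by simp [h]⟩
    · have h' : (‖ξ (x k)‖ : ℂ) ≠ 0 := by exact_mod_cast norm_ne_zero_iff.2 h
      refine ⟨‖ξ (x k)‖ / ξ (x k), ?_, by field_simp⟩
      rw [norm_div, Complex.norm_real, norm_norm, div_self (norm_ne_zero_iff.2 h)]
  choose u hu1 hu2 using hu
  have hnorm : ‖∑ k, u k • x k‖ ≤ max 1 (Ψ 1) := by
    refine norm_le_of_boundary_le_one _ ?_
    filter_upwards [hx, boundary_sum Finset.univ u x] with t ht hb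
    rw [hb]
    refine (norm_sum_le _ _).trans (le_trans (Finset.sum_le_sum fun k _ => ?_) ht)
    rw [norm_mul]
    exact mul_le_of_le_one_left (norm_nonneg _) (hu1 k)
  have hval : ξ (∑ k, u k • x k) = ((∑ k, ‖ξ (x k)‖ : ℝ) : ℂ) := by
    rw [map_sum, Complex.ofReal_sum]
    exact Finset.sum_congr rfl fun k _ => by rw [map_smul, smul_eq_mul, hu2]
  have h1 := ξ.le_opNorm (∑ k, u k • x k)
  rw [hval, Complex.norm_real, Real.norm_of_nonneg (by positivity)] at h1
  refine h1.trans ((mul_le_of_le_one_left (norm_nonneg _) hξ).trans hnorm)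

/-- A `p`-summing operator on the Hardy–Orlicz space cannot be bounded below on many functions with
uniformly bounded sum of moduli. -/
theorem IsPSumming.exists_card_mul_le {T : hardyOrlicz Ψ →L[ℂ] hardyOrlicz Ψ} {p : ℝ}
    (hp : 1 ≤ p) (hT : IsPSumming p T) : ∃ D : ℝ, ∀ (n : ℕ) (x : Fin n → hardyOrlicz Ψ) (β : ℝ),
      (∀ᵐ t ∂haarT, ∑ k, ‖boundary (x k) t‖ ≤ 1) → 0 ≤ β → (∀ k, β ≤ ‖T (x k)‖) →
        n * β ^ p ≤ D := by
  obtain ⟨C, hC, h⟩ := hT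
  set B : ℝ := max 1 (Ψ 1) with hB
  have hB0 : 0 < B := one_pos.trans_le (le_max_left _ _)
  refine ⟨C ^ p * B ^ p, fun n x β hx hβ hle => ?_⟩
  calc (n : ℝ) * β ^ p = ∑ _k : Fin n, β ^ p := by simp
    _ ≤ ∑ k, ‖T (x k)‖ ^ p := Finset.sum_le_sum fun k _ =>
        Real.rpow_le_rpow hβ (hle k) (by linarith)
    _ ≤ _ := h n x
    _ ≤ _ := by
      gcongr
      have : Nonempty {ξ : StrongDual ℂ (hardyOrlicz Ψ) // ‖ξ‖ ≤ 1} :=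
        ⟨⟨0, ContinuousLinearMap.opNorm_zero.trans_le zero_le_one⟩⟩
      refine ciSup_le fun ξ => ?_
      have hS := sum_norm_apply_le x hx ξ.1 ξ.2
      -- For `p ≥ 1` a number in `[0, 1]` dominates its `p`-th power, so the weak `ℓ¹` bound
      -- controls the weak `ℓᵖ` sum.
      have hk : ∀ k, ‖ξ.1 (x k)‖ ^ p ≤ B ^ p * (‖ξ.1 (x k)‖ / B) := fun k => by
        have h1 : ‖ξ.1 (x k)‖ ≤ B := (Finset.single_le_sum
          (f := fun k => ‖ξ.1 (x k)‖) (fun _ _ => norm_nonneg _) (Finset.mem_univ k)).trans hS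
        have h2 : (‖ξ.1 (x k)‖ / B) ^ p ≤ ‖ξ.1 (x k)‖ / B := by
          rcases (norm_nonneg (ξ.1 (x k))).eq_or_lt with h0 | h0
          · rw [← h0, zero_div, Real.zero_rpow (by linarith)]
          · have := Real.rpow_le_rpow_of_exponent_ge (div_pos h0 hB0) ((div_le_one hB0).2 h1) hp
            rwa [Real.rpow_one] at this
        rw [Real.div_rpow (norm_nonneg _) hB0.le, div_le_iff₀ (by positivity)] at h2
        linarith
      calc _ ≤ ∑ k, B ^ p * (‖ξ.1 (x k)‖ / B) := Finset.sum_le_sum fun k _ => hk k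
        _ = B ^ p * ((∑ k, ‖ξ.1 (x k)‖) / B) := by rw [← Finset.mul_sum, Finset.sum_div]
        _ ≤ B ^ p * 1 := by
          gcongr
          exact (div_le_one hB0).2 hS
        _ = _ := mul_one _

/-! ### Fejér peaks -/

/-- Parseval's identity for the discrete Fourier transform of order `N`, from the orthogonality of
the powers of a primitive root. -/
theorem sum_norm_sq_sum_mul_pow {N : ℕ} {η : ℂ} (hη : IsPrimitiveRoot η N) (hN : N ≠ 0)
    (c : ℕ → ℂ) : ∑ k ∈ Finset.range N, ‖∑ j ∈ Finset.range N, c j * η ^ (k * j)‖ ^ 2 =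
      N * ∑ j ∈ Finset.range N, ‖c j‖ ^ 2 := by
  have hη1 : ‖η‖ = 1 := hη.norm'_eq_one hN
  have hη0 : η ≠ 0 := by intro h; simp [h] at hη1
  have hconj : starRingEnd ℂ η = η⁻¹ := by
    rw [Complex.inv_def, Complex.normSq_eq_norm_sq, hη1]; simp
  have horth : ∀ j ∈ Finset.range N, ∀ l ∈ Finset.range N,
      ∑ k ∈ Finset.range N, η ^ (k * j) * starRingEnd ℂ (η ^ (k * l)) =
        if j = l then (N : ℂ) else 0 := by
    intro j hj l hl
    have hq : ∀ k, η ^ (k * j) * starRingEnd ℂ (η ^ (k * l)) =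
        (η ^ j * (η⁻¹) ^ l) ^ k := fun k => by
      rw [map_pow, hconj, mul_pow, ← pow_mul, ← pow_mul, mul_comm j, mul_comm l]
    simp only [hq]
    split_ifs with h
    · rw [h, ← mul_pow, mul_inv_cancel₀ hη0]; simp
    · have hne : η ^ j * (η⁻¹) ^ l ≠ 1 := fun h1 => by
        rw [inv_pow, ← div_eq_mul_inv, div_eq_one_iff_eq (pow_ne_zero _ hη0)] at h1
        exact h (hη.pow_inj (Finset.mem_range.1 hj) (Finset.mem_range.1 hl) h1)
      rw [geom_sum_eq hne, mul_pow, ← pow_mul, ← pow_mul, mul_comm j, mul_comm l, pow_mul, pow_mul,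
        inv_pow, hη.pow_eq_one]
      simp
  have key : ((∑ k ∈ Finset.range N, ‖∑ j ∈ Finset.range N, c j * η ^ (k * j)‖ ^ 2 : ℝ) : ℂ) =
      ((N * ∑ j ∈ Finset.range N, ‖c j‖ ^ 2 : ℝ) : ℂ) := by
    push_cast
    simp only [← Complex.mul_conj', map_sum, map_mul, Finset.sum_mul_sum]
    rw [Finset.sum_comm, Finset.mul_sum]
    refine Finset.sum_congr rfl fun j hj => ?_
    rw [Finset.sum_comm]
    calc _ = ∑ l ∈ Finset.range N, c j * starRingEnd ℂ (c l) *
          ∑ k ∈ Finset.range N, η ^ (k * j) * starRingEnd ℂ (η ^ (k * l)) := by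
          refine Finset.sum_congr rfl fun l _ => ?_
          rw [Finset.mul_sum]
          exact Finset.sum_congr rfl fun k _ => by ring
      _ = ∑ l ∈ Finset.range N, if j = l then c j * starRingEnd ℂ (c l) * N else 0 := by
          refine Finset.sum_congr rfl fun l hl => ?_
          rw [horth j hj l hl, mul_ite, mul_zero]
      _ = _ := by
          rw [Finset.sum_ite_eq, if_pos hj]
          ring
  exact_mod_cast key

/-- An analytic version of the Fejér kernel of order `N`, with a peak at `exp (i x)`. -/
def fejerPeak (N : ℕ) (x : ℝ) (z : ℂ) : ℂ :=
  ((N : ℂ)⁻¹ * ∑ j ∈ Finset.range N, (Complex.exp (-(x : ℂ) * Complex.I) * z) ^ j) ^ 2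

theorem differentiable_fejerPeak (N : ℕ) (x : ℝ) : Differentiable ℂ (fejerPeak N x) := by
  unfold fejerPeak
  fun_prop

/-- Peaks spaced by `2π / N` are, up to the factor `N ^ (-2)`, the squares of the discrete Fourier
transform of one geometric progression with terms of modulus at most one. Parseval bounds the sum of
all `N` moduli by `N ^ (-2) * N * N`. The square in the definition of the peak turns this `ℓ²`
identity into an `ℓ¹` bound. -/
theorem sum_norm_fejerPeak_le {M N : ℕ} (hMN : M ≤ N) (hN : N ≠ 0) (x : ℝ) {z : ℂ} (hz : ‖z‖ ≤ 1) :
    ∑ k : Fin M, ‖fejerPeak N (x + 2 * Real.pi * k / N) z‖ ≤ 1 := by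
  have hN' : (N : ℂ) ≠ 0 := Nat.cast_ne_zero.2 hN
  have hNr : (0 : ℝ) < N := Nat.cast_pos.2 (Nat.pos_of_ne_zero hN)
  have hη := (Complex.isPrimitiveRoot_exp N hN).inv
  set η : ℂ := (Complex.exp (2 * Real.pi * Complex.I / N))⁻¹ with hηdef
  set c : ℕ → ℂ := fun j => (Complex.exp (-(x : ℂ) * Complex.I) * z) ^ j with hc
  have hterm : ∀ k : ℕ, ‖fejerPeak N (x + 2 * Real.pi * k / N) z‖ =
      ((N : ℝ) ^ 2)⁻¹ * ‖∑ j ∈ Finset.range N, c j * η ^ (k * j)‖ ^ 2 := fun k => by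
    have he : Complex.exp (-((x + 2 * Real.pi * k / N : ℝ) : ℂ) * Complex.I) =
        Complex.exp (-(x : ℂ) * Complex.I) * η ^ k := by
      rw [hηdef, ← Complex.exp_neg, ← Complex.exp_nat_mul, ← Complex.exp_add]
      congr 1
      push_cast
      ring
    have hs : ∑ j ∈ Finset.range N, (Complex.exp (-((x + 2 * Real.pi * k / N : ℝ) : ℂ) *
        Complex.I) * z) ^ j = ∑ j ∈ Finset.range N, c j * η ^ (k * j) := by
      refine Finset.sum_congr rfl fun j _ => ?_
      rw [he, hc, pow_mul]
      ring
    unfold fejerPeak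
    rw [hs, norm_pow, norm_mul, norm_inv, Complex.norm_natCast, mul_pow, inv_pow]
  calc _ = ∑ k ∈ Finset.range M, ‖fejerPeak N (x + 2 * Real.pi * k / N) z‖ :=
        Fin.sum_univ_eq_sum_range (fun k => ‖fejerPeak N (x + 2 * Real.pi * k / N) z‖) M
    _ ≤ ∑ k ∈ Finset.range N, ‖fejerPeak N (x + 2 * Real.pi * k / N) z‖ :=
        Finset.sum_le_sum_of_subset_of_nonneg (Finset.range_mono hMN) fun _ _ _ => norm_nonneg _
    _ = ((N : ℝ) ^ 2)⁻¹ * (N * ∑ j ∈ Finset.range N, ‖c j‖ ^ 2) := by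
        simp only [hterm]
        rw [← Finset.mul_sum, sum_norm_sq_sum_mul_pow hη hN]
    _ ≤ ((N : ℝ) ^ 2)⁻¹ * (N * ∑ _j ∈ Finset.range N, 1) := by
        gcongr with j _
        rw [hc, norm_pow, norm_mul, ← Complex.ofReal_neg, Complex.norm_exp_ofReal_mul_I, one_mul]
        exact pow_le_one₀ (by positivity) (pow_le_one₀ (norm_nonneg _) hz)
    _ = 1 := by
        simp only [Finset.sum_const, Finset.card_range, nsmul_eq_mul, mul_one]
        field_simp

/-- There is no cancellation: each of the `N` terms has modulus at least `1 / 2` and an argument of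
size at most `1 / 2`, hence real part at least `1 / 4`. Squaring the mean gives `1 / 16`. -/
theorem le_norm_fejerPeak {N : ℕ} (hN : N ≠ 0) {r x v : ℝ} (hr0 : 0 ≤ r) (hr1 : r ≤ 1)
    (hr : 1 / 2 ≤ r ^ N) (hv : N * |v - x| ≤ 1 / 2) :
    1 / 16 ≤ ‖fejerPeak N x (r * Complex.exp (v * Complex.I))‖ := by
  have hNr : (0 : ℝ) < N := Nat.cast_pos.2 (Nat.pos_of_ne_zero hN)
  have hterm : ∀ j ∈ Finset.range N, (1 / 4 : ℝ) ≤
      ((Complex.exp (-(x : ℂ) * Complex.I) * (r * Complex.exp (v * Complex.I))) ^ j).re := by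
    intro j hj
    have hjN : (j : ℝ) ≤ N := by exact_mod_cast (Finset.mem_range.1 hj).le
    have he : (Complex.exp (-(x : ℂ) * Complex.I) * (r * Complex.exp (v * Complex.I))) ^ j =
        ((r ^ j : ℝ) : ℂ) * Complex.exp ((j * (v - x) : ℝ) * Complex.I) := by
      rw [mul_left_comm, ← Complex.exp_add, mul_pow, ← Complex.exp_nat_mul]
      push_cast
      congr 2
      ring
    rw [he, Complex.re_ofReal_mul, Complex.exp_ofReal_mul_I_re]
    have h1 : 1 / 2 ≤ r ^ j := hr.trans
      (pow_le_pow_of_le_one hr0 hr1 (Finset.mem_range.1 hj).le)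
    have h2 : |j * (v - x)| ≤ 1 / 2 := by
      rw [abs_mul, Nat.abs_cast]
      exact (mul_le_mul_of_nonneg_right hjN (abs_nonneg _)).trans hv
    have h3 := Real.one_sub_sq_div_two_le_cos (x := j * (v - x))
    have h4 : (j * (v - x)) ^ 2 ≤ (1 / 2) ^ 2 := sq_le_sq' (by linarith [(abs_le.1 h2).1])
      (abs_le.1 h2).2
    have h5 : 1 / 2 ≤ Real.cos (j * (v - x)) := by linarith
    nlinarith
  have hsum : (N : ℝ) / 4 ≤ ‖∑ j ∈ Finset.range N,
      (Complex.exp (-(x : ℂ) * Complex.I) * (r * Complex.exp (v * Complex.I))) ^ j‖ := by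
    refine le_trans ?_ (Complex.re_le_norm _)
    rw [Complex.re_sum]
    calc (N : ℝ) / 4 = ∑ _j ∈ Finset.range N, (1 / 4 : ℝ) := by simp; ring
      _ ≤ _ := Finset.sum_le_sum hterm
  unfold fejerPeak
  rw [norm_pow, norm_mul, norm_inv, Complex.norm_natCast]
  have h : 1 / 4 ≤ (N : ℝ)⁻¹ * ‖∑ j ∈ Finset.range N,
      (Complex.exp (-(x : ℂ) * Complex.I) * (r * Complex.exp (v * Complex.I))) ^ j‖ := by
    rw [le_inv_mul_iff₀ hNr]
    linarith
  calc (1 / 16 : ℝ) = (1 / 4) ^ 2 := by norm_num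
    _ ≤ _ := by gcongr

end

/-! ### The angle coordinate -/

/-- The angle in `[0, 2π)` of a point of the circle. -/
def angle (t : Torus) : ℝ := (AddCircle.equivIco (2 * Real.pi) 0 t : ℝ)

theorem angle_nonneg (t : Torus) : 0 ≤ angle t := (AddCircle.equivIco (2 * Real.pi) 0 t).2.1

theorem angle_lt (t : Torus) : angle t < 2 * Real.pi :=
  (AddCircle.equivIco (2 * Real.pi) 0 t).2.2.trans_eq (zero_add _)

theorem coe_angle (t : Torus) : ((angle t : ℝ) : Torus) = t := AddCircle.coe_equivIco

theorem angle_coe {x : ℝ} (h0 : 0 ≤ x) (h1 : x < 2 * Real.pi) : angle (x : Torus) = x :=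
  AddCircle.equivIco_coe_of_mem ⟨h0, by rwa [zero_add]⟩

theorem circlePoint_eq_exp (t : Torus) : circlePoint t = Complex.exp (angle t * Complex.I) := by
  conv_lhs => rw [← coe_angle t]
  rw [circlePoint, AddCircle.toCircle_apply_mk, div_self Real.two_pi_pos.ne', one_mul,
    Circle.coe_exp]

theorem measurable_angle : Measurable angle :=
  measurable_subtype_coe.comp (AddCircle.measurableEquivIco (2 * Real.pi) 0).measurable

theorem continuousAt_angle {t : Torus} (ht : angle t ≠ 0) : ContinuousAt angle t := by
  have h : t ≠ ((0 : ℝ) : Torus) := fun h => ht (by rw [h, angle_coe le_rfl Real.two_pi_pos])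
  exact continuousAt_subtype_val.comp (AddCircle.continuousAt_equivIco _ _ h)

theorem haarT_preimage_angle {S : Set ℝ} (hS : MeasurableSet S) (hsub : S ⊆ Ioo 0 (2 * Real.pi)) :
    haarT (angle ⁻¹' S) = volume S / ENNReal.ofReal (2 * Real.pi) := by
  have h := AddCircle.add_projection_respects_measure (T := 2 * Real.pi) 0
    (measurable_angle hS)
  have hset : (QuotientAddGroup.mk ⁻¹' (angle ⁻¹' S) : Set ℝ) ∩ Ioc 0 (0 + 2 * Real.pi) = S := by
    ext x
    constructor
    -- The fundamental domain `(0, 2π]` differs from `[0, 2π)` at its endpoints: `2π` has angle `0`,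
    -- which `S` excludes.
    · rintro ⟨hx, hx0, hx1⟩
      rw [zero_add] at hx1
      rcases hx1.eq_or_lt with rfl | hlt
      · have h0 : ((2 * Real.pi : ℝ) : Torus) = ((0 : ℝ) : Torus) := by
          rw [AddCircle.coe_period]; rfl
        have h1 : angle ((2 * Real.pi : ℝ) : Torus) ∈ S := hx
        rw [h0, angle_coe le_rfl Real.two_pi_pos] at h1
        exact absurd (hsub h1).1 (lt_irrefl _)
      · have h1 : angle (x : Torus) ∈ S := hx
        rwa [angle_coe hx0.le hlt] at h1
    · intro hx
      have hx' := hsub hx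
      refine ⟨?_, hx'.1, by rw [zero_add]; exact hx'.2.le⟩
      change angle (x : Torus) ∈ S
      rwa [angle_coe hx'.1.le hx'.2]
  rw [hset, AddCircle.volume_eq_smul_haarAddCircle, Measure.smul_apply, smul_eq_mul] at h
  rwa [ENNReal.eq_div_iff (by simpa using Real.pi_pos) ENNReal.ofReal_ne_top]

theorem haarT_preimage_Ioo {x y : ℝ} (hx : 0 ≤ x) (hy : y ≤ 2 * Real.pi) :
    haarT (angle ⁻¹' Ioo x y) = ENNReal.ofReal ((y - x) / (2 * Real.pi)) := by
  rw [haarT_preimage_angle measurableSet_Ioo (Ioo_subset_Ioo hx hy), Real.volume_Ioo,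
    ENNReal.ofReal_div_of_pos Real.two_pi_pos]

theorem ae_angle_notMem {Z : Set ℝ} (hZ : Z.Countable) : ∀ᵐ t ∂haarT, angle t ∉ Z := by
  have h := AddCircle.add_projection_respects_measure (T := 2 * Real.pi) 0
    (measurable_angle hZ.measurableSet)
  have hnull : volume ((QuotientAddGroup.mk ⁻¹' (angle ⁻¹' Z) : Set ℝ) ∩
      Ioc 0 (0 + 2 * Real.pi)) = 0 := by
    refine measure_mono_null (t := Z ∪ {2 * Real.pi}) ?_
      ((hZ.union (countable_singleton _)).measure_zero volume)
    rintro x ⟨hx, hx0, hx1⟩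
    rw [zero_add] at hx1
    rcases hx1.eq_or_lt with rfl | hlt
    · exact Or.inr rfl
    · have h1 : angle (x : Torus) ∈ Z := hx
      rw [angle_coe hx0.le hlt] at h1
      exact Or.inl h1
  rw [hnull, AddCircle.volume_eq_smul_haarAddCircle, Measure.smul_apply, smul_eq_mul,
    mul_eq_zero] at h
  have h0 : haarT (angle ⁻¹' Z) = 0 := h.resolve_left (by simpa using Real.pi_pos)
  exact measure_eq_zero_iff_ae_notMem.1 h0

/-! ### The argument of the boundary values on an arc -/

/-- On the circle the Herglotz kernel is `-i cot ((α - θ) / 2)`. At coinciding points both sides are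
`0` by the convention for division. -/
theorem exp_add_div_exp_sub (α θ : ℝ) :
    (Complex.exp (α * Complex.I) + Complex.exp (θ * Complex.I)) /
      (Complex.exp (α * Complex.I) - Complex.exp (θ * Complex.I)) =
      -((Real.cos ((α - θ) / 2) / Real.sin ((α - θ) / 2) : ℝ) : ℂ) * Complex.I := by
  set x : ℝ := (α - θ) / 2 with hx
  set m : ℝ := (α + θ) / 2 with hm
  have h1 : Complex.exp (α * Complex.I) =
      Complex.exp (m * Complex.I) * (Complex.cos x + Complex.sin x * Complex.I) := by
    rw [← Complex.exp_mul_I, ← Complex.exp_add, hm, hx]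
    congr 1; push_cast; ring
  have h2 : Complex.exp (θ * Complex.I) =
      Complex.exp (m * Complex.I) * (Complex.cos x - Complex.sin x * Complex.I) := by
    have : Complex.cos x - Complex.sin x * Complex.I = Complex.exp (-(x : ℂ) * Complex.I) := by
      rw [Complex.exp_mul_I, Complex.cos_neg, Complex.sin_neg]; ring
    rw [this, ← Complex.exp_add, hm, hx]
    congr 1; push_cast; ring
  have hm0 := Complex.exp_ne_zero (m * Complex.I)
  rw [h1, h2, ← mul_add, ← mul_sub, mul_div_mul_left _ _ hm0]
  push_cast
  by_cases hs : Complex.sin x = 0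
  · simp [hs]
  · have h3 : Complex.cos x + Complex.sin x * Complex.I -
        (Complex.cos x - Complex.sin x * Complex.I) ≠ 0 := by
      ring_nf
      simp [hs]
    rw [div_eq_iff h3]
    field_simp
    ring_nf
    rw [Complex.I_sq]
    ring

/-- The argument at the angle `θ` of the outer function with modulus `exp g`, provided that `g = R`
near `θ`. -/
def conjugateIntegral (g : Torus → ℝ) (R θ : ℝ) : ℝ :=
  ∫ t, Real.cos ((angle t - θ) / 2) / Real.sin ((angle t - θ) / 2) * (R - g t) ∂haarT

theorem herglotzBoundary_eq (g : Torus → ℝ) (t₀ : Torus) :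
    herglotzBoundary g t₀ =
      (g t₀ : ℂ) + (conjugateIntegral g (g t₀) (angle t₀) : ℂ) * Complex.I := by
  unfold herglotzBoundary conjugateIntegral
  congr 1
  rw [← integral_complex_ofReal, ← integral_mul_const]
  congr 1 with t
  rw [circlePoint_eq_exp, circlePoint_eq_exp, exp_add_div_exp_sub]
  push_cast
  ring

section Arc

variable {a c θ : ℝ}

/-- A point `θ` of the middle two thirds stays at distance at least `c / 6` from the complement of
the arc. Jordan's inequality at `c / 12` gives `c / (6π) ≥ c / 20`. -/
theorem le_sin_half_sub (hc : 0 < c) (hca : 2 * c ≤ a) (ha : a ≤ 1 / 2) (h1 : a + c / 6 ≤ θ)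
    (h2 : θ ≤ a + 5 * c / 6) {α : ℝ} (hα : a + c ≤ α) (hα2 : α < 2 * Real.pi) :
    c / 20 ≤ Real.sin ((α - θ) / 2) := by
  have hpi := Real.pi_gt_three
  have hpi2 := Real.pi_lt_d2
  have key : ∀ x : ℝ, c / 12 ≤ x → x ≤ Real.pi / 2 → c / 20 ≤ Real.sin x := fun x hx hx2 => by
    refine le_trans ?_ (Real.mul_le_sin (by linarith) hx2)
    rw [div_mul_eq_mul_div, le_div_iff₀ Real.pi_pos]
    nlinarith
  rcases le_total ((α - θ) / 2) (Real.pi / 2) with h | h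
  · exact key _ (by linarith) h
  -- Around the back of the circle the relevant distance is `2π - α + θ`, which exceeds `a ≥ 2 * c`.
  · rw [← Real.sin_pi_sub]
    exact key _ (by linarith) (by linarith)

theorem sin_half_sub_le (hc : 0 < c) (hca : 2 * c ≤ a) (ha : a ≤ 1 / 2) (h1 : a + c / 6 ≤ θ)
    (h2 : θ ≤ a + 5 * c / 6) {α : ℝ} (hα0 : 0 ≤ α) (hα : α ≤ a) :
    Real.sin ((α - θ) / 2) ≤ -(c / 20) := by
  have hpi := Real.pi_gt_three
  have hpi2 := Real.pi_lt_d2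
  have h : c / 20 ≤ Real.sin ((θ - α) / 2) := by
    refine le_trans ?_ (Real.mul_le_sin (by linarith) (by linarith))
    rw [div_mul_eq_mul_div, le_div_iff₀ Real.pi_pos]
    nlinarith
  have he : (α - θ) / 2 = -((θ - α) / 2) := by ring
  rw [he, Real.sin_neg]
  linarith

variable {g : Torus → ℝ} {R : ℝ}

theorem integrable_conjugateIntegral (hc : 0 < c) (hca : 2 * c ≤ a) (ha : a ≤ 1 / 2)
    (hg : Measurable g) (hgI : ∀ t, angle t ∈ Ioo a (a + c) → g t = R) (hgR : ∀ t, |R - g t| ≤ 1)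
    (h1 : a + c / 6 ≤ θ) (h2 : θ ≤ a + 5 * c / 6) :
    Integrable (fun t => Real.cos ((angle t - θ) / 2) / Real.sin ((angle t - θ) / 2) *
      (R - g t)) haarT := by
  have hm : Measurable fun t : Torus => (angle t - θ) / 2 :=
    (measurable_angle.sub_const θ).div_const 2
  refine Integrable.of_bound (((Real.measurable_cos.comp hm).div
    (Real.measurable_sin.comp hm)).mul (hg.const_sub R)).aestronglyMeasurable (20 / c)
    (Eventually.of_forall fun t => ?_)
  by_cases htI : angle t ∈ Ioo a (a + c)
  · rw [hgI t htI, sub_self, mul_zero, norm_zero]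
    positivity
  · have hs : c / 20 ≤ |Real.sin ((angle t - θ) / 2)| := by
      rcases le_or_gt (angle t) a with h | h
      · exact le_abs.2 (Or.inr (by
          linarith [sin_half_sub_le hc hca ha h1 h2 (angle_nonneg t) h]))
      · exact le_abs.2 (Or.inl (le_sin_half_sub hc hca ha h1 h2
          (not_lt.1 fun h' => htI ⟨h, h'⟩) (angle_lt t)))
    rw [norm_mul, norm_div, Real.norm_eq_abs, Real.norm_eq_abs, Real.norm_eq_abs]
    calc _ ≤ 1 / (c / 20) * 1 := by
          gcongr
          · exact Real.abs_cos_le_one _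
          · exact hgR t
      _ = _ := by field_simp

theorem cot_sub_cot {x y : ℝ} (hx : Real.sin x ≠ 0) (hy : Real.sin y ≠ 0) :
    Real.cos x / Real.sin x - Real.cos y / Real.sin y =
      Real.sin (y - x) / (Real.sin x * Real.sin y) := by
  rw [Real.sin_sub]
  field_simp

/-- The difference kernel is nonnegative and bounded away from the arc. -/
theorem cot_sub_cot_bounds (hc : 0 < c) (hca : 2 * c ≤ a) (ha : a ≤ 1 / 2) {θ₁ θ₂ : ℝ}
    (h1 : a + c / 6 ≤ θ₁) (h12 : θ₁ ≤ θ₂) (h2 : θ₂ ≤ a + 5 * c / 6) {α : ℝ} (h0 : 0 ≤ α)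
    (hα : α < 2 * Real.pi) (hαI : α ∉ Ioo a (a + c)) :
    0 ≤ Real.cos ((α - θ₂) / 2) / Real.sin ((α - θ₂) / 2) -
        Real.cos ((α - θ₁) / 2) / Real.sin ((α - θ₁) / 2) ∧
      Real.cos ((α - θ₂) / 2) / Real.sin ((α - θ₂) / 2) -
        Real.cos ((α - θ₁) / 2) / Real.sin ((α - θ₁) / 2) ≤ 200 * (θ₂ - θ₁) / c ^ 2 := by
  have hpi := Real.pi_gt_three
  have hprod : c / 20 * (c / 20) ≤ Real.sin ((α - θ₂) / 2) * Real.sin ((α - θ₁) / 2) := by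
    rcases le_or_gt α a with h | h
    · have e1 := sin_half_sub_le hc hca ha h1 (h12.trans h2) h0 h
      have e2 := sin_half_sub_le hc hca ha (h1.trans h12) h2 h0 h
      nlinarith
    · have hge : a + c ≤ α := not_lt.1 fun h' => hαI ⟨h, h'⟩
      have e1 := le_sin_half_sub hc hca ha h1 (h12.trans h2) hge hα
      have e2 := le_sin_half_sub hc hca ha (h1.trans h12) h2 hge hα
      exact mul_le_mul e2 e1 (by positivity) (by linarith)
  have hpos : 0 < Real.sin ((α - θ₂) / 2) * Real.sin ((α - θ₁) / 2) :=
    lt_of_lt_of_le (by positivity) hprod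
  have hne := mul_ne_zero_iff.1 hpos.ne'
  rw [cot_sub_cot hne.1 hne.2, show (α - θ₁) / 2 - (α - θ₂) / 2 = (θ₂ - θ₁) / 2 by ring]
  have hs0 : 0 ≤ Real.sin ((θ₂ - θ₁) / 2) :=
    Real.sin_nonneg_of_nonneg_of_le_pi (by linarith) (by linarith)
  refine ⟨div_nonneg hs0 hpos.le, ?_⟩
  calc _ ≤ ((θ₂ - θ₁) / 2) / (c / 20 * (c / 20)) := by
        gcongr
        exact Real.sin_le (by linarith)
    _ = _ := by field_simp; ring

/-- The difference of cotangents is `sin (c / 6)` over a product of two sines. The numerator is at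
least `c / 10`, and both sines are at most `c` because `α` is within `2 * c` of the left end of the
arc. -/
theorem le_cot_sub_cot (hc : 0 < c) (hca : 2 * c ≤ a) (ha : a ≤ 1 / 2) {α : ℝ}
    (hα : α ∈ Ioo (a + c) (a + 2 * c)) :
    1 / (10 * c) ≤
      Real.cos ((α - (a + 2 * c / 3)) / 2) / Real.sin ((α - (a + 2 * c / 3)) / 2) -
        Real.cos ((α - (a + c / 3)) / 2) / Real.sin ((α - (a + c / 3)) / 2) := by
  have hpi := Real.pi_gt_three
  have hpi2 := Real.pi_lt_d2
  obtain ⟨hα1, hα2⟩ := hα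
  have e1 := le_sin_half_sub (θ := a + c / 3) hc hca ha (by linarith) (by linarith) hα1.le
    (by linarith)
  have e2 := le_sin_half_sub (θ := a + 2 * c / 3) hc hca ha (by linarith) (by linarith) hα1.le
    (by linarith)
  have f1 := Real.sin_le (x := (α - (a + c / 3)) / 2) (by linarith)
  have f2 := Real.sin_le (x := (α - (a + 2 * c / 3)) / 2) (by linarith)
  have p1 : 0 < Real.sin ((α - (a + c / 3)) / 2) := lt_of_lt_of_le (by positivity) e1
  have p2 : 0 < Real.sin ((α - (a + 2 * c / 3)) / 2) := lt_of_lt_of_le (by positivity) e2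
  rw [cot_sub_cot p2.ne' p1.ne',
    show (α - (a + c / 3)) / 2 - (α - (a + 2 * c / 3)) / 2 = c / 6 by ring]
  have hs : c / 10 ≤ Real.sin (c / 6) := by
    refine le_trans ?_ (Real.mul_le_sin (by linarith) (by linarith))
    rw [div_mul_eq_mul_div, le_div_iff₀ Real.pi_pos]
    nlinarith
  calc 1 / (10 * c) = (c / 10) / (c * c) := by field_simp
    _ ≤ _ := div_le_div₀ (by linarith) hs (mul_pos p2 p1)
      (mul_le_mul (by linarith) (by linarith) p1.le hc.le)

/-- On the arc the factor `R - g` vanishes; off it the difference of kernels is at most `200 * (θ₂ -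
θ₁) / c ^ 2`. This Lipschitz bound gives both continuity, for the intermediate value theorem, and
the measure of the set where the argument is near a given value. -/
theorem abs_conjugateIntegral_sub_le (hc : 0 < c) (hca : 2 * c ≤ a) (ha : a ≤ 1 / 2)
    (hg : Measurable g) (hgI : ∀ t, angle t ∈ Ioo a (a + c) → g t = R) (hgR : ∀ t, |R - g t| ≤ 1)
    {θ₁ θ₂ : ℝ} (h1 : a + c / 6 ≤ θ₁) (h12 : θ₁ ≤ θ₂) (h2 : θ₂ ≤ a + 5 * c / 6) :
    |conjugateIntegral g R θ₂ - conjugateIntegral g R θ₁| ≤ 200 / c ^ 2 * (θ₂ - θ₁) := by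
  have i1 := integrable_conjugateIntegral hc hca ha hg hgI hgR h1 (h12.trans h2)
  have i2 := integrable_conjugateIntegral hc hca ha hg hgI hgR (h1.trans h12) h2
  unfold conjugateIntegral
  rw [← integral_sub i2 i1]
  have hb : (0 : ℝ) ≤ 200 / c ^ 2 * (θ₂ - θ₁) := mul_nonneg (by positivity) (by linarith)
  have := norm_integral_le_of_norm_le_const (μ := haarT) (C := 200 / c ^ 2 * (θ₂ - θ₁))
    (f := fun t => Real.cos ((angle t - θ₂) / 2) / Real.sin ((angle t - θ₂) / 2) * (R - g t) -
      Real.cos ((angle t - θ₁) / 2) / Real.sin ((angle t - θ₁) / 2) * (R - g t))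
    (Eventually.of_forall fun t => by
      rw [← sub_mul]
      by_cases htI : angle t ∈ Ioo a (a + c)
      · rw [hgI t htI, sub_self, mul_zero, norm_zero]
        exact hb
      · obtain ⟨k0, k1⟩ := cot_sub_cot_bounds hc hca ha h1 h12 h2 (angle_nonneg t) (angle_lt t) htI
        rw [norm_mul, Real.norm_of_nonneg k0, Real.norm_eq_abs]
        calc _ ≤ 200 * (θ₂ - θ₁) / c ^ 2 * 1 := mul_le_mul k1 (hgR t) (abs_nonneg _) (k0.trans k1)
          _ = _ := by ring)
  simpa using this

/-- The argument varies by a definite amount over the middle of the arc, if `g` is much smaller on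
the adjacent arc. -/
theorem le_conjugateIntegral_sub (hc : 0 < c) (hca : 2 * c ≤ a) (ha : a ≤ 1 / 2)
    (hg : Measurable g) (hgI : ∀ t, angle t ∈ Ioo a (a + c) → g t = R) (hgR : ∀ t, |R - g t| ≤ 1)
    {δ : ℝ} (hδ : ∀ t, angle t ∈ Ioo (a + c) (a + 2 * c) → δ ≤ R - g t) (hδ0 : 0 ≤ δ)
    {Q : Set Torus} (hQm : MeasurableSet Q) (hQ : ∀ t, t ∉ Q → 0 ≤ R - g t) :
    δ / (20 * Real.pi) - 67 / c * haarT.real Q ≤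
      conjugateIntegral g R (a + 2 * c / 3) - conjugateIntegral g R (a + c / 3) := by
  have hpi := Real.pi_gt_three
  have h1 : a + c / 6 ≤ a + c / 3 := by linarith
  have h12 : a + c / 3 ≤ a + 2 * c / 3 := by linarith
  have h2 : a + 2 * c / 3 ≤ a + 5 * c / 6 := by linarith
  have i1 := integrable_conjugateIntegral hc hca ha hg hgI hgR h1 (h12.trans h2)
  have i2 := integrable_conjugateIntegral hc hca ha hg hgI hgR (h1.trans h12) h2
  set A : Set Torus := angle ⁻¹' Ioo (a + c) (a + 2 * c) with hA
  have hAm : MeasurableSet A := measurable_angle measurableSet_Ioo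
  have hAr : haarT.real A = c / (2 * Real.pi) := by
    rw [measureReal_def, hA, haarT_preimage_Ioo (by linarith) (by linarith),
      ENNReal.toReal_ofReal (div_nonneg (by linarith) (by positivity))]
    congr 1
    ring
  -- A step function below the integrand: the adjacent arc `A` contributes at least `δ / (10 * c)`,
  -- the exceptional set `Q` costs at most `200 * (c / 3) / c ^ 2 ≤ 67 / c`, and elsewhere the
  -- integrand is nonnegative.
  have hint : ∫ t, (A.indicator (fun _ => δ / (10 * c)) t - Q.indicator (fun _ => 67 / c) t)
      ∂haarT = δ / (20 * Real.pi) - 67 / c * haarT.real Q := by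
    rw [integral_sub ((integrable_const _).indicator hAm) ((integrable_const _).indicator hQm),
      integral_indicator_const _ hAm, integral_indicator_const _ hQm, hAr, smul_eq_mul,
      smul_eq_mul]
    field_simp
    ring
  unfold conjugateIntegral
  rw [← integral_sub i2 i1, ← hint]
  refine integral_mono (((integrable_const _).indicator hAm).sub
    ((integrable_const _).indicator hQm)) (i2.sub i1) fun t => ?_
  simp only [← sub_mul]
  have hQ0 : 0 ≤ Q.indicator (fun _ => 67 / c) t := indicator_nonneg (fun _ _ => by positivity) t
  by_cases htI : angle t ∈ Ioo a (a + c)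
  · have htA : t ∉ A := fun h => by
      have h' : angle t ∈ Ioo (a + c) (a + 2 * c) := h
      linarith [h'.1, htI.2]
    rw [hgI t htI, sub_self, mul_zero, indicator_of_notMem htA]
    linarith
  · obtain ⟨k0, k1⟩ := cot_sub_cot_bounds hc hca ha h1 h12 h2 (angle_nonneg t) (angle_lt t) htI
    by_cases htA : t ∈ A
    · rw [indicator_of_mem htA]
      have k2 := le_cot_sub_cot hc hca ha htA
      have k3 := mul_le_mul k2 (hδ t htA) hδ0 k0
      have : 1 / (10 * c) * δ = δ / (10 * c) := by ring
      linarith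
    · rw [indicator_of_notMem htA]
      by_cases htQ : t ∈ Q
      · rw [indicator_of_mem htQ]
        have k2 : 200 * (a + 2 * c / 3 - (a + c / 3)) / c ^ 2 ≤ 67 / c := by
          rw [div_le_div_iff₀ (by positivity) hc]
          nlinarith [sq_nonneg c, mul_pos hc hc]
        have k3 := (abs_le.1 (hgR t)).1
        nlinarith [k1.trans k2]
      · have := mul_nonneg k0 (hQ t htQ)
        linarith

end Arc

/-! ### A sequence of small arcs -/

/-- The index `n ≥ 1` of the arc `(2⁻ⁿ, 2⁻ⁿ + c n)` that contains `θ`, and `0` if there is none. -/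
def label (c : ℕ → ℝ) (θ : ℝ) : ℕ :=
  sInf {n : ℕ | 1 ≤ n ∧ θ ∈ Ioo ((1 / 2 : ℝ) ^ n) ((1 / 2 : ℝ) ^ n + c n)}

theorem half_pow_le_half {n : ℕ} (hn : 1 ≤ n) : (1 / 2 : ℝ) ^ n ≤ 1 / 2 := by
  simpa using pow_le_pow_of_le_one (by norm_num) (by norm_num : (1 / 2 : ℝ) ≤ 1) hn

theorem two_mul_half_pow_le {m n : ℕ} (h : n < m) : 2 * (1 / 2 : ℝ) ^ m ≤ (1 / 2 : ℝ) ^ n := by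
  have := pow_le_pow_of_le_one (by norm_num) (by norm_num : (1 / 2 : ℝ) ≤ 1) (Nat.succ_le_of_lt h)
  rw [pow_succ] at this
  linarith

section Label

variable {c : ℕ → ℝ} {θ : ℝ} {n : ℕ}

theorem mem_arc_of_label_eq (hn : n ≠ 0) (h : label c θ = n) :
    θ ∈ Ioo ((1 / 2 : ℝ) ^ n) ((1 / 2 : ℝ) ^ n + c n) := by
  have hne : {n : ℕ | 1 ≤ n ∧ θ ∈ Ioo ((1 / 2 : ℝ) ^ n) ((1 / 2 : ℝ) ^ n + c n)}.Nonempty := by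
    by_contra he
    rw [not_nonempty_iff_eq_empty] at he
    rw [label, he, Nat.sInf_empty] at h
    exact hn h.symm
  have := Nat.sInf_mem hne
  rw [← h]
  exact this.2

/-- The arcs are disjoint: for `m > n` the `m`-th arc ends by `3/2 * 2⁻ᵐ`, which is less than `2⁻ⁿ`.
-/
theorem label_eq_of_mem (hc : ∀ n, 2 * c n ≤ (1 / 2 : ℝ) ^ n) (hn : 1 ≤ n)
    (hθ : θ ∈ Ioo ((1 / 2 : ℝ) ^ n) ((1 / 2 : ℝ) ^ n + c n)) : label c θ = n := by
  have hset : {n : ℕ | 1 ≤ n ∧ θ ∈ Ioo ((1 / 2 : ℝ) ^ n) ((1 / 2 : ℝ) ^ n + c n)} = {n} := by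
    ext m
    refine ⟨fun hm => ?_, fun hm => hm ▸ ⟨hn, hθ⟩⟩
    obtain ⟨_, hm1, hm2⟩ := hm
    obtain ⟨h1, h2⟩ := hθ
    have := hc m
    have := hc n
    have : (0 : ℝ) < (1 / 2) ^ m := by positivity
    have : (0 : ℝ) < (1 / 2) ^ n := by positivity
    rcases lt_trichotomy m n with h | h | h
    · have := two_mul_half_pow_le h
      linarith
    · exact h
    · have := two_mul_half_pow_le h
      linarith
  rw [label, hset, csInf_singleton]

/-- Even the arcs of doubled length do not overlap, which is what the factor `2` in the hypothesis
secures. The modulus therefore takes its background value right after each arc. -/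
theorem label_eq_zero_of_mem (hc : ∀ n, 2 * c n ≤ (1 / 2 : ℝ) ^ n)
    (hθ : θ ∈ Ioo ((1 / 2 : ℝ) ^ n + c n) ((1 / 2 : ℝ) ^ n + 2 * c n)) : label c θ = 0 := by
  by_contra hne
  obtain ⟨hm1, hm2⟩ := mem_arc_of_label_eq hne rfl
  set m := label c θ
  obtain ⟨h1, h2⟩ := hθ
  have := hc m
  have := hc n
  have : (0 : ℝ) < (1 / 2) ^ m := by positivity
  have : (0 : ℝ) < (1 / 2) ^ n := by positivity
  rcases lt_trichotomy m n with h | h | h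
  · have := two_mul_half_pow_le h
    linarith
  · rw [h] at hm2
    linarith
  · have := two_mul_half_pow_le h
    linarith

theorem preimage_label_of_ne_zero (hc : ∀ n, 2 * c n ≤ (1 / 2 : ℝ) ^ n) (hn : n ≠ 0) :
    label c ⁻¹' {n} = Ioo ((1 / 2 : ℝ) ^ n) ((1 / 2 : ℝ) ^ n + c n) :=
  Subset.antisymm (fun _ h => mem_arc_of_label_eq hn h)
    fun _ h => label_eq_of_mem hc (Nat.one_le_iff_ne_zero.2 hn) h

theorem measurable_label (hc : ∀ n, 2 * c n ≤ (1 / 2 : ℝ) ^ n) : Measurable (label c) := by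
  have hne : ∀ n, n ≠ 0 → MeasurableSet (label c ⁻¹' {n}) := fun n hn => by
    rw [preimage_label_of_ne_zero hc hn]
    exact measurableSet_Ioo
  refine measurable_to_countable' fun n => ?_
  rcases eq_or_ne n 0 with rfl | hn
  · have : label c ⁻¹' {0} = (⋃ n : ℕ, label c ⁻¹' {n + 1})ᶜ := by
      ext θ
      simp only [mem_preimage, mem_singleton_iff, mem_compl_iff, mem_iUnion, not_exists]
      refine ⟨fun h n => by omega, fun h => ?_⟩
      by_contra h0
      exact h (label c θ - 1) (by omega)
    rw [this]
    exact (MeasurableSet.iUnion fun n => hne (n + 1) (by omega)).compl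
  · exact hne n hn

/-- The arcs accumulate only at `0`, so only finitely many reach above `θ / 2`, and membership in
each of these is locally constant away from its endpoints. -/
theorem eventually_label_eq (hc : ∀ n, 2 * c n ≤ (1 / 2 : ℝ) ^ n) (hθ : 0 < θ)
    (h1 : ∀ n : ℕ, θ ≠ (1 / 2 : ℝ) ^ n) (h2 : ∀ n : ℕ, θ ≠ (1 / 2 : ℝ) ^ n + c n) :
    ∀ᶠ θ' in 𝓝 θ, label c θ' = label c θ := by
  have hiff : ∀ n : ℕ, ∀ᶠ θ' in 𝓝 θ, (θ' ∈ Ioo ((1 / 2 : ℝ) ^ n) ((1 / 2 : ℝ) ^ n + c n) ↔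
      θ ∈ Ioo ((1 / 2 : ℝ) ^ n) ((1 / 2 : ℝ) ^ n + c n)) := by
    intro n
    by_cases hmem : θ ∈ Ioo ((1 / 2 : ℝ) ^ n) ((1 / 2 : ℝ) ^ n + c n)
    · filter_upwards [isOpen_Ioo.mem_nhds hmem] with θ' h'
      exact iff_of_true h' hmem
    · rcases lt_or_gt_of_ne (h1 n) with h | h
      · filter_upwards [Iio_mem_nhds h] with θ' h'
        exact iff_of_false (fun h'' => lt_asymm h' h''.1) hmem
      · have h3 : (1 / 2 : ℝ) ^ n + c n < θ :=
          lt_of_le_of_ne (not_lt.1 fun h3 => hmem ⟨h, h3⟩) (h2 n).symm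
        filter_upwards [Ioi_mem_nhds h3] with θ' h'
        exact iff_of_false (fun h'' => lt_asymm h' h''.2) hmem
  obtain ⟨N, hN⟩ := exists_pow_lt_of_lt_one (half_pos (half_pos hθ))
    (by norm_num : (1 / 2 : ℝ) < 1)
  have hsmall : ∀ n, N ≤ n → (1 / 2 : ℝ) ^ n + c n < θ / 2 := fun n hn => by
    have h3 := pow_le_pow_of_le_one (by norm_num) (by norm_num : (1 / 2 : ℝ) ≤ 1) hn
    have h4 := hc n
    have h5 : (0 : ℝ) < (1 / 2) ^ n := by positivity
    linarith
  have hfin : ∀ᶠ θ' in 𝓝 θ, ∀ n ∈ Finset.range N,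
      (θ' ∈ Ioo ((1 / 2 : ℝ) ^ n) ((1 / 2 : ℝ) ^ n + c n) ↔
      θ ∈ Ioo ((1 / 2 : ℝ) ^ n) ((1 / 2 : ℝ) ^ n + c n)) :=
    (Filter.eventually_all_finset _).2 fun n _ => hiff n
  filter_upwards [hfin, Ioi_mem_nhds (half_lt_self hθ)] with θ' h3 h4
  have h4' : θ / 2 < θ' := h4
  unfold label
  congr 1
  ext n
  refine and_congr_right fun _ => ?_
  rcases lt_or_ge n N with hn | hn
  · exact h3 n (Finset.mem_range.2 hn)
  · have := hsmall n hn
    exact iff_of_false (fun h => by linarith [h.2]) (fun h => by linarith [h.2])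

end Label

/-! ### Rapidly growing levels -/

theorem mul_self_le_two_pow {n : ℕ} (hn : 4 ≤ n) : n * n ≤ 2 ^ n := by
  induction n, hn using Nat.le_induction with
  | base => norm_num
  | succ k hk ih => rw [pow_succ]; nlinarith

section Growth

variable {P : ℕ → ℝ}

theorem le_of_sq_le_succ (h0 : 2000 ≤ P 0) (hP : ∀ n, P n ^ 2 ≤ P (n + 1)) (n : ℕ)
    : 2000 ≤ P n := by
  induction n with
  | zero => exact h0
  | succ n ih => nlinarith [hP n]

theorem two_pow_mul_le_of_sq_le_succ (h0 : 2000 ≤ P 0) (hP : ∀ n, P n ^ 2 ≤ P (n + 1)) (n k : ℕ)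
    : 2 ^ k * P n ≤ P (n + k) := by
  induction k with
  | zero => simp
  | succ k ih =>
    have h1 := le_of_sq_le_succ h0 hP (n + k)
    have h2 := hP (n + k)
    rw [← add_assoc, pow_succ]
    nlinarith

theorem monotone_of_sq_le_succ (h0 : 2000 ≤ P 0) (hP : ∀ n, P n ^ 2 ≤ P (n + 1))
    : Monotone P := monotone_nat_of_le_succ fun n => by
  nlinarith [hP n, le_of_sq_le_succ h0 hP n]

theorem two_pow_two_pow_le (h0 : 2000 ≤ P 0) (hP : ∀ n, P n ^ 2 ≤ P (n + 1)) (n : ℕ) : (2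
    : ℝ) ^ (2 ^ n) ≤ P n := by
  induction n with
  | zero => norm_num; linarith
  | succ n ih =>
    rw [pow_succ 2 n, pow_mul]
    exact (pow_le_pow_left₀ (by positivity) ih 2).trans (hP n)

/-- Iterated squaring beats every geometric sequence: once `2 ^ n ≥ 2 * B`, one has `(2 * B) ^ n ≤ 2
^ (n * n) ≤ 2 ^ 2 ^ n ≤ P n`. -/
theorem tendsto_div_pow_atTop (h0 : 2000 ≤ P 0) (hP : ∀ n, P n ^ 2 ≤ P (n + 1)) (B : ℝ) (hB
    : 1 ≤ B) :
    Tendsto (fun n => P n / B ^ n) atTop atTop := by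
  have h2 : Tendsto (fun n : ℕ => (2 : ℝ) ^ n) atTop atTop :=
    tendsto_pow_atTop_atTop_of_one_lt one_lt_two
  refine tendsto_atTop_mono' atTop ?_ h2
  filter_upwards [h2.eventually_ge_atTop (2 * B), eventually_ge_atTop 4] with n hn hn4
  have hB0 : 0 < B := one_pos.trans_le hB
  rw [le_div_iff₀ (by positivity), ← mul_pow]
  calc (2 * B) ^ n ≤ ((2 : ℝ) ^ n) ^ n := pow_le_pow_left₀ (by positivity) hn n
    _ = (2 : ℝ) ^ (n * n) := (pow_mul _ _ _).symm
    _ ≤ (2 : ℝ) ^ (2 ^ n) := pow_le_pow_right₀ one_le_two (mul_self_le_two_pow hn4)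
    _ ≤ P n := two_pow_two_pow_le h0 hP n

end Growth

section

variable {Ψ : OrliczFunction}

/-! ### The symbol -/

/-- A geometric sequence along which `Ψ` grows at least like an iterated square. -/
structure IsLevelSequence (Ψ : OrliczFunction) (α : ℝ) (s : ℕ → ℝ) : Prop where
  one_lt : 1 < α
  pos_zero : 0 < s 0
  succ : ∀ n, s (n + 1) = α * s n
  base : 2000 ≤ Ψ (s 0)
  sq_le : ∀ n, Ψ (s n) ^ 2 ≤ Ψ (s (n + 1))

theorem OrliczFunction.DeltaSupTwo.exists_isLevelSequence (hΨ : Ψ.DeltaSupTwo) :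
    ∃ (α : ℝ) (s : ℕ → ℝ), IsLevelSequence Ψ α s := by
  obtain ⟨α, hα, h⟩ := hΨ
  obtain ⟨x, hx⟩ := eventually_atTop.1
    (h.and ((Ψ.tendsto_atTop.eventually_ge_atTop 2000).and (eventually_gt_atTop 0)))
  have hx0 : 0 < x := (hx x le_rfl).2.2
  refine ⟨α, fun n => x * α ^ n, hα, by simpa using hx0, fun n => by rw [pow_succ]; ring,
    by simpa using (hx x le_rfl).2.1, fun n => ?_⟩
  have := (hx (x * α ^ n) (le_mul_of_one_le_right hx0.le (one_le_pow₀ hα.le))).1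
  rwa [show x * α ^ (n + 1) = α * (x * α ^ n) by rw [pow_succ]; ring]

/-- The lengths of the arcs. -/
def arcLength (Ψ : OrliczFunction) (s : ℕ → ℝ) (n : ℕ) : ℝ := 1 / Ψ (s (2 * n))

/-- The values of the modulus. -/
def modulusValue (Ψ : OrliczFunction) (s : ℕ → ℝ) (n : ℕ) : ℝ := 1 - 2 / Ψ (s n)

/-- The index of the arc that contains a point of the circle. -/
def arcIndex (Ψ : OrliczFunction) (s : ℕ → ℝ) (t : Torus) : ℕ := label (arcLength Ψ s) (angle t)

/-- The logarithm of the modulus. -/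
def logModulus (Ψ : OrliczFunction) (s : ℕ → ℝ) (t : Torus) : ℝ :=
  Real.log (modulusValue Ψ s (arcIndex Ψ s t))

/-- The boundary values of the symbol. -/
def symbolBoundary (Ψ : OrliczFunction) (s : ℕ → ℝ) (t : Torus) : ℂ :=
  Complex.exp (herglotzBoundary (logModulus Ψ s) t)

namespace IsLevelSequence

variable {α : ℝ} {s : ℕ → ℝ}

theorem pos (H : IsLevelSequence Ψ α s) (n : ℕ) : 0 < s n := by
  induction n with
  | zero => exact H.pos_zero
  | succ n ih => rw [H.succ]; exact mul_pos (one_pos.trans H.one_lt) ih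

theorem eq_mul_pow (H : IsLevelSequence Ψ α s) (n k : ℕ) : s (n + k) = α ^ k * s n := by
  induction k with
  | zero => simp
  | succ k ih => rw [← add_assoc, H.succ, ih, pow_succ]; ring

theorem le_apply (H : IsLevelSequence Ψ α s) (n : ℕ)
    : 2000 ≤ Ψ (s n) := le_of_sq_le_succ H.base H.sq_le n

theorem two_pow_mul_le (H : IsLevelSequence Ψ α s) (n k : ℕ) : 2 ^ k * Ψ (s n) ≤ Ψ (s (n + k)) :=
  two_pow_mul_le_of_sq_le_succ H.base H.sq_le n k

theorem monotone_apply (H : IsLevelSequence Ψ α s)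
    : Monotone fun n => Ψ (s n) := monotone_of_sq_le_succ H.base H.sq_le

theorem arcLength_pos (H : IsLevelSequence Ψ α s) (n : ℕ) : 0 < arcLength Ψ s n :=
  one_div_pos.2 (by linarith [H.le_apply (2 * n)])

theorem two_mul_arcLength_le (H : IsLevelSequence Ψ α s) (n : ℕ) : 2 * arcLength Ψ s n ≤ (1 / 2
    : ℝ) ^ n := by
  unfold arcLength
  have h1 := H.two_pow_mul_le n n
  have h2 := H.le_apply n
  have h3 : (1 : ℝ) ≤ 2 ^ n := one_le_pow₀ one_le_two
  rw [two_mul n, mul_one_div, one_div_pow, div_le_div_iff₀ (by linarith [H.le_apply (n + n)])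
    (by positivity)]
  nlinarith

theorem modulusValue_bounds (H : IsLevelSequence Ψ α s) (n : ℕ) :
    999 / 1000 ≤ modulusValue Ψ s n ∧ modulusValue Ψ s n < 1 := by
  unfold modulusValue
  have h1 := H.le_apply n
  have h2 : 2 / Ψ (s n) ≤ 1 / 1000 := by
    rw [div_le_div_iff₀ (by linarith) (by norm_num)]; linarith
  have h3 : 0 < 2 / Ψ (s n) := div_pos two_pos (by linarith)
  constructor <;> linarith

theorem modulusValue_pos (H : IsLevelSequence Ψ α s) (n : ℕ) : 0 < modulusValue Ψ s n := by
  linarith [(H.modulusValue_bounds n).1]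

theorem log_modulusValue_neg (H : IsLevelSequence Ψ α s) (n : ℕ)
    : Real.log (modulusValue Ψ s n) < 0 :=
  Real.log_neg (H.modulusValue_pos n) (H.modulusValue_bounds n).2

theorem neg_one_le_log_modulusValue (H : IsLevelSequence Ψ α s) (n : ℕ)
    : -1 ≤ Real.log (modulusValue Ψ s n) := by
  have h := Real.one_sub_inv_le_log_of_pos (H.modulusValue_pos n)
  have h2 : (modulusValue Ψ s n)⁻¹ ≤ 2 := by
    rw [inv_le_comm₀ (H.modulusValue_pos n) two_pos]
    linarith [(H.modulusValue_bounds n).1]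
  linarith

theorem log_modulusValue_mono (H : IsLevelSequence Ψ α s) {m n : ℕ} (h : m ≤ n) :
    Real.log (modulusValue Ψ s m) ≤ Real.log (modulusValue Ψ s n) := by
  refine Real.log_le_log (H.modulusValue_pos m) ?_
  unfold modulusValue
  have := H.le_apply m
  have h1 : Ψ (s m) ≤ Ψ (s n) := H.monotone_apply h
  gcongr

theorem log_modulusValue_zero_lt_one (H : IsLevelSequence Ψ α s) :
    Real.log (modulusValue Ψ s 0) < Real.log (modulusValue Ψ s 1) := by
  refine Real.log_lt_log (H.modulusValue_pos 0) ?_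
  unfold modulusValue
  have := H.le_apply 0
  have h1 : Ψ (s 0) < Ψ (s 1) := by nlinarith [H.sq_le 0]
  have h2 : 2 / Ψ (s 1) < 2 / Ψ (s 0) := div_lt_div_of_pos_left two_pos (by linarith) h1
  linarith

/-! ### The modulus as a function on the circle -/

theorem measurable_arcIndex (H : IsLevelSequence Ψ α s) : Measurable (arcIndex Ψ s) :=
  (measurable_label H.two_mul_arcLength_le).comp measurable_angle

theorem measurable_logModulus (H : IsLevelSequence Ψ α s) : Measurable (logModulus Ψ s) :=
  (measurable_from_nat (f := fun n => Real.log (modulusValue Ψ s n))).comp H.measurable_arcIndex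

theorem abs_logModulus_le (H : IsLevelSequence Ψ α s) (t : Torus) : |logModulus Ψ s t| ≤ 1 :=
  abs_le.2 ⟨H.neg_one_le_log_modulusValue _, by
    linarith [H.log_modulusValue_neg (arcIndex Ψ s t), show logModulus Ψ s t =
      Real.log (modulusValue Ψ s (arcIndex Ψ s t)) from rfl]⟩

theorem integrable_logModulus (H : IsLevelSequence Ψ α s) : Integrable (logModulus Ψ s) haarT :=
  integrable_of_bounded H.measurable_logModulus H.abs_logModulus_le

/-- The only exceptions are the cut at angle `0`, where the arcs also accumulate, and the endpoints
of the arcs, a countable set. -/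
theorem ae_eventually_logModulus_eq (H : IsLevelSequence Ψ α s) :
    ∀ᵐ t₀ ∂haarT, ∀ᶠ t in 𝓝 t₀, logModulus Ψ s t = logModulus Ψ s t₀ := by
  have hZ : (({0} ∪ range fun n : ℕ => (1 / 2 : ℝ) ^ n) ∪
      range fun n : ℕ => (1 / 2 : ℝ) ^ n + arcLength Ψ s n).Countable :=
    ((countable_singleton _).union (countable_range _)).union (countable_range _)
  filter_upwards [ae_angle_notMem hZ] with t₀ ht₀
  simp only [mem_union, mem_singleton_iff, mem_range, not_or, not_exists] at ht₀
  obtain ⟨⟨h0, h1⟩, h2⟩ := ht₀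
  have h := (continuousAt_angle h0).eventually (eventually_label_eq H.two_mul_arcLength_le
    (lt_of_le_of_ne (angle_nonneg t₀) (Ne.symm h0)) (fun n => (Ne.symm (h1 n)))
    fun n => Ne.symm (h2 n))
  filter_upwards [h] with t ht
  unfold logModulus arcIndex
  rw [ht]

theorem norm_symbolBoundary (H : IsLevelSequence Ψ α s) (t : Torus) :
    ‖symbolBoundary Ψ s t‖ = modulusValue Ψ s (arcIndex Ψ s t) := by
  rw [symbolBoundary, Complex.norm_exp, re_herglotzBoundary, logModulus,
    Real.exp_log (H.modulusValue_pos _)]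

/-! ### The control function lies in the Morse–Transue space -/

theorem haarT_arcIndex_le (H : IsLevelSequence Ψ α s) {n : ℕ} (hn : n ≠ 0) :
    haarT (arcIndex Ψ s ⁻¹' {n}) ≤ ENNReal.ofReal (arcLength Ψ s n) := by
  have hpi := Real.pi_gt_three
  have h1 := H.two_mul_arcLength_le n
  have h2 := half_pow_le_half (Nat.one_le_iff_ne_zero.2 hn)
  have h3 := H.arcLength_pos n
  change haarT (angle ⁻¹' (label (arcLength Ψ s) ⁻¹' {n})) ≤ _
  rw [preimage_label_of_ne_zero H.two_mul_arcLength_le hn,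
    haarT_preimage_Ioo (by positivity) (by linarith)]
  refine ENNReal.ofReal_le_ofReal ?_
  rw [add_sub_cancel_left]
  exact div_le_self h3.le (by linarith)

/-- With `α ^ j > 1 / C`, division by `C` costs at most `j` levels. For `n > j` the value `Ψ (s n /
C)` is at most `Ψ (s (2 * n - 1))`, while the arc has length `1 / Ψ (s (2 * n)) ≤ 1 / Ψ (s (2 * n -
1)) ^ 2`. The product is at most `1 / Ψ (s (2 * n - 1)) ≤ 2⁻ⁿ`. -/
theorem modular_lt_top (H : IsLevelSequence Ψ α s) {C : ℝ} (hC : 0 < C) :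
    modular Ψ haarT (fun t => ((s (arcIndex Ψ s t) : ℝ) : ℂ)) C < ⊤ := by
  have hnorm : ∀ n, ‖((s n : ℝ) : ℂ)‖ / C = s n / C := fun n => by
    rw [Complex.norm_real, Real.norm_of_nonneg (H.pos n).le]
  have hmap : modular Ψ haarT (fun t => ((s (arcIndex Ψ s t) : ℝ) : ℂ)) C =
      ∑' n, ENNReal.ofReal (Ψ (s n / C)) * haarT (arcIndex Ψ s ⁻¹' {n}) := by
    unfold modular
    simp only [hnorm]
    rw [← lintegral_map (f := fun n => ENNReal.ofReal (Ψ (s n / C))) (measurable_from_nat)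
      H.measurable_arcIndex, lintegral_countable']
    exact tsum_congr fun n => by
      rw [Measure.map_apply H.measurable_arcIndex (measurableSet_singleton n)]
  rw [hmap]
  obtain ⟨j, hj⟩ := pow_unbounded_of_one_lt (1 / C) H.one_lt
  have hterm : ∀ n, j + 1 ≤ n → Ψ (s n / C) * arcLength Ψ s n ≤ (1 / 2 : ℝ) ^ n := by
    intro n hn
    have h1 : Ψ (s n / C) ≤ Ψ (s (2 * n - 1)) := by
      refine (Ψ.mono (div_nonneg (H.pos n).le hC.le) (y := s (n + j)) ?_).trans
        (H.monotone_apply (by omega))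
      rw [H.eq_mul_pow, div_eq_mul_one_div, mul_comm]
      exact mul_le_mul_of_nonneg_right hj.le (H.pos n).le
    have h2 : Ψ (s (2 * n - 1)) ^ 2 ≤ Ψ (s (2 * n)) := by
      have := H.sq_le (2 * n - 1)
      rwa [show 2 * n - 1 + 1 = 2 * n by omega] at this
    have h3 : (2 : ℝ) ^ n ≤ Ψ (s (2 * n - 1)) := by
      have h4 := H.two_pow_mul_le (n - 1) n
      rw [show n - 1 + n = 2 * n - 1 by omega] at h4
      have h5 := H.le_apply (n - 1)
      have h6 : (1 : ℝ) ≤ 2 ^ n := one_le_pow₀ one_le_two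
      nlinarith
    have h7 := H.le_apply (2 * n - 1)
    have h8 := H.le_apply (2 * n)
    unfold arcLength
    rw [mul_one_div, one_div_pow, div_le_div_iff₀ (by linarith) (by positivity), one_mul]
    calc _ ≤ Ψ (s (2 * n - 1)) * Ψ (s (2 * n - 1)) :=
          mul_le_mul h1 h3 (by positivity) (by linarith)
      _ ≤ _ := by rw [← sq]; exact h2
  -- The finitely many levels up to `j`, including the background level `0`, are estimated by total
  -- mass one.
  have hsum : Summable fun n => if n ≤ j then Ψ (s n / C) else (1 / 2 : ℝ) ^ n := by
    refine (summable_congr_cofinite ?_).2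
      (summable_geometric_of_lt_one (by norm_num) (by norm_num : (1 / 2 : ℝ) < 1))
    rw [Nat.cofinite_eq_atTop]
    filter_upwards [eventually_gt_atTop j] with n hn
    rw [if_neg (by omega)]
  refine lt_of_le_of_lt (ENNReal.tsum_le_tsum fun n => ?_) hsum.tsum_ofReal_lt_top
  split_ifs with hn
  · exact mul_le_of_le_one_right zero_le prob_le_one
  · calc _ ≤ ENNReal.ofReal (Ψ (s n / C)) * ENNReal.ofReal (arcLength Ψ s n) := by
          gcongr
          exact H.haarT_arcIndex_le (by omega)
      _ = ENNReal.ofReal (Ψ (s n / C) * arcLength Ψ s n) :=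
          (ENNReal.ofReal_mul (Ψ.nonneg (div_nonneg (H.pos n).le hC.le))).symm
      _ ≤ _ := ENNReal.ofReal_le_ofReal (hterm n (by omega))

theorem controlledSymbol (H : IsLevelSequence Ψ α s) : ControlledSymbol Ψ (fun z => Complex.exp
    (herglotz (logModulus Ψ s) z))
    (symbolBoundary Ψ s) fun t => s (arcIndex Ψ s t) where
  differentiableOn := (differentiableOn_herglotz H.integrable_logModulus).cexp
  mapsTo := fun z hz => by
    rw [mem_ball_zero_iff, Complex.norm_exp, Real.exp_lt_one_iff]
    exact re_herglotz_neg H.integrable_logModulus (fun t => H.log_modulusValue_neg _) hz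
  tendsto := by
    filter_upwards [H.ae_eventually_logModulus_eq] with t ht
    exact (Complex.continuous_exp.tendsto _).comp
      (tendsto_herglotz_radial H.measurable_logModulus H.abs_logModulus_le ht)
  measurable := measurable_from_nat.comp H.measurable_arcIndex
  pos := fun t => H.pos _
  norm_le := Eventually.of_forall fun t => (H.norm_symbolBoundary t).le
  modular_lt_top := fun _ hC => H.modular_lt_top hC

theorem isPiecewiseConstant (H : IsLevelSequence Ψ α s) :
    IsPiecewiseConstant fun t => modulusValue Ψ s (arcIndex Ψ s t) := by
  refine ⟨modulusValue Ψ s, fun n => arcIndex Ψ s ⁻¹' {n},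
    fun n => ⟨H.modulusValue_pos n, (H.modulusValue_bounds n).2⟩,
    fun n => H.measurable_arcIndex (measurableSet_singleton n), fun m n hmn => ?_, ?_,
    fun n t ht => ?_⟩
  · exact Disjoint.preimage _ (disjoint_singleton.2 hmn)
  · exact eq_univ_of_forall fun t => mem_iUnion.2 ⟨_, rfl⟩
  · exact congrArg (modulusValue Ψ s) ht

/-! ### The symbol winds around the disk -/

/-- Already the next arc is shorter than the `n`-th by a factor `Ψ (s (2 * n))`, by squaring, and
from then on the bounds at least halve; the geometric series gives the factor `2`. These are the
only places where the modulus can exceed its value on the `n`-th arc. -/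
theorem haarT_real_later_arcs_le (H : IsLevelSequence Ψ α s) (n : ℕ) :
    haarT.real {t | n < arcIndex Ψ s t} ≤ 2 * arcLength Ψ s n / Ψ (s (2 * n)) := by
  have hset : {t | n < arcIndex Ψ s t} = ⋃ k : ℕ, arcIndex Ψ s ⁻¹' {n + 1 + k} := by
    ext t
    simp only [mem_ofPred_eq, mem_iUnion, mem_preimage, mem_singleton_iff]
    exact ⟨fun h => ⟨arcIndex Ψ s t - (n + 1), by omega⟩, fun ⟨k, hk⟩ => by omega⟩
  have h2n := H.le_apply (2 * n)
  have hlen : ∀ k, arcLength Ψ s (n + 1 + k) ≤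
      arcLength Ψ s n / Ψ (s (2 * n)) * (1 / 2 : ℝ) ^ k := fun k => by
    have h1 := H.two_pow_mul_le (2 * n + 1) (2 * k + 1)
    have h2 := H.sq_le (2 * n)
    have h3 : (2 : ℝ) ^ k ≤ 2 ^ (2 * k + 1) := pow_le_pow_right₀ one_le_two (by omega)
    have h4 := H.le_apply (2 * n + 1)
    unfold arcLength
    rw [div_div, ← sq, one_div_pow, div_mul_div_comm, one_mul,
      show 2 * (n + 1 + k) = 2 * n + 1 + (2 * k + 1) by ring]
    refine one_div_le_one_div_of_le (by positivity) (le_trans ?_ h1)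
    rw [mul_comm]
    exact mul_le_mul h3 h2 (by positivity) (by positivity)
  have hgeo : Summable fun k : ℕ => arcLength Ψ s n / Ψ (s (2 * n)) * (1 / 2 : ℝ) ^ k :=
    (summable_geometric_of_lt_one (by norm_num) (by norm_num)).mul_left _
  have hnn : 0 ≤ arcLength Ψ s n / Ψ (s (2 * n)) :=
    div_nonneg (H.arcLength_pos n).le (by linarith)
  rw [measureReal_def]
  refine ENNReal.toReal_le_of_le_ofReal (by rw [mul_div_assoc]; positivity) ?_
  rw [hset]
  calc _ ≤ ∑' k : ℕ, haarT (arcIndex Ψ s ⁻¹' {n + 1 + k}) := measure_iUnion_le _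
    _ ≤ ∑' k : ℕ, ENNReal.ofReal (arcLength Ψ s n / Ψ (s (2 * n)) * (1 / 2 : ℝ) ^ k) :=
        ENNReal.tsum_le_tsum fun k => (H.haarT_arcIndex_le (by omega)).trans
          (ENNReal.ofReal_le_ofReal (hlen k))
    _ = ENNReal.ofReal (∑' k : ℕ, arcLength Ψ s n / Ψ (s (2 * n)) * (1 / 2 : ℝ) ^ k) :=
        (ENNReal.ofReal_tsum_of_nonneg (fun k => by positivity) hgeo).symm
    _ = _ := by
        rw [tsum_mul_left, tsum_geometric_two]
        congr 1
        ring

/-- Every argument between `v` and `v + δ` is attained in the middle third of the arc, by the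
intermediate value theorem, and the Lipschitz bound keeps the argument close to it on an interval
around that point. There the boundary values lie on the circle of radius `1 - 2 / Ψ (s n)`, which
order `N` peaks cannot distinguish from the unit circle as long as `4 * N ≤ Ψ (s n)`. -/
theorem exists_large_peaks (H : IsLevelSequence Ψ α s) {n N : ℕ} (hn : n ≠ 0) (hN : N ≠ 0) (hNn
    : 4 * N ≤ Ψ (s n)) {δ : ℝ}
    (hδ : δ ≤ conjugateIntegral (logModulus Ψ s) (Real.log (modulusValue Ψ s n))
        ((1 / 2 : ℝ) ^ n + 2 * arcLength Ψ s n / 3) -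
      conjugateIntegral (logModulus Ψ s) (Real.log (modulusValue Ψ s n))
        ((1 / 2 : ℝ) ^ n + arcLength Ψ s n / 3)) :
    ∃ v : ℝ, ∀ x : ℝ, 0 ≤ x → x ≤ δ → ENNReal.ofReal (1 / Ψ (s (2 * n + 2))) <
      haarT {t | 1 / 16 ≤ ‖fejerPeak N (v + x) (symbolBoundary Ψ s t)‖} := by
  set a : ℝ := (1 / 2 : ℝ) ^ n with ha_def
  set c : ℝ := arcLength Ψ s n with hc_def
  set R : ℝ := Real.log (modulusValue Ψ s n) with hR_def
  set V : ℝ → ℝ := conjugateIntegral (logModulus Ψ s) R with hV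
  have hpi := Real.pi_gt_three
  have hpi4 := Real.pi_lt_d2
  have hc : 0 < c := H.arcLength_pos n
  have hca : 2 * c ≤ a := H.two_mul_arcLength_le n
  have ha : a ≤ 1 / 2 := half_pow_le_half (Nat.one_le_iff_ne_zero.2 hn)
  have hNr : (1 : ℝ) ≤ N := by exact_mod_cast Nat.one_le_iff_ne_zero.2 hN
  have hidx : ∀ t, angle t ∈ Ioo a (a + c) → arcIndex Ψ s t = n := fun t ht =>
    label_eq_of_mem H.two_mul_arcLength_le (Nat.one_le_iff_ne_zero.2 hn) ht
  have hgI : ∀ t, angle t ∈ Ioo a (a + c) → logModulus Ψ s t = R := fun t ht => by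
    rw [logModulus, hidx t ht]
  have hgR : ∀ t, |R - logModulus Ψ s t| ≤ 1 := fun t => by
    have h1 := H.log_modulusValue_neg n
    have h2 := H.neg_one_le_log_modulusValue n
    have h3 : logModulus Ψ s t < 0 := H.log_modulusValue_neg _
    have h4 : -1 ≤ logModulus Ψ s t := H.neg_one_le_log_modulusValue _
    rw [abs_le]
    constructor <;> linarith
  have hLip : ∀ θ₁ θ₂, a + c / 6 ≤ θ₁ → θ₁ ≤ θ₂ → θ₂ ≤ a + 5 * c / 6 →
      |V θ₂ - V θ₁| ≤ 200 / c ^ 2 * (θ₂ - θ₁) := fun θ₁ θ₂ h1 h12 h2 =>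
    abs_conjugateIntegral_sub_le hc hca ha H.measurable_logModulus hgI hgR h1 h12 h2
  have hLip' : ∀ θ₁ θ₂, θ₁ ∈ Icc (a + c / 6) (a + 5 * c / 6) →
      θ₂ ∈ Icc (a + c / 6) (a + 5 * c / 6) → |V θ₁ - V θ₂| ≤ 200 / c ^ 2 * |θ₁ - θ₂| := by
    intro θ₁ θ₂ h1 h2
    rcases le_total θ₁ θ₂ with h | h
    · rw [abs_sub_comm, abs_sub_comm θ₁, abs_of_nonneg (sub_nonneg.2 h)]
      exact hLip θ₁ θ₂ h1.1 h h2.2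
    · rw [abs_of_nonneg (sub_nonneg.2 h)]
      exact hLip θ₂ θ₁ h2.1 h h1.2
  have hcont : ContinuousOn V (Icc (a + c / 3) (a + 2 * c / 3)) := by
    have hlw : LipschitzOnWith (Real.toNNReal (200 / c ^ 2)) V
        (Icc (a + c / 6) (a + 5 * c / 6)) := LipschitzOnWith.of_dist_le_mul fun x hx y hy => by
      rw [Real.dist_eq, Real.dist_eq, Real.coe_toNNReal _ (by positivity)]
      exact hLip' x y hx hy
    exact hlw.continuousOn.mono (Icc_subset_Icc (by linarith) (by linarith))
  refine ⟨V (a + c / 3), fun x hx0 hxδ => ?_⟩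
  obtain ⟨θ, hθ, hVθ⟩ : V (a + c / 3) + x ∈ V '' Icc (a + c / 3) (a + 2 * c / 3) :=
    intermediate_value_Icc (by linarith) hcont ⟨by linarith, by linarith⟩
  -- Chosen so that `N * (200 / c ^ 2) * w = 1 / 2`, the tolerance of `le_norm_fejerPeak`.
  set w : ℝ := c ^ 2 / (400 * N) with hw_def
  have hw0 : 0 < w := by positivity
  have hw : w ≤ c / 6 := by
    rw [hw_def, div_le_div_iff₀ (by positivity) (by norm_num)]
    nlinarith
  have hsub : angle ⁻¹' Ioo (θ - w) (θ + w) ⊆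
      {t | 1 / 16 ≤ ‖fejerPeak N (V (a + c / 3) + x) (symbolBoundary Ψ s t)‖} := by
    intro t ht
    have ht' : angle t ∈ Ioo (θ - w) (θ + w) := ht
    have htI : angle t ∈ Ioo a (a + c) :=
      ⟨by linarith [ht'.1, hθ.1], by linarith [ht'.2, hθ.2]⟩
    have hb : symbolBoundary Ψ s t =
        ((modulusValue Ψ s n : ℝ) : ℂ) * Complex.exp ((V (angle t) : ℝ) * Complex.I) := by
      rw [symbolBoundary, herglotzBoundary_eq, hgI t htI, Complex.exp_add, hR_def,
        ← Complex.ofReal_exp, Real.exp_log (H.modulusValue_pos n)]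
    rw [mem_ofPred_eq, hb, ← hVθ]
    refine le_norm_fejerPeak hN (H.modulusValue_pos n).le (H.modulusValue_bounds n).2.le ?_ ?_
    · have hΨn := H.le_apply n
      -- Bernoulli's inequality: the `N`-th power of the modulus is at least `1 - 2 * N / Ψ (s n) ≥
      -- 1 / 2`.
      have h1 := one_add_mul_le_pow (a := -(2 / Ψ (s n))) (by
        have : 2 / Ψ (s n) ≤ 1 := (div_le_one (by linarith)).2 (by linarith)
        linarith) N
      have h2 : (N : ℝ) * (2 / Ψ (s n)) ≤ 1 / 2 := by
        rw [mul_div_assoc', div_le_div_iff₀ (by linarith) two_pos]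
        linarith
      rw [← sub_eq_add_neg] at h1
      change 1 / 2 ≤ (1 - 2 / Ψ (s n)) ^ N
      linarith
    · have h1 := hLip' (angle t) θ ⟨by linarith [ht'.1, hθ.1], by linarith [ht'.2, hθ.2]⟩
        ⟨by linarith [hθ.1], by linarith [hθ.2]⟩
      have h2 : |angle t - θ| ≤ w := abs_le.2 ⟨by linarith [ht'.1], by linarith [ht'.2]⟩
      calc (N : ℝ) * |V (angle t) - V θ| ≤ N * (200 / c ^ 2 * w) := by
            gcongr
            exact h1.trans (by gcongr)
        _ = 1 / 2 := by rw [hw_def]; field_simp; norm_num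
  refine lt_of_lt_of_le ?_ (measure_mono hsub)
  rw [haarT_preimage_Ioo (by linarith [hθ.1]) (by linarith [hθ.2])]
  refine (ENNReal.ofReal_lt_ofReal_iff (div_pos (by linarith) (by linarith))).2 ?_
  have hP := H.le_apply (2 * n)
  have hNP : (N : ℝ) ≤ Ψ (s (2 * n)) := by
    have : Ψ (s n) ≤ Ψ (s (2 * n)) := H.monotone_apply (by omega)
    linarith
  -- The interval has normalized measure `1 / (400 * π * N * P ^ 2)` with `N ≤ P`. Two squarings pay
  -- for `P ^ 3` and for the constant `400 * 3.15 < 2000 ≤ P`.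
  have hP4 : Ψ (s (2 * n)) ^ 4 ≤ Ψ (s (2 * n + 2)) := by
    calc Ψ (s (2 * n)) ^ 4 = (Ψ (s (2 * n)) ^ 2) ^ 2 := by ring
      _ ≤ Ψ (s (2 * n + 1)) ^ 2 := by gcongr; exact H.sq_le _
      _ ≤ _ := H.sq_le _
  set P : ℝ := Ψ (s (2 * n))
  have hcP : c = 1 / P := rfl
  have he : (θ + w - (θ - w)) / (2 * Real.pi) = 1 / (400 * Real.pi * N * P ^ 2) := by
    rw [hw_def, hcP]
    field_simp
    ring
  rw [he]
  refine one_div_lt_one_div_of_lt (by positivity) (lt_of_lt_of_le ?_ hP4)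
  calc 400 * Real.pi * N * P ^ 2 ≤ 400 * 3.15 * P * P ^ 2 := by gcongr
    _ < P * P * P ^ 2 := by gcongr; linarith
    _ = P ^ 4 := by ring

/-- The jump of the log-modulus beside the `n`-th arc is at least the fixed amount `d` separating
levels `0` and `1`. Its contribution is scale invariant: a kernel of size `1 / c` over an arc of
length `c` gives `d / (20 * π)`. The later arcs cost at most `134 / Ψ (s (2 * n))`, eventually less
than half of this. -/
theorem exists_winding (H : IsLevelSequence Ψ α s) : ∃ δ : ℝ, 0 < δ ∧ δ ≤ 1 ∧ ∀ᶠ n in atTop,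
    δ ≤ conjugateIntegral (logModulus Ψ s) (Real.log (modulusValue Ψ s n))
        ((1 / 2 : ℝ) ^ n + 2 * arcLength Ψ s n / 3) -
      conjugateIntegral (logModulus Ψ s) (Real.log (modulusValue Ψ s n))
        ((1 / 2 : ℝ) ^ n + arcLength Ψ s n / 3) := by
  have hpi := Real.pi_gt_three
  set d : ℝ := Real.log (modulusValue Ψ s 1) - Real.log (modulusValue Ψ s 0) with hd
  have hd0 : 0 < d := sub_pos.2 H.log_modulusValue_zero_lt_one
  have hd1 : d ≤ 1 := by
    linarith [H.log_modulusValue_neg 1, H.neg_one_le_log_modulusValue 0]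
  refine ⟨d / (40 * Real.pi), by positivity,
    (div_le_one (by positivity)).2 (by linarith), ?_⟩
  have hlim : Tendsto (fun n : ℕ => Ψ (s n)) atTop atTop := by
    have := tendsto_div_pow_atTop H.base H.sq_le 1 le_rfl
    simpa using this
  filter_upwards [hlim.eventually_ge_atTop (134 / (d / (40 * Real.pi))), eventually_ge_atTop 1]
    with n hn hn1
  have hc := H.arcLength_pos n
  have hP := H.le_apply (2 * n)
  have hidx : ∀ t, angle t ∈ Ioo ((1 / 2 : ℝ) ^ n) ((1 / 2 : ℝ) ^ n + arcLength Ψ s n) →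
      arcIndex Ψ s t = n := fun t ht => label_eq_of_mem H.two_mul_arcLength_le hn1 ht
  have hmain := le_conjugateIntegral_sub (g := logModulus Ψ s)
    (R := Real.log (modulusValue Ψ s n)) (δ := d) (Q := {t | n < arcIndex Ψ s t}) hc
    (H.two_mul_arcLength_le n) (half_pow_le_half hn1) H.measurable_logModulus
    (fun t ht => by rw [logModulus, hidx t ht]) (fun t => by
      have h1 := H.log_modulusValue_neg n
      have h2 := H.neg_one_le_log_modulusValue n
      have h3 : logModulus Ψ s t < 0 := H.log_modulusValue_neg _
      have h4 : -1 ≤ logModulus Ψ s t := H.neg_one_le_log_modulusValue _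
      rw [abs_le]
      constructor <;> linarith)
    (fun t ht => by
      have h0 : arcIndex Ψ s t = 0 := label_eq_zero_of_mem H.two_mul_arcLength_le ht
      rw [logModulus, h0]
      linarith [H.log_modulusValue_mono hn1])
    hd0.le (H.measurable_arcIndex (measurableSet_Ioi (a := n))) (fun t ht => by
      rw [mem_ofPred_eq, not_lt] at ht
      exact sub_nonneg.2 (H.log_modulusValue_mono ht))
  refine le_trans ?_ hmain
  have hQ : 67 / arcLength Ψ s n * haarT.real {t | n < arcIndex Ψ s t} ≤ d / (40 * Real.pi) := by
    calc _ ≤ 67 / arcLength Ψ s n * (2 * arcLength Ψ s n / Ψ (s (2 * n))) := by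
          gcongr
          exact H.haarT_real_later_arcs_le n
      _ = 134 / Ψ (s (2 * n)) := by field_simp; norm_num
      _ ≤ _ := by
          rw [div_le_iff₀ (by linarith)]
          rw [div_le_iff₀ (by positivity)] at hn
          have : Ψ (s n) ≤ Ψ (s (2 * n)) := H.monotone_apply (by omega)
          have h2 : 0 < d / (40 * Real.pi) := by positivity
          nlinarith
  have h2 : d / (20 * Real.pi) = d / (40 * Real.pi) + d / (40 * Real.pi) := by
    field_simp; ring
  linarith

/-! ### Counting peaks against their norms -/

theorem not_isPSumming (H : IsLevelSequence Ψ α s) {T : hardyOrlicz Ψ →L[ℂ] hardyOrlicz Ψ}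
    (hT : ∀ f, boundary (T f) =ᵐ[haarT] fun t => diskExt f (symbolBoundary Ψ s t)) {p : ℝ}
    (hp : 1 ≤ p) : ¬ IsPSumming p T := by
  intro hsum
  have hpi := Real.pi_gt_three
  obtain ⟨D, hD⟩ := hsum.exists_card_mul_le hp
  obtain ⟨δ, hδ0, hδ1, hwind⟩ := H.exists_winding
  have hα0 : 0 < α := one_pos.trans H.one_lt
  -- The lower bound `1 / (16 * s (2 * n + 2))` for the norm of an image has `p`-th power `1 / (E *
  -- B ^ n)`.
  set B : ℝ := (α ^ 2) ^ p with hB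
  have hB1 : 1 ≤ B := Real.one_le_rpow (one_le_pow₀ H.one_lt.le) (by linarith)
  set E : ℝ := (16 * s 2) ^ p with hE
  have hs2 := H.pos 2
  have hE0 : 0 < E := by positivity
  have hlim := tendsto_div_pow_atTop H.base H.sq_le B hB1
  have hlim1 : Tendsto (fun n : ℕ => Ψ (s n)) atTop atTop := by
    simpa using tendsto_div_pow_atTop H.base H.sq_le 1 le_rfl
  obtain ⟨n, hn, hwn, hnD, hn2⟩ := ((eventually_ge_atTop 1).and (hwind.and
    ((hlim.eventually_gt_atTop (32 * Real.pi / δ * (D * E))).and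
      (hlim1.eventually_ge_atTop (32 * Real.pi / δ))))).exists
  have hP := H.le_apply n
  set P : ℝ := Ψ (s n)
  set N : ℕ := ⌊P / 4⌋₊
  have hN4 : 4 * (N : ℝ) ≤ P := by
    have := Nat.floor_le (show 0 ≤ P / 4 by linarith)
    linarith
  have hN8 : P / 8 ≤ N := by
    have := Nat.lt_floor_add_one (P / 4)
    have h : (N : ℝ) = ⌊P / 4⌋₊ := rfl
    linarith
  have hNpos : (0 : ℝ) < N := by linarith
  have hN0 : N ≠ 0 := by
    intro h; rw [h, Nat.cast_zero] at hNpos; exact lt_irrefl _ hNpos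
  -- The number of peaks with spacing `2π / N` that fit into an interval of arguments of length `δ`;
  -- it is at least a fixed multiple of `Ψ (s n)`.
  set M : ℕ := ⌊δ * N / (2 * Real.pi)⌋₊
  have hMle : (M : ℝ) ≤ δ * N / (2 * Real.pi) := Nat.floor_le (by positivity)
  have hMN : M ≤ N := by
    have : (M : ℝ) ≤ N := hMle.trans (by
      rw [div_le_iff₀ (by positivity)]
      nlinarith)
    exact_mod_cast this
  have hMP : δ / (32 * Real.pi) * P ≤ M := by
    have h1 := Nat.lt_floor_add_one (δ * N / (2 * Real.pi))
    have h2 : (M : ℝ) = ⌊δ * N / (2 * Real.pi)⌋₊ := rfl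
    have h3 : δ * (P / 8) / (2 * Real.pi) ≤ δ * N / (2 * Real.pi) := by gcongr
    have h4 : δ * (P / 8) / (2 * Real.pi) = 2 * (δ / (32 * Real.pi) * P) := by
      field_simp; norm_num
    have h5 : 1 ≤ δ / (32 * Real.pi) * P := by
      rw [div_le_iff₀ hδ0] at hn2
      rw [div_mul_eq_mul_div, le_div_iff₀ (by positivity)]
      linarith
    linarith
  obtain ⟨v, hv⟩ := H.exists_large_peaks (Nat.one_le_iff_ne_zero.1 hn) hN0 hN4 hwn
  have hx := hD M (fun k => entireElement Ψ
    (differentiable_fejerPeak N (v + 2 * Real.pi * k / N))) (1 / 16 / s (2 * n + 2))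
    (by
      have hb := ae_all_iff.2 fun k : Fin M => boundary_entireElement (Ψ := Ψ)
        (differentiable_fejerPeak N (v + 2 * Real.pi * k / N))
      filter_upwards [hb] with t ht
      simp only [ht]
      exact sum_norm_fejerPeak_le hMN hN0 v (norm_circlePoint t).le)
    (div_nonneg (by norm_num) (H.pos _).le)
    (fun k => by
      have hk : 2 * Real.pi * k / N ≤ δ := by
        have h1 : ((k : ℕ) : ℝ) ≤ M := by exact_mod_cast k.2.le
        have h2 := h1.trans hMle
        rw [le_div_iff₀ (by positivity)] at h2
        rw [div_le_iff₀ hNpos]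
        linarith
      refine le_norm_of_le_on (f := (T _).1) (by norm_num) (H.pos _)
        (hv (2 * Real.pi * k / N) (by positivity) hk) ?_
      filter_upwards [hT (entireElement Ψ
        (differentiable_fejerPeak N (v + 2 * Real.pi * k / N))),
        H.controlledSymbol.mem_disk] with t h1 h2 h3
      have h4 : boundary (T (entireElement Ψ
        (differentiable_fejerPeak N (v + 2 * Real.pi * k / N)))) t =
          fejerPeak N (v + 2 * Real.pi * k / N) (symbolBoundary Ψ s t) := by
        rw [h1, diskExt_entireElement _ h2]
      exact h3.trans_eq (congrArg norm h4).symm)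
  have hpow : (1 / 16 / s (2 * n + 2)) ^ p = 1 / (E * B ^ n) := by
    rw [show 2 * n + 2 = 2 + 2 * n by ring, H.eq_mul_pow, div_div,
      show 16 * (α ^ (2 * n) * s 2) = 16 * s 2 * (α ^ 2) ^ n by rw [pow_mul]; ring,
      Real.div_rpow zero_le_one (by positivity), Real.one_rpow,
      Real.mul_rpow (by positivity) (by positivity), hE, hB,
      Real.rpow_pow_comm (by positivity)]
  rw [hpow, mul_one_div, div_le_iff₀ (by positivity)] at hx
  have hBn : 0 < B ^ n := by positivity
  rw [lt_div_iff₀ hBn] at hnD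
  -- The level `n` was chosen so that the lower bound for `M` exceeds `D * (E * B ^ n)`, the largest
  -- number of peaks that summability allows.
  have h6 : δ / (32 * Real.pi) * (32 * Real.pi / δ * (D * E) * B ^ n) <
      δ / (32 * Real.pi) * P := by gcongr
  have h7 : δ / (32 * Real.pi) * (32 * Real.pi / δ * (D * E) * B ^ n) = D * (E * B ^ n) := by
    field_simp
  linarith

end IsLevelSequence

end

end HardyOrlicz

end

theorem mainTheorem2 (Ψ : HardyOrlicz.OrliczFunction) (hΨ : Ψ.DeltaSupTwo) :
    ∃ φ : ℂ → ℂ, DifferentiableOn ℂ φ HardyOrlicz.disk ∧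
      Set.MapsTo φ HardyOrlicz.disk HardyOrlicz.disk ∧
      (∃ h : HardyOrlicz.Torus → ℝ,
        HardyOrlicz.IsPiecewiseConstant h ∧ HardyOrlicz.IsOuterWithModulus φ h) ∧
      ∃ T : HardyOrlicz.hardyOrlicz Ψ →L[ℂ] HardyOrlicz.hardyOrlicz Ψ,
        HardyOrlicz.IsCompositionOperator φ T ∧
        HardyOrlicz.IsOrderBoundedIntoMorseTransue T ∧
        IsCompactOperator T ∧
        ∀ p : ℝ, 1 ≤ p → ¬ HardyOrlicz.IsPSumming p T := by
  obtain ⟨α, s, H⟩ := hΨ.exists_isLevelSequence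
  obtain ⟨T, hT, hord, hcomp, hbd⟩ := H.controlledSymbol.exists_compositionOperator
  exact ⟨_, H.controlledSymbol.differentiableOn, H.controlledSymbol.mapsTo,
    ⟨_, H.isPiecewiseConstant, H.integrable_logModulus, fun z _ => rfl⟩, T, hT, hord, hcomp,
    fun p hp => H.not_isPSumming hbd hp⟩
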